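/- **Setting.** Let $f(x,y)=f_1(x,y)+f_2(x)$ and $\tilde f(x,y)=\tilde f_1(x,y)+\tilde f_2(y)$ with $f_1,\tilde f_1:\mathbb R^n\times\mathbb R^m\to\mathbb R$, and with $f_2:\mathbb R^n\to\mathbb R\cup\{\infty\}$, $\tilde f_2:\mathbb R^m\to\mathbb R\cup\{\infty\}$ proper closed convex functions whose domains $\mathcal X=\mathrm{dom}\,f_2$ and $\mathcal Y=\mathrm{dom}\,\tilde f_2$ are compact. Assume that $f,\tilde f$ are continuous on $\mathcal X\times\mathcal Y$, that $\tilde f_1(x,\cdot)$ is convex on $\mathcal Y$ for every $x\in\mathcal X$, and that on $\mathcal X\times\mathcal Y$ the functions $f_1,\tilde f_1$ are differentiable with $L_{\nabla f_1}$- and $L_{\nabla\tilde f_1}$-Lipschitz gradients ($L_{\nabla f_1},L_{\nabla\tilde f_1}\ge0$, not both $0$). Consider the bilevel problem $f^*=\min\{f(x,y): y\in\operatorname{argmin}_z\tilde f(x,z)\}$. Put $D_{\mathbf x}=\operatorname{diam}\mathcal X$, $D_{\mathbf y}=\operatorname{diam}\mathcal Y$, assume $D_{\mathbf y}>0$, and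 let $\tilde f_{\rm hi}=\max_{\mathcal X\times\mathcal Y}\tilde f$, $\tilde f_{\rm low}=\min_{\mathcal X\times\mathcal Y}\tilde f$, $f_{\rm low}=\min_{\mathcal X\times\mathcal Y}f$. Evaluations of $\nabla f_1,\nabla\tilde f_1$ are answered by maps $G,\tilde G:\mathbb R^{n+m}\to\mathbb R^{n+m}$ that equal $\nabla f_1,\nabla\tilde f_1$ on $\mathcal X\times\mathcal Y$ and are $L_{\nabla f_1}$-, $L_{\nabla\tilde f_1}$-Lipschitz on the whole space (the gradients themselves if $f_1,\tilde f_1$ are smooth with these constants everywhere). For a lower semicontinuous $\phi$ and $x\in\mathrm{dom}\,\phi$, $\partial\phi(x)=\{s:\langle s,d\rangle\le\phi'(x;d)\ \forall d\}$ with the upper subderivative $\phi'(x;d)=\lim_{r\downarrow0}\limsup_{x'\to x,\,\phi(x')\to\phi(x),\,t\downarrow0}\ \inf_{\|d'-d\|<r}\frac{\phi(x'+td')-\phi(x')}{t}$. Products carry the Euclidean norm, $\mathrm{prox}_\phi(x)=\operatorname{argmin}_v\{\tfrac12\|v-x\|^2+\phi(v)\}$, and an evaluation of $\mathrm{prox}_{\gamma\phi}$,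 $\gamma>0$, counts as one evaluation of the proximal operator of $\phi$. **Algorithm M1** (for $\min_x\max_y\bar h(x,y)+p(x)-q(y)$; parameters $\sigma_x,\sigma_y,L,\tau>0$, start $(z^0,y^0)$). Let $\hat h=\bar h-\frac{\sigma_x}2\|x\|^2+\frac{\sigma_y}2\|y\|^2$, $\bar\alpha=\min\{1,\sqrt{8\sigma_y/\sigma_x}\}$, $\eta_z=\sigma_x/2$, $\eta_y=\min\{\frac1{2\sigma_y},\frac4{\bar\alpha\sigma_x}\}$, $\beta_t=\frac2{t+3}$, $\zeta=(2\sqrt5(1+8L/\sigma_x))^{-1}$, $\gamma=8/\sigma_x$, $\hat\zeta=\min\{\sigma_x,\sigma_y\}/L^2$, $(z^0_f,y^0_f)=(z^0,y^0)$. For $k=0,1,\dots$: 1. $(z_g,y_g)=\bar\alpha(z^k,y^k)+(1-\bar\alpha)(z^k_f,y^k_f)$, and $(x^{-1},y^{-1})=(-z_g/\sigma_x,\,y_g)$. Write $a_x(x,y)=\nabla_x\hat h(x,y)+\frac{\sigma_x}2(x-z_g/\sigma_x)$, $a_y(x,y)=-\nabla_y\hat h(x,y)+\sigma_yy+\frac{\sigma_x}8(y-y_g)$,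 $a=(a_x,a_y)$, $u=(x,y)$, and $J(v_x,v_y)=(\mathrm{prox}_{\zeta\gamma p}(v_x),\mathrm{prox}_{\zeta\gamma q}(v_y))$. 2. With $v=u^{-1}-\zeta\gamma a(u^{-1})$ put $u^0=J(v)$, $b^0=(v-u^0)/(\zeta\gamma)$, $t=0$ (here $u^t=(x^t,y^t)$ are inner iterates). While $\gamma\|a(u^t)+b^t\|^2>\gamma^{-1}\|u^t-u^{-1}\|^2$: $c=u^t+\beta_t(u^0-u^t)$, $u^{t+1/2}=c-\zeta\gamma(a(u^t)+b^t)$, $v=c-\zeta\gamma a(u^{t+1/2})$, $u^{t+1}=J(v)$, $b^{t+1}=(v-u^{t+1})/(\zeta\gamma)$, $t\leftarrow t+1$. 3. $(x_f,y_f)=u^t$, $z_f=\nabla_x\hat h(x_f,y_f)+b^t_x$, $w_f=-\nabla_y\hat h(x_f,y_f)+b^t_y$, $(z^{k+1}_f,y^{k+1}_f)=(z_f,y_f)$, $z^{k+1}=z^k+\frac{\eta_z}{\sigma_x}(z_f-z^k)-\eta_z(x_f+\frac{z_f}{\sigma_x})$, $y^{k+1}=y^k+\eta_y\sigma_y(y_f-y^k)-\eta_y(w_f+\sigma_yy_f)$,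 $x^{k+1}=-z^{k+1}/\sigma_x$. 4. $\hat x=\mathrm{prox}_{\hat\zeta p}(x^{k+1}-\hat\zeta\nabla_x\bar h(x^{k+1},y^{k+1}))$, $\hat y=\mathrm{prox}_{\hat\zeta q}(y^{k+1}+\hat\zeta\nabla_y\bar h(x^{k+1},y^{k+1}))$. Stop and output $(\hat x,\hat y)$ if $\|\hat\zeta^{-1}(x^{k+1}-\hat x,\hat y-y^{k+1})-(\nabla\bar h(x^{k+1},y^{k+1})-\nabla\bar h(\hat x,\hat y))\|\le\tau$. **Algorithm M2** (for $\min_x\max_yh(x,y)+p(x)-q(y)$; parameters $L_h,D_q,\varepsilon,\varepsilon_0>0$, start $(x^0,y^0)$). For $k=0,1,\dots$: let $(x^{k+1},y^{k+1})$ be the output of M1 for $\bar h=h-\frac{\varepsilon}{4D_q}\|y-y^0\|^2+L_h\|x-x^k\|^2$ with $\tau=\varepsilon_0/(k+1)$, $\sigma_x=L_h$, $\sigma_y=\frac{\varepsilon}{2D_q}$, $L=3L_h+\frac{\varepsilon}{2D_q}$, started at $(-\sigma_xx^k,y^k)$; stop and output it if $\|x^{k+1}-x^k\|\le\varepsilon/(4L_h)$.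 **Penalty method** (for $\varepsilon\in(0,1/4]$, $\rho=\varepsilon^{-1}$, and $(x^0,y^0)\in\mathcal X\times\mathcal Y$ with $\tilde f(x^0,y^0)\le\min_y\tilde f(x^0,y)+\varepsilon$). Apply M2 to $\min_{x,y}\max_z f(x,y)+\rho(\tilde f(x,y)-\tilde f(x,z))$, that is, with $h(x,y,z)=f_1(x,y)+\rho\tilde f_1(x,y)-\rho\tilde f_1(x,z)$, $p(x,y)=f_2(x)+\rho\tilde f_2(y)$, $q(z)=\rho\tilde f_2(z)$, minimization variable $(x,y)$ and maximization variable $z$, starting point $((x^0,y^0),y^0)$, $\varepsilon_0=\varepsilon^{3/2}$, $D_q=D_{\mathbf y}$, $L_h=\widehat L$; the output is $(x_\varepsilon,y_\varepsilon)$ together with $z_\varepsilon$. **Constants.** With $t_+=\max\{t,0\}$, $$\widehat L=L_{\nabla f_1}+2\varepsilon^{-1}L_{\nabla\tilde f_1},\qquad \hat\alpha=\min\Big\{1,\sqrt{4\varepsilon/(D_{\mathbf y}\widehat L)}\Big\},$$ $$\hat\delta=(2+\hat\alpha^{-1})(D_{\mathbf x}^2+D_{\mathbf y}^2)\widehat L+\max\{\varepsilon/D_{\mathbf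 y},\hat\alpha\widehat L/4\}D_{\mathbf y}^2,$$ $$\widehat C=\frac{4\max\big\{\frac1{2\widehat L},\min\{\frac{D_{\mathbf y}}\varepsilon,\frac4{\hat\alpha\widehat L}\}\big\}\big[\hat\delta+2\hat\alpha^{-1}(f^*-f_{\rm low}+\varepsilon^{-1}(\tilde f_{\rm hi}-\tilde f_{\rm low})+\varepsilon D_{\mathbf y}/4+\widehat L(D_{\mathbf x}^2+D_{\mathbf y}^2))\big]}{\big[(3\widehat L+\frac{\varepsilon}{2D_{\mathbf y}})^2/\min\{\widehat L,\frac{\varepsilon}{2D_{\mathbf y}}\}+3\widehat L+\frac{\varepsilon}{2D_{\mathbf y}}\big]^{-2}\varepsilon^3},$$ $$\widehat K=\Big\lceil16\big(1+f(x^0,y^0)-f_{\rm low}+\varepsilon D_{\mathbf y}/4\big)\widehat L\varepsilon^{-2}+32\big(1+4D_{\mathbf y}^2\widehat L^2\varepsilon^{-2}\big)\varepsilon-1\Big\rceil_+,$$ $$\widehat N=\Big(\Big\lceil96\sqrt2\big(1+(24\widehat L+4\varepsilon/D_{\mathbf y})\widehat L^{-1}\big)\Big\rceil+2\Big)\max\Big\{2,\sqrt{D_{\mathbf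 y}\widehat L\varepsilon^{-1}}\Big\}\Big((\widehat K+1)(\log\widehat C)_++\widehat K+1+2\widehat K\log(\widehat K+1)\Big),$$ $$\Gamma=1+f(x^0,y^0)-f_{\rm low}+2\varepsilon^3\big(\widehat L^{-1}+4D_{\mathbf y}^2\widehat L\varepsilon^{-2}\big)+D_{\mathbf y}\varepsilon/4 .$$ **Theorem.** (1) For all such $\varepsilon$ and $(x^0,y^0)$ the penalty method terminates, and its output satisfies $$\mathrm{dist}\big(0,\ \partial f(x_\varepsilon,y_\varepsilon)+\rho\,\partial\tilde f(x_\varepsilon,y_\varepsilon)-(\rho\nabla_x\tilde f(x_\varepsilon,z_\varepsilon);0)\big)\le\varepsilon,\qquad \mathrm{dist}\big(0,\rho\,\partial_z\tilde f(x_\varepsilon,z_\varepsilon)\big)\le\varepsilon,$$ $$\tilde f(x_\varepsilon,y_\varepsilon)\le\min_z\tilde f(x_\varepsilon,z)+\varepsilon\,\Gamma ,$$ where $\nabla_x\tilde f=\nabla_x\tilde f_1$; and the method performs at most $\widehat N$ evaluations of $\nabla f_1$, at most $\widehat N$ of $\nabla\tilde f_1$, at most $\widehat N$ of the proximal operator of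 $f_2$, and at most $\widehat N$ of the proximal operator of $\tilde f_2$. (2) There is a constant $C$, independent of $\varepsilon$ and of $(x^0,y^0)$, such that $\widehat N\le C\,\varepsilon^{-4}\log\varepsilon^{-1}$ and $\Gamma\le C$ for all $\varepsilon\in(0,1/4]$ and $(x^0,y^0)\in\mathcal X\times\mathcal Y$. Hence the suboptimality at the lower level is $O(\varepsilon)$ and the number of evaluations is $O(\varepsilon^{-4}\log\varepsilon^{-1})$. -/

import Mathlib

open Set Filter Topology
open scoped Pointwise

noncomputable section

namespace Bilevel

/-! ### Euclidean spaces -/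

/-- The Euclidean space `ℝⁿ`. -/
abbrev Vec (n : ℕ) : Type := EuclideanSpace ℝ (Fin n)

/-- `ℝⁿ × ℝᵐ` with the Euclidean norm of the stacked vector. -/
abbrev Pair (n m : ℕ) : Type := WithLp 2 (Vec n × Vec m)

/-- The stacked vector `(x; y)`. -/
abbrev stack {n m : ℕ} (x : Vec n) (y : Vec m) : Pair n m := WithLp.toLp 2 (x, y)

/-! ### Extended real valued functions -/

section Convex

variable {E : Type} [NormedAddCommGroup E] [InnerProductSpace ℝ E]

/-- The domain `{x | φ x < ∞}`. -/
def effDom (φ : E → EReal) : Set E := {x | φ x < ⊤}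

/-- `φ : E → ℝ ∪ {∞}` is proper, closed (lower semicontinuous) and convex (convex epigraph). -/
structure IsProperClosedConvex (φ : E → EReal) : Prop where
  ne_bot : ∀ x, φ x ≠ ⊥
  nonempty_dom : (effDom φ).Nonempty
  closed : LowerSemicontinuous φ
  convex : Convex ℝ {p : E × ℝ | φ p.1 ≤ (p.2 : EReal)}

/-- The upper subderivative of `φ` at `x` in the direction `d`:
the limit, as the radius `r` decreases to zero (that is, the supremum over `r > 0`), of
`limsup inf_{‖d' - d‖ < r} (φ (x' + t d') - φ x') / t`, where `x' → x`, `φ x' → φ x`, `t ↓ 0`. -/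
def upperSubderivative (φ : E → EReal) (x d : E) : EReal :=
  ⨆ (r : ℝ) (_ : 0 < r),
    limsup (fun q : E × ℝ =>
        ⨅ d' ∈ Metric.ball d r, (φ (q.1 + q.2 • d') - φ q.1) / (q.2 : EReal))
      ((𝓝 x ⊓ comap φ (𝓝 (φ x))) ×ˢ 𝓝[>] (0 : ℝ))

/-- The subdifferential of `φ` at a point `x` of its domain (and the empty set elsewhere). -/
def subdifferential (φ : E → EReal) (x : E) : Set E :=
  {s | x ∈ effDom φ ∧ ∀ d : E, ((inner ℝ s d : ℝ) : EReal) ≤ upperSubderivative φ x d}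

/-- `u` minimizes `‖v - x‖² / 2 + γ φ v` over all `v`. -/
def IsProx (γ : ℝ) (φ : E → EReal) (x u : E) : Prop :=
  ∀ v, ((‖u - x‖ ^ 2 / 2 : ℝ) : EReal) + (γ : EReal) * φ u
    ≤ ((‖v - x‖ ^ 2 / 2 : ℝ) : EReal) + (γ : EReal) * φ v

/-- The proximal operator of `γ φ`. -/
def prox (γ : ℝ) (φ : E → EReal) (x : E) : E := Classical.epsilon (IsProx γ φ x)

/-- `φ` is differentiable at the points of `S` and its gradient is `L`-Lipschitz on `S`. -/
def SmoothOn [CompleteSpace E] (L : ℝ) (φ : E → ℝ) (S : Set E) : Prop :=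
  (∀ u ∈ S, DifferentiableAt ℝ φ u) ∧
    ∀ u ∈ S, ∀ v ∈ S, ‖gradient φ u - gradient φ v‖ ≤ L * ‖u - v‖

/-- The map `g` answers gradient queries for `φ`: on `S` it returns the gradient of `φ`, and it is
`L`-Lipschitz on the whole space. If `φ` is `L`-smooth on the whole space, `g = ∇φ` is such a map;
if `φ` is only known to be `L`-smooth on a closed convex set `S`, then `∇φ` composed with the
projection onto `S` is such a map. -/
def IsGradientOracle [CompleteSpace E] (L : ℝ) (φ : E → ℝ) (S : Set E) (g : E → E) : Prop :=
  (∀ u ∈ S, g u = gradient φ u) ∧ ∀ u v, ‖g u - g v‖ ≤ L * ‖u - v‖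

end Convex

/-! ### Programs with oracle queries -/

/-- Numbers of evaluations of `∇f₁`, `∇f̃₁`, of the proximal operator of `f₂` and of that of
`f̃₂`. -/
structure Cost where
  gradF : ℕ
  gradFt : ℕ
  proxF : ℕ
  proxFt : ℕ

/-- A possibly non-terminating computation that counts its oracle queries. -/
abbrev Run : Type → Type := StateT Cost Part

/-- One pass of a loop, as a partial function on states paired with the cost so far. -/
def Run.pass {σ β : Type} (body : σ → Run (β ⊕ σ)) : σ × Cost →. (β × Cost) ⊕ (σ × Cost) :=
  fun sc => (body sc.1 sc.2).map fun rc =>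
    match rc.1 with
    | Sum.inl b => Sum.inl (b, rc.2)
    | Sum.inr s' => Sum.inr (s', rc.2)

/-- Repeat `body` until it returns a result (`Sum.inl`); `Sum.inr` is the state for the next pass.
The value is undefined if the loop, or one of its passes, does not terminate. -/
def Run.loop {σ β : Type} (body : σ → Run (β ⊕ σ)) (s : σ) : Run β := fun c =>
  PFun.fix (Run.pass body) (s, c)

/-! ### A first-order method for nonconvex-concave minimax problems

The problem is `min_x max_y h x y + p x - q y`; it is accessed only through the oracles below. -/

/-- Access to `∇h = (∇ₓh, ∇ᵧh)` and to the proximal operators of `γ p` and `γ q`, `γ > 0`. -/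
structure SaddleOracle (X Y : Type) where
  grad : X → Y → Run (X × Y)
  proxP : ℝ → X → Run X
  proxQ : ℝ → Y → Run Y

section Minimax

variable {X Y : Type} [NormedAddCommGroup X] [InnerProductSpace ℝ X]
  [NormedAddCommGroup Y] [InnerProductSpace ℝ Y]

/-- The gradient of `ĥ(x, y) = h̄(x, y) - σx ‖x‖² / 2 + σy ‖y‖² / 2`, from one evaluation
of `∇h̄`. -/
def gradHat (O : SaddleOracle X Y) (σx σy : ℝ) (x : X) (y : Y) : Run (X × Y) := do
  let g ← O.grad x y
  pure (g.1 - σx • x, g.2 + σy • y)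

/-- The state `(xᵗ, yᵗ)`, `∇ĥ(xᵗ, yᵗ)`, `(bₓᵗ, bᵧᵗ)` of the inner loop. -/
structure InnerState (X Y : Type) where
  t : ℕ
  x : X
  y : Y
  g : X × Y
  bX : X
  bY : Y

/-- The state `(zᵏ, yᵏ)`, `(z_fᵏ, y_fᵏ)` of the outer loop. -/
structure OuterState (X Y : Type) where
  z : X
  y : Y
  zf : X
  yf : Y

/-- The inner stage of an iteration of `optimalMethod`, started from `(z_g, y_g)`. It returns the
last iterate together with `∇ĥ` there and the subgradients `(bₓ, bᵧ)`. -/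
def innerStage (O : SaddleOracle X Y) (σx σy L : ℝ) (zg : X) (yg : Y) :
    Run (InnerState X Y) := do
  let ζ : ℝ := (2 * √5 * (1 + 8 * L / σx))⁻¹
  let γ : ℝ := 8 * σx⁻¹
  let aX : X × Y → X → X := fun g x => g.1 + (σx / 2) • (x - σx⁻¹ • zg)
  let aY : X × Y → Y → Y := fun g y => -g.2 + σy • y + (σx / 8) • (y - yg)
  let xm : X := -(σx⁻¹ • zg)
  let ym : Y := yg
  let gm ← gradHat O σx σy xm ym
  let vx : X := xm - (ζ * γ) • aX gm xm
  let vy : Y := ym - (ζ * γ) • aY gm ym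
  let x₀ ← O.proxP (ζ * γ) vx
  let y₀ ← O.proxQ (ζ * γ) vy
  let g₀ ← gradHat O σx σy x₀ y₀
  Run.loop (fun s : InnerState X Y =>
    if γ * ‖aX s.g s.x + s.bX‖ ^ 2 + γ * ‖aY s.g s.y + s.bY‖ ^ 2
        ≤ γ⁻¹ * ‖s.x - xm‖ ^ 2 + γ⁻¹ * ‖s.y - ym‖ ^ 2 then
      pure (Sum.inl s)
    else do
      let β : ℝ := 2 / ((s.t : ℝ) + 3)
      let cx : X := s.x + β • (x₀ - s.x)
      let cy : Y := s.y + β • (y₀ - s.y)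
      let xh : X := cx - (ζ * γ) • (aX s.g s.x + s.bX)
      let yh : Y := cy - (ζ * γ) • (aY s.g s.y + s.bY)
      let gh ← gradHat O σx σy xh yh
      let vx' : X := cx - (ζ * γ) • aX gh xh
      let vy' : Y := cy - (ζ * γ) • aY gh yh
      let x' ← O.proxP (ζ * γ) vx'
      let y' ← O.proxQ (ζ * γ) vy'
      let g' ← gradHat O σx σy x' y'
      pure (Sum.inr
        { t := s.t + 1, x := x', y := y', g := g',
          bX := (ζ * γ)⁻¹ • (vx' - x'), bY := (ζ * γ)⁻¹ • (vy' - y') }))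
    { t := 0, x := x₀, y := y₀, g := g₀,
      bX := (ζ * γ)⁻¹ • (vx - x₀), bY := (ζ * γ)⁻¹ • (vy - y₀) }

/-- The modified optimal first-order method for a `σx`-strongly-convex-`σy`-strongly-concave
problem `min_x max_y h̄ x y + p x - q y` with `L`-smooth `h̄`, tolerance `τ` and starting point
`(z⁰, y⁰)`. -/
def optimalMethod (O : SaddleOracle X Y) (σx σy L τ : ℝ) (z₀ : X) (y₀ : Y) : Run (X × Y) :=
  let α : ℝ := min 1 √(8 * σy / σx)
  let ηz : ℝ := σx / 2
  let ηy : ℝ := min (1 / (2 * σy)) (4 / (α * σx))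
  let ζh : ℝ := min σx σy / L ^ 2
  Run.loop (fun s : OuterState X Y => do
    let zg : X := α • s.z + (1 - α) • s.zf
    let yg : Y := α • s.y + (1 - α) • s.yf
    let r ← innerStage O σx σy L zg yg
    let xf : X := r.x
    let yf : Y := r.y
    let zf : X := r.g.1 + r.bX
    let wf : Y := -r.g.2 + r.bY
    let z' : X := s.z + (ηz * σx⁻¹) • (zf - s.z) - ηz • (xf + σx⁻¹ • zf)
    let y' : Y := s.y + (ηy * σy) • (yf - s.y) - ηy • (wf + σy • yf)
    let x' : X := -(σx⁻¹ • z')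
    let g ← O.grad x' y'
    let xh ← O.proxP ζh (x' - ζh • g.1)
    let yh ← O.proxQ ζh (y' + ζh • g.2)
    let gh ← O.grad xh yh
    if √(‖ζh⁻¹ • (x' - xh) - (g.1 - gh.1)‖ ^ 2 + ‖ζh⁻¹ • (yh - y') - (g.2 - gh.2)‖ ^ 2) ≤ τ then
      pure (Sum.inl (xh, yh))
    else
      pure (Sum.inr { z := z', y := y', zf := zf, yf := yf }))
    { z := z₀, y := y₀, zf := z₀, yf := y₀ }

/-- Oracles for the subproblem with
`h_k(x, y) = h(x, y) - ε ‖y - y⁰‖² / (4 Dq) + Lh ‖x - xᵏ‖²`. -/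
def subproblemOracle (O : SaddleOracle X Y) (Lh Dq ε : ℝ) (xk : X) (y₀ : Y) :
    SaddleOracle X Y where
  grad x y := do
    let g ← O.grad x y
    pure (g.1 + (2 * Lh) • (x - xk), g.2 - (ε / (2 * Dq)) • (y - y₀))
  proxP := O.proxP
  proxQ := O.proxQ

/-- The first-order method for `min_x max_y h x y + p x - q y`, where `h` is `Lh`-smooth and `Dq`
is the diameter of the domain of `q`. The loop state is `(k, xᵏ, yᵏ)`. -/
def minimaxMethod (O : SaddleOracle X Y) (Lh Dq ε ε₀ : ℝ) (x₀ : X) (y₀ : Y) : Run (X × Y) :=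
  Run.loop (fun s : ℕ × X × Y => do
    let r ← optimalMethod (subproblemOracle O Lh Dq ε s.2.1 y₀) Lh (ε / (2 * Dq))
      (3 * Lh + ε / (2 * Dq)) (ε₀ / ((s.1 : ℝ) + 1)) (-(Lh • s.2.1)) s.2.2
    if ‖r.1 - s.2.1‖ ≤ ε / (4 * Lh) then
      pure (Sum.inl r)
    else
      pure (Sum.inr (s.1 + 1, r.1, r.2)))
    (0, x₀, y₀)

end Minimax

/-! ### The bilevel problem -/

/-- The functions of the bilevel problem `min f(x, y)` subject to `y ∈ argmin_z f̃(x, z)`, with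
`f(x, y) = f₁(x, y) + f₂(x)` and `f̃(x, y) = f̃₁(x, y) + f̃₂(y)`. -/
structure Problem (n m : ℕ) where
  f₁ : Pair n m → ℝ
  f₂ : Vec n → EReal
  ft₁ : Pair n m → ℝ
  ft₂ : Vec m → EReal

namespace Problem

variable {n m : ℕ} (P : Problem n m)

/-- The upper level objective `f`. -/
def f (u : Pair n m) : EReal := (P.f₁ u : EReal) + P.f₂ u.fst

/-- The lower level objective `f̃`. -/
def ft (u : Pair n m) : EReal := (P.ft₁ u : EReal) + P.ft₂ u.snd

/-- `𝒳 = dom f₂`. -/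
def setX : Set (Vec n) := effDom P.f₂

/-- `𝒴 = dom f̃₂`. -/
def setY : Set (Vec m) := effDom P.ft₂

/-- `𝒳 × 𝒴`. -/
def setXY : Set (Pair n m) := {u | u.fst ∈ P.setX ∧ u.snd ∈ P.setY}

/-- The structural assumptions on the bilevel problem. -/
structure Assumption (Lf Lft : ℝ) : Prop where
  f_continuousOn : ContinuousOn P.f P.setXY
  ft_continuousOn : ContinuousOn P.ft P.setXY
  f₂_convex : IsProperClosedConvex P.f₂
  ft₂_convex : IsProperClosedConvex P.ft₂
  ft₁_convex : ∀ x ∈ P.setX, ConvexOn ℝ P.setY (fun y => P.ft₁ (stack x y))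
  f₁_smooth : SmoothOn Lf P.f₁ P.setXY
  ft₁_smooth : SmoothOn Lft P.ft₁ P.setXY
  Lf_nonneg : 0 ≤ Lf
  Lft_nonneg : 0 ≤ Lft
  compact_X : IsCompact P.setX
  compact_Y : IsCompact P.setY

/-- `D_x`, the diameter of `𝒳`. -/
def Dx : ℝ := Metric.diam P.setX

/-- `D_y`, the diameter of `𝒴`. -/
def Dy : ℝ := Metric.diam P.setY

/-- `f̃_hi`, the maximum of `f̃` over `𝒳 × 𝒴`. -/
def ftHi : ℝ := (⨆ u ∈ P.setXY, P.ft u).toReal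

/-- `f̃_low`, the minimum of `f̃` over `𝒳 × 𝒴`. -/
def ftLow : ℝ := (⨅ u ∈ P.setXY, P.ft u).toReal

/-- `f_low`, the minimum of `f` over `𝒳 × 𝒴`. -/
def fLow : ℝ := (⨅ u ∈ P.setXY, P.f u).toReal

/-- `min_z f̃(x, z)`. -/
def lowerValue (x : Vec n) : EReal := ⨅ z : Vec m, P.ft (stack x z)

/-- `f^*`, the optimal value of the bilevel problem. -/
def fStar : ℝ :=
  (⨅ (x : Vec n) (y : Vec m) (_ : ∀ z : Vec m, P.ft (stack x y) ≤ P.ft (stack x z)),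
    P.f (stack x y)).toReal

/-! ### The penalty method -/

/-- One evaluation of `∇f₁`, answered by `G`. -/
def queryGradF (G : Pair n m → Pair n m) (u : Pair n m) : Run (Pair n m) := fun c =>
  Part.some (G u, { c with gradF := c.gradF + 1 })

/-- One evaluation of `∇f̃₁`, answered by `Gt`. -/
def queryGradFt (Gt : Pair n m → Pair n m) (u : Pair n m) : Run (Pair n m) := fun c =>
  Part.some (Gt u, { c with gradFt := c.gradFt + 1 })

/-- One evaluation of the proximal operator of `f₂`. -/
def queryProxF (γ : ℝ) (x : Vec n) : Run (Vec n) := fun c =>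
  Part.some (prox γ P.f₂ x, { c with proxF := c.proxF + 1 })

/-- One evaluation of the proximal operator of `f̃₂`. -/
def queryProxFt (γ : ℝ) (y : Vec m) : Run (Vec m) := fun c =>
  Part.some (prox γ P.ft₂ y, { c with proxFt := c.proxFt + 1 })

/-- Oracles for the minimax problem `min_{x,y} max_z f(x, y) + ρ (f̃(x, y) - f̃(x, z))`:
`h(x, y, z) = f₁(x, y) + ρ f̃₁(x, y) - ρ f̃₁(x, z)`, `p(x, y) = f₂(x) + ρ f̃₂(y)`,
`q(z) = ρ f̃₂(z)`. -/
def penaltyOracle (G Gt : Pair n m → Pair n m) (ρ : ℝ) : SaddleOracle (Pair n m) (Vec m) where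
  grad u z := do
    let a ← queryGradF G u
    let b ← queryGradFt Gt u
    let c ← queryGradFt Gt (stack u.fst z)
    pure (a + ρ • b - ρ • stack c.fst 0, -(ρ • c.snd))
  proxP γ u := do
    let a ← P.queryProxF γ u.fst
    let b ← P.queryProxFt (γ * ρ) u.snd
    pure (stack a b)
  proxQ γ z := P.queryProxFt (γ * ρ) z

/-- `L̂ = L_{∇f₁} + 2 ε⁻¹ L_{∇f̃₁}`. -/
def Lhat (Lf Lft ε : ℝ) : ℝ := Lf + 2 * ε⁻¹ * Lft

/-- The practical penalty method with `ρ = ε⁻¹`, started from `(x⁰, y⁰)`. It returns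
`((x_ε, y_ε), z_ε)`. -/
def penaltyMethod (G Gt : Pair n m → Pair n m) (Lf Lft ε : ℝ) (x₀ : Vec n) (y₀ : Vec m) :
    Run (Pair n m × Vec m) :=
  minimaxMethod (P.penaltyOracle G Gt ε⁻¹) (Lhat Lf Lft ε) P.Dy ε (ε ^ (3 / 2 : ℝ))
    (stack x₀ y₀) y₀

/-! ### The constants of the complexity bound -/

/-- `α̂`. -/
def alphaHat (Lf Lft ε : ℝ) : ℝ := min 1 √(4 * ε / (P.Dy * Lhat Lf Lft ε))

/-- `δ̂`. -/
def deltaHat (Lf Lft ε : ℝ) : ℝ :=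
  (2 + (P.alphaHat Lf Lft ε)⁻¹) * (P.Dx ^ 2 + P.Dy ^ 2) * Lhat Lf Lft ε
    + max (ε / P.Dy) (P.alphaHat Lf Lft ε * Lhat Lf Lft ε / 4) * P.Dy ^ 2

/-- `Ĉ`. -/
def CHat (Lf Lft ε : ℝ) : ℝ :=
  let L := Lhat Lf Lft ε
  let α := P.alphaHat Lf Lft ε
  (4 * max (1 / (2 * L)) (min (P.Dy / ε) (4 / (α * L)))
      * (P.deltaHat Lf Lft ε
        + 2 * α⁻¹ * (P.fStar - P.fLow + ε⁻¹ * (P.ftHi - P.ftLow) + ε * P.Dy / 4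
          + L * (P.Dx ^ 2 + P.Dy ^ 2))))
    / ((((3 * L + ε / (2 * P.Dy)) ^ 2 / min L (ε / (2 * P.Dy)) + 3 * L + ε / (2 * P.Dy)) ^ 2)⁻¹
        * ε ^ 3)

/-- `K̂`; the natural number ceiling is `⌈·⌉₊ = max (⌈·⌉, 0)`. -/
def KHat (Lf Lft ε : ℝ) (x₀ : Vec n) (y₀ : Vec m) : ℕ :=
  let L := Lhat Lf Lft ε
  ⌈16 * (1 + (P.f (stack x₀ y₀)).toReal - P.fLow + ε * P.Dy / 4) * L * (ε ^ 2)⁻¹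
    + 32 * (1 + 4 * P.Dy ^ 2 * L ^ 2 * (ε ^ 2)⁻¹) * ε - 1⌉₊

/-- `N̂`. -/
def NHat (Lf Lft ε : ℝ) (x₀ : Vec n) (y₀ : Vec m) : ℝ :=
  let L := Lhat Lf Lft ε
  let K : ℝ := P.KHat Lf Lft ε x₀ y₀
  ((⌈96 * √2 * (1 + (24 * L + 4 * ε / P.Dy) * L⁻¹)⌉ : ℝ) + 2)
    * max 2 √(P.Dy * L * ε⁻¹)
    * ((K + 1) * max (Real.log (P.CHat Lf Lft ε)) 0 + K + 1 + 2 * K * Real.log (K + 1))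

/-- The factor of `ε` in the bound on the lower level suboptimality. -/
def gapFactor (Lf Lft ε : ℝ) (x₀ : Vec n) (y₀ : Vec m) : ℝ :=
  1 + (P.f (stack x₀ y₀)).toReal - P.fLow
    + 2 * ε ^ 3 * ((Lhat Lf Lft ε)⁻¹ + 4 * P.Dy ^ 2 * Lhat Lf Lft ε * (ε ^ 2)⁻¹) + P.Dy * ε / 4

/-- The set `∂f(x, y) + ρ ∂f̃(x, y) - (ρ ∇ₓf̃(x, z); 0)`, where `∇ₓf̃ = ∇ₓf̃₁`. -/
def upperStationarity (ρ : ℝ) (x : Vec n) (y z : Vec m) : Set (Pair n m) :=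
  subdifferential P.f (stack x y) + ρ • subdifferential P.ft (stack x y)
    - {stack (ρ • gradient (fun x' => P.ft₁ (stack x' z)) x) 0}

/-- The set `ρ ∂_z f̃(x, z)`. -/
def lowerStationarity (ρ : ℝ) (x : Vec n) (z : Vec m) : Set (Vec m) :=
  ρ • subdifferential (fun z' => P.ft (stack x z')) z

end Problem

end Bilevel

end

/-!
The penalty method runs a proximal point method on the primal function of
`min_{x,y} max_z f(x, y) + ρ (f̃(x, y) - f̃(x, z))`, whose subproblems are strongly convex in `(x, y)`
and strongly concave in `z` and are solved by an accelerated method with an inner loop. Each of the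
three loops has a potential that bounds its number of passes, and the evaluations are counted along
the way (`Run.Ensures.loop`).

* Inner loop. It is an anchored extragradient iteration for a monotone inclusion, with anchor the
  forward-backward step from the starting point. The potential `anchorPotential` does not increase
  (`anchorPotential_step`). As long as the relative accuracy is not reached, the anchor is within a
  multiple of the residual of the iterate, so that the potential grows quadratically in the number of
  passes and their number is at most `6 / ζ` (`anchor_terminates`). No solution of the inclusion is
  compared with, so the bound is an absolute one.

* Accelerated loop. In the variable `z = -σx x` the saddle problem becomes the minimization of a
  strongly convex function of `(z, y)`, the supremum of `dualValue` over `x`, and the point returned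
  by the inner stage carries an exact subgradient of this function. The relative accuracy of the inner
  stage makes the iteration an inexact accelerated proximal point method, whose potential contracts by
  the factor `1 - α / 2` (`outer_step`). The output test succeeds once the distance to the saddle
  point is small (`IsStrong.residual_le`), since the forward-backward map is Lipschitz on the whole
  space; this uses the Lipschitz bound for the oracle answers off the domain.

* Outer loop. A pass that does not end the loop moves by more than `ε / (4 L̂)`, which lowers the
  primal function by a fixed amount up to summable errors of order `ε₀² / (k + 1)²`
  (`IsWeak.primal_decrease`), and the primal function is bounded below.

At the output, the test of the accelerated loop provides subgradients with small residuals
(`IsApproxSaddle`); removing the regularization terms, which are at most `ε / 2`, gives the two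
stationarity bounds, because the gradient of a smooth function plus a convex subgradient lies in the
subdifferential (`add_mem_subdifferential`). The lower level gap comes from the bound on the primal
function at the output, divided by `ρ = ε⁻¹` (`Assumption.penaltyMethod_stationarity`).

For the asymptotic statement, every constant is compared with a power of `ε⁻¹` (`PolyBounded`): the
number of outer passes is of order `ε⁻³`, an accelerated loop takes of the order of `ε⁻¹ log ε⁻¹`
passes, and an inner stage takes boundedly many.
-/

namespace Bilevel

/-! ### Total correctness and query counts of programs -/

/-- Started with any cost, the program `r` terminates with a result satisfying `Q`; it makes at
most `g` evaluations of each of the two gradients and at most `p` of each of the two proximal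
operators. -/
def Run.Ensures {β : Type} (r : Run β) (g p : ℕ) (Q : β → Prop) : Prop :=
  ∀ c : Cost, ∃ (b : β) (c' : Cost), (b, c') ∈ r c ∧ Q b ∧
    c'.gradF ≤ c.gradF + g ∧ c'.gradFt ≤ c.gradFt + g ∧
    c'.proxF ≤ c.proxF + p ∧ c'.proxFt ≤ c.proxFt + p

theorem Run.mem_bind {β δ : Type} {r : Run β} {k : β → Run δ} {c c₁ c₂ : Cost} {b : β} {d : δ}
    (hb : (b, c₁) ∈ r c) (hd : (d, c₂) ∈ k b c₁) : (d, c₂) ∈ (r >>= k) c :=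
  show (d, c₂) ∈ (r c).bind fun bc => k bc.1 bc.2 from Part.mem_bind_iff.2 ⟨(b, c₁), hb, hd⟩

namespace Run.Ensures

variable {β δ σ : Type}

theorem pure {b : β} {Q : β → Prop} (h : Q b) : Run.Ensures (Pure.pure b) 0 0 Q := fun c =>
  ⟨b, c, Part.mem_some _, h, by simp⟩

theorem bind {r : Run β} {k : β → Run δ} {g p g' p' : ℕ} {Q : β → Prop} {R : δ → Prop}
    (hr : r.Ensures g p Q) (hk : ∀ b, Q b → (k b).Ensures g' p' R) :
    Run.Ensures (r >>= k) (g + g') (p + p') R := by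
  intro c
  obtain ⟨b, c₁, hb, hQ, h1, h2, h3, h4⟩ := hr c
  obtain ⟨d, c₂, hd, hR, k1, k2, k3, k4⟩ := hk b hQ c₁
  exact ⟨d, c₂, Run.mem_bind hb hd, hR, by omega, by omega, by omega, by omega⟩

theorem mono {r : Run β} {g p g' p' : ℕ} {Q R : β → Prop} (hr : r.Ensures g p Q)
    (hg : g ≤ g') (hp : p ≤ p') (hQ : ∀ b, Q b → R b) : r.Ensures g' p' R := by
  intro c
  obtain ⟨b, c₁, hb, hq, h1, h2, h3, h4⟩ := hr c
  exact ⟨b, c₁, hb, hQ b hq, by omega, by omega, by omega, by omega⟩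

theorem bind' {r : Run β} {k : β → Run δ} {g p g' p' G P : ℕ} {Q : β → Prop} {R : δ → Prop}
    (hr : r.Ensures g p Q) (hG : g + g' ≤ G) (hP : p + p' ≤ P)
    (hk : ∀ b, Q b → (k b).Ensures g' p' R) : Run.Ensures (r >>= k) G P R :=
  (hr.bind hk).mono hG hP fun _ h => h

/-- Total correctness of a loop: the invariant `I j` holds before pass `j`, and pass `N`, if it is
reached, is the last one. -/
theorem loop {body : σ → Run (β ⊕ σ)} {I : ℕ → σ → Prop} {Q : β → Prop} {N : ℕ} {g p : ℕ → ℕ}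
    (hbody : ∀ j ≤ N, ∀ s, I j s →
      (body s).Ensures (g j) (p j) (Sum.elim Q fun s' => j < N ∧ I (j + 1) s'))
    {s : σ} (hs : I 0 s) :
    (Run.loop body s).Ensures (∑ j ∈ Finset.range (N + 1), g j)
      (∑ j ∈ Finset.range (N + 1), p j) Q := by
  -- Induction on the number of passes that may still follow.
  suffices H : ∀ d j, j + d = N → ∀ s, I j s →
      (Run.loop body s).Ensures (∑ i ∈ Finset.range (d + 1), g (j + i))
        (∑ i ∈ Finset.range (d + 1), p (j + i)) Q by
    simpa using H N 0 (by simp) s hs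
  intro d
  induction d with
  | zero =>
    intro j hj s hI c
    obtain ⟨b, c', hb, hQ, hc⟩ := hbody j (by omega) s hI c
    rcases b with b | s'
    · refine ⟨b, c', ?_, hQ, by simpa using hc⟩
      exact PFun.mem_fix_iff.2 (Or.inl ((Part.mem_map_iff _).2 ⟨_, hb, rfl⟩))
    · exact absurd hQ.1 (by omega)
  | succ d ih =>
    intro j hj s hI c
    obtain ⟨b, c', hb, hQ, h1, h2, h3, h4⟩ := hbody j (by omega) s hI c
    rw [Finset.sum_range_succ', Finset.sum_range_succ' (fun i => p (j + i))]
    rcases b with b | s'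
    · refine ⟨b, c', ?_, hQ, ?_⟩
      · exact PFun.mem_fix_iff.2 (Or.inl ((Part.mem_map_iff _).2 ⟨_, hb, rfl⟩))
      · simp only [add_zero]
        omega
    · obtain ⟨b, c'', hb', hQ', k1, k2, k3, k4⟩ := ih (j + 1) (by omega) s' hQ.2 c'
      refine ⟨b, c'', ?_, hQ', ?_⟩
      · exact PFun.mem_fix_iff.2 (Or.inr ⟨(s', c'), (Part.mem_map_iff _).2 ⟨_, hb, rfl⟩, hb'⟩)
      · simp only [add_assoc, add_comm 1, add_zero] at k1 k2 k3 k4 ⊢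
        omega

end Run.Ensures

/-! ### Subgradients, proximal maps and monotonicity -/

section Subgradients

variable {E : Type} [NormedAddCommGroup E] [InnerProductSpace ℝ E]

/-- `s` is a subgradient at `x ∈ D` of the function that equals `φ` on `D` and `∞` elsewhere. -/
def IsSubgradOn (D : Set E) (φ : E → ℝ) (s x : E) : Prop :=
  x ∈ D ∧ ∀ w ∈ D, φ x + inner ℝ s (w - x) ≤ φ w

/-- `π γ` is the proximal operator of `γ φ` (where `φ` is `∞` outside `D`) for every `γ > 0`. -/
def IsProxMap (D : Set E) (φ : E → ℝ) (π : ℝ → E → E) : Prop :=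
  ∀ γ : ℝ, 0 < γ → ∀ v, IsSubgradOn D φ (γ⁻¹ • (v - π γ v)) (π γ v)

variable {D : Set E} {φ : E → ℝ}

theorem IsSubgradOn.monotone {s s' x x' : E} (h : IsSubgradOn D φ s x)
    (h' : IsSubgradOn D φ s' x') : 0 ≤ inner ℝ (s - s') (x - x') := by
  have h1 := h.2 x' h'.1
  have h2 := h'.2 x h.1
  have e : inner ℝ s (x - x') = -inner ℝ s (x' - x) := by rw [← inner_neg_right, neg_sub]
  rw [inner_sub_left, e]
  linarith

/-- A monotone pair of increments makes the resolvent nonexpansive. -/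
theorem norm_le_norm_add_smul {a b : E} {s : ℝ} (hs : 0 ≤ s) (h : 0 ≤ inner ℝ b a) :
    ‖a‖ ≤ ‖a + s • b‖ := by
  refine abs_le_of_sq_le_sq' ?_ (norm_nonneg _) |>.2
  rw [norm_add_sq_real, inner_smul_right, real_inner_comm]
  nlinarith [sq_nonneg ‖s • b‖, mul_nonneg hs h]

end Subgradients

/-! ### Potential of the anchored extragradient iteration -/

section Anchor

variable {E : Type} [NormedAddCommGroup E] [InnerProductSpace ℝ E]

/-- The potential of the inner loop: `u` is the iterate, `S` an element of the monotone inclusion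
operator at `u`, and `u₀` the anchor. -/
noncomputable def anchorPotential (ζ t : ℝ) (u₀ u S : E) : ℝ :=
  ζ * ((t + 1) * (t + 2) ^ 2 / 4) * ‖S‖ ^ 2 + (t + 1) * (t + 2) * inner ℝ S (u - u₀)

/-- The potential does not increase along an anchored extragradient step. Only monotonicity between
consecutive iterates is needed; the extrapolated point enters through a Lipschitz bound. -/
theorem anchorPotential_step {ζ t : ℝ} (hζ : 0 ≤ ζ) (ht : 0 ≤ t) {u₀ u S T u' S' : E}
    (hu : u' = u + (2 / (t + 3)) • (u₀ - u) - ζ • T)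
    (hlip : 20 * ‖S' - T‖ ^ 2 ≤ ‖T - S‖ ^ 2)
    (hmono : 0 ≤ inner ℝ (S' - S) (u' - u)) :
    anchorPotential ζ (t + 1) u₀ u' S' ≤ anchorPotential ζ t u₀ u S := by
  have e1 : u' - u = (-(2 / (t + 3))) • (u - u₀) - ζ • T := by rw [hu]; module
  have e2 : u' - u₀ = (1 - 2 / (t + 3)) • (u - u₀) - ζ • T := by rw [hu]; module
  rw [e1] at hmono
  unfold anchorPotential
  rw [e2]
  generalize u - u₀ = w at *
  simp only [inner_sub_left, inner_sub_right, inner_smul_right] at hmono ⊢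
  rw [norm_sub_sq_real, norm_sub_sq_real, real_inner_comm S T] at hlip
  set a' := inner ℝ S' T
  set a := inner ℝ S T
  set b' := inner ℝ S' w
  set b := inner ℝ S w
  have ht3 : t + 3 ≠ 0 := by positivity
  -- The hypothesis `hlip`, weighted by `(t + 3)² / 80`, leaves this square and a nonnegative
  -- multiple of `‖S‖²`.
  have hsq : 0 ≤ ‖(t + 3) • T - ((19 * t + 17) / 19) • S‖ ^ 2 := sq_nonneg _
  rw [norm_sub_sq_real, norm_smul, norm_smul, inner_smul_left, inner_smul_right,
    real_inner_comm S T, mul_pow, mul_pow, Real.norm_eq_abs, Real.norm_eq_abs, sq_abs, sq_abs]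
    at hsq
  simp only [conj_trivial] at hsq
  change 0 ≤ (t + 3) ^ 2 * ‖T‖ ^ 2 - 2 * ((t + 3) * ((19 * t + 17) / 19 * a)) +
    ((19 * t + 17) / 19) ^ 2 * ‖S‖ ^ 2 at hsq
  have hm : (t + 1) * (t + 2) * (b' - b) ≤ -(ζ * ((t + 1) * (t + 2) * (t + 3) / 2) * (a' - a)) := by
    have := mul_nonneg (show 0 ≤ (t + 1) * (t + 2) * (t + 3) / 2 by positivity) hmono
    have e : (t + 1) * (t + 2) * (t + 3) / 2 * (-(2 / (t + 3)) * b' - ζ * a' -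
        (-(2 / (t + 3)) * b - ζ * a)) =
        -((t + 1) * (t + 2) * (b' - b)) - ζ * ((t + 1) * (t + 2) * (t + 3) / 2) * (a' - a) := by
      field_simp
      ring
    linarith
  have e3 : (t + 1 + 1) * (t + 1 + 2) * ((1 - 2 / (t + 3)) * b' - ζ * a') =
      (t + 1) * (t + 2) * b' - ζ * ((t + 2) * (t + 3) * a') := by
    field_simp
    ring
  rw [e3]
  have key : (t + 3) ^ 2 / 4 * ‖S'‖ ^ 2 - (t + 1) * (t + 2) / 4 * ‖S‖ ^ 2 -
      (t + 3) ^ 2 / 2 * a' + (t + 1) * (t + 3) / 2 * a ≤ 0 := by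
    have h1 := mul_le_mul_of_nonneg_left hlip (show 0 ≤ (t + 3) ^ 2 / 80 by positivity)
    have h2 : 0 ≤ (380 * t + 300) / 19 * ‖S‖ ^ 2 := by positivity
    linear_combination h1 + 19 / 80 * hsq + h2 / 80
  have key2 := mul_nonpos_of_nonneg_of_nonpos (show 0 ≤ ζ * (t + 2) by positivity) key
  linear_combination key2 + hm

/-- If the anchored iteration has not reached the relative accuracy `‖S‖ ≤ ‖u - um‖`, then
`ζ (t + 2) < 6`. The anchor `u₀` is the forward-backward step from `um`; comparing it with `u`
through the monotone part `B` bounds `‖u - u₀‖` and `‖S₀‖` by multiples of `‖S‖`, and the potential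
then bounds `t`. No solution of the inclusion is involved. -/
theorem anchor_terminates {A : E → E} {ζ t : ℝ} (hζ : 0 < ζ) (hζ' : ζ ≤ 1 / 100) (ht : 0 ≤ t)
    (hA : ∀ a b, ζ * ‖A a - A b‖ ≤ 9 / 40 * ‖a - b‖) {um u₀ u B B₀ : E}
    (hu₀ : u₀ + ζ • B₀ = um - ζ • A um) (hmono : 0 ≤ inner ℝ (B - B₀) (u - u₀))
    (hV : anchorPotential ζ t u₀ u (A u + B) ≤ ζ * ‖A u₀ + B₀‖ ^ 2)
    (hdone : ‖u - um‖ < ‖A u + B‖) : ζ * (t + 2) < 6 := by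
  by_contra! hT
  set S := A u + B with hS
  set r := ‖S‖
  have hr : 0 < r := (norm_nonneg _).trans_lt hdone
  have h1 : ‖u - u₀‖ ≤ 5 / 4 * r := by
    have h := norm_le_norm_add_smul hζ.le hmono
    have e : u - u₀ + ζ • (B - B₀) = (u - um) + ζ • S + ζ • (A um - A u) := by
      have : ζ • B₀ = um - ζ • A um - u₀ := by rw [← hu₀]; abel
      rw [smul_sub, this, hS]
      module
    rw [e] at h
    have h2 := norm_add₃_le (a := u - um) (b := ζ • S) (c := ζ • (A um - A u))
    rw [norm_smul, norm_smul, Real.norm_of_nonneg hζ.le] at h2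
    have h3 := hA um u
    rw [norm_sub_rev um u] at h3
    have h4 : ζ * r ≤ 1 / 100 * r := by gcongr
    change _ ≤ _ + ζ * r + _ at h2
    linarith
  have h2 : ζ * ‖A u₀ + B₀‖ ≤ 45 / 16 * r := by
    have e : ζ • (A u₀ + B₀) = (um - u) + (u - u₀) + ζ • (A u₀ - A um) := by
      have : ζ • B₀ = um - ζ • A um - u₀ := by rw [← hu₀]; abel
      rw [smul_add, this]
      module
    have h3 := norm_add_le ((um - u) + (u - u₀)) (ζ • (A u₀ - A um))
    rw [← e, norm_smul, norm_smul, Real.norm_of_nonneg hζ.le] at h3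
    have h4 := hA u₀ um
    have h5 := norm_add_le (um - u) (u - u₀)
    rw [norm_sub_rev um u] at h5
    have h6 : ‖u₀ - um‖ = ‖um - u + (u - u₀)‖ := by
      rw [norm_sub_rev]; congr 1; abel
    rw [← h6] at h3 h5
    linarith
  have h3 : ζ * (ζ * ‖A u₀ + B₀‖ ^ 2) ≤ 8 * r ^ 2 := by
    have := mul_self_le_mul_self (by positivity) h2
    nlinarith [sq_nonneg r]
  have h4 : -(r * (5 / 4 * r)) ≤ inner ℝ S (u - u₀) := by
    have := (abs_le.1 (abs_real_inner_le_norm S (u - u₀))).1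
    have h5 : r * ‖u - u₀‖ ≤ r * (5 / 4 * r) := by gcongr
    change -(r * ‖u - u₀‖) ≤ _ at this
    linarith
  have h5 : (t + 1) * (t + 2) * r ^ 2 / 4 ≤ ζ * ‖A u₀ + B₀‖ ^ 2 := by
    refine le_trans ?_ hV
    unfold anchorPotential
    have h6 := mul_le_mul_of_nonneg_left h4 (show 0 ≤ (t + 1) * (t + 2) by positivity)
    have h7 := mul_le_mul_of_nonneg_right hT
      (show 0 ≤ (t + 1) * (t + 2) * r ^ 2 / 4 by positivity)
    change _ ≤ _ * r ^ 2 + _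
    linarith
  have h6 : ζ * ((t + 1) * (t + 2)) ≤ 32 := by
    have h7 : ζ * ((t + 1) * (t + 2)) * r ^ 2 ≤ 32 * r ^ 2 := by
      linarith [mul_le_mul_of_nonneg_left h5 hζ.le]
    exact le_of_mul_le_mul_right h7 (by positivity)
  nlinarith

end Anchor

/-! ### Strongly convex-strongly concave saddle problems -/

section Saddle

variable (X Y : Type) [NormedAddCommGroup X] [InnerProductSpace ℝ X]
  [NormedAddCommGroup Y] [InnerProductSpace ℝ Y]

/-- The data of the problem `min_x max_y h x y + p x - q y`. The functions `p` and `q` are real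
valued on their domains `domP` and `domQ`; their values elsewhere are irrelevant. The maps `gradX`,
`gradY`, `proxP`, `proxQ` are the answers to oracle queries. -/
structure SaddleProblem where
  domP : Set X
  domQ : Set Y
  p : X → ℝ
  q : Y → ℝ
  h : X → Y → ℝ
  gradX : X → Y → X
  gradY : X → Y → Y
  proxP : ℝ → X → X
  proxQ : ℝ → Y → Y

variable {X Y}

namespace SaddleProblem

/-- The objective `h x y + p x - q y`. -/
def value (S : SaddleProblem X Y) (x : X) (y : Y) : ℝ := S.h x y + S.p x - S.q y

/-- The oracle `O` returns the answers recorded in `S`. An evaluation of `∇h` may use two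
evaluations of each gradient, and one of a proximal operator one of each proximal operator. -/
structure AnsweredBy (S : SaddleProblem X Y) (O : SaddleOracle X Y) : Prop where
  grad : ∀ x y, (O.grad x y).Ensures 2 0 (· = (S.gradX x y, S.gradY x y))
  proxP : ∀ γ x, (O.proxP γ x).Ensures 0 1 (· = S.proxP γ x)
  proxQ : ∀ γ y, (O.proxQ γ y).Ensures 0 1 (· = S.proxQ γ y)

/-- `S` is `σx`-strongly convex and `σy`-strongly concave on its domain, in terms of the
first-order inequalities for the oracle answers, which are `L`-Lipschitz on the whole space.
The field `lipschitz_shift` bounds the map that governs the inner loop of `optimalMethod`. -/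
structure IsStrong (S : SaddleProblem X Y) (σx σy L : ℝ) : Prop where
  σx_pos : 0 < σx
  σy_pos : 0 < σy
  le_L : 3 * σx + σy ≤ L
  proxP : IsProxMap S.domP S.p S.proxP
  proxQ : IsProxMap S.domQ S.q S.proxQ
  convex : ∀ x ∈ S.domP, ∀ x' ∈ S.domP, ∀ y ∈ S.domQ,
    S.h x y + inner ℝ (S.gradX x y) (x' - x) + σx / 2 * ‖x' - x‖ ^ 2 ≤ S.h x' y
  concave : ∀ x ∈ S.domP, ∀ y ∈ S.domQ, ∀ y' ∈ S.domQ,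
    S.h x y' ≤ S.h x y + inner ℝ (S.gradY x y) (y' - y) - σy / 2 * ‖y' - y‖ ^ 2
  lipschitz : ∀ x y x' y', ‖S.gradX x y - S.gradX x' y'‖ ^ 2 + ‖S.gradY x y - S.gradY x' y'‖ ^ 2
    ≤ L ^ 2 * (‖x - x'‖ ^ 2 + ‖y - y'‖ ^ 2)
  lipschitz_shift : ∀ x y x' y',
    ‖S.gradX x y - S.gradX x' y' - (σx / 2) • (x - x')‖ ^ 2
      + ‖S.gradY x y - S.gradY x' y' - (σx / 8) • (y - y')‖ ^ 2
    ≤ L ^ 2 * (‖x - x'‖ ^ 2 + ‖y - y'‖ ^ 2)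

namespace IsStrong

variable {S : SaddleProblem X Y} {σx σy L : ℝ}

theorem L_pos (hS : S.IsStrong σx σy L) : 0 < L := by
  linarith [hS.le_L, hS.σx_pos, hS.σy_pos]

/-- Strong monotonicity on the domain of the saddle operator `(∇ₓh, -∇ᵧh)`. -/
theorem monotone (hS : S.IsStrong σx σy L) {x x' : X} {y y' : Y} (hx : x ∈ S.domP)
    (hx' : x' ∈ S.domP) (hy : y ∈ S.domQ) (hy' : y' ∈ S.domQ) :
    σx * ‖x - x'‖ ^ 2 + σy * ‖y - y'‖ ^ 2 ≤
      inner ℝ (S.gradX x y - S.gradX x' y') (x - x')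
        - inner ℝ (S.gradY x y - S.gradY x' y') (y - y') := by
  have h1 := hS.convex x hx x' hx' y hy
  have h2 := hS.convex x' hx' x hx y' hy'
  have h3 := hS.concave x hx y hy y' hy'
  have h4 := hS.concave x' hx' y' hy' y hy
  have e1 : inner ℝ (S.gradX x y) (x' - x) = -inner ℝ (S.gradX x y) (x - x') := by
    rw [← inner_neg_right, neg_sub]
  have e2 : inner ℝ (S.gradY x y) (y' - y) = -inner ℝ (S.gradY x y) (y - y') := by
    rw [← inner_neg_right, neg_sub]
  rw [e1, norm_sub_rev x' x] at h1
  rw [e2, norm_sub_rev y' y] at h3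
  rw [inner_sub_left, inner_sub_left]
  linarith

end IsStrong

end SaddleProblem

end Saddle

/-! ### The inner stage -/

section Pair

variable {X Y : Type} [NormedAddCommGroup X] [NormedAddCommGroup Y]

/-- The stacked vector `(x; y)` in the Euclidean product. -/
abbrev pair (x : X) (y : Y) : WithLp 2 (X × Y) := WithLp.toLp 2 (x, y)

theorem norm_pair_sq (x : X) (y : Y) : ‖pair x y‖ ^ 2 = ‖x‖ ^ 2 + ‖y‖ ^ 2 :=
  WithLp.prod_norm_sq_eq_of_L2 _

end Pair

section InnerStage

variable {X Y : Type} [NormedAddCommGroup X] [InnerProductSpace ℝ X]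
  [NormedAddCommGroup Y] [InnerProductSpace ℝ Y]

theorem inner_pair (x x' : X) (y y' : Y) :
    inner ℝ (pair x y) (pair x' y') = inner ℝ x x' + inner ℝ y y' :=
  WithLp.prod_inner_apply _ _

theorem gradHat_ensures {S : SaddleProblem X Y} {O : SaddleOracle X Y} (hO : S.AnsweredBy O)
    (σx σy : ℝ) (x : X) (y : Y) :
    (gradHat O σx σy x y).Ensures 2 0
      (· = (S.gradX x y - σx • x, S.gradY x y + σy • y)) :=
  (hO.grad x y).bind (g' := 0) (p' := 0) fun g hg => Run.Ensures.pure (by rw [hg])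

namespace SaddleProblem

variable (S : SaddleProblem X Y)

/-- The operator `γ (aₓ, a_y)` with `γ = 8 / σx` of the inner stage started from `(zg, yg)`. -/
noncomputable def innerOp (σx σy : ℝ) (zg : X) (yg : Y) (u : WithLp 2 (X × Y)) :
    WithLp 2 (X × Y) :=
  (8 * σx⁻¹) • pair
    ((S.gradX u.fst u.snd - σx • u.fst) + (σx / 2) • (u.fst - σx⁻¹ • zg))
    (-(S.gradY u.fst u.snd + σy • u.snd) + σy • u.snd + (σx / 8) • (u.snd - yg))

variable {S} {σx σy L : ℝ}

theorem innerOp_sub (zg : X) (yg : Y) (u v : WithLp 2 (X × Y)) :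
    S.innerOp σx σy zg yg u - S.innerOp σx σy zg yg v = (8 * σx⁻¹) • pair
      (S.gradX u.fst u.snd - S.gradX v.fst v.snd - (σx / 2) • (u.fst - v.fst))
      (-(S.gradY u.fst u.snd - S.gradY v.fst v.snd - (σx / 8) • (u.snd - v.snd))) := by
  unfold innerOp
  rw [← smul_sub, ← WithLp.toLp_sub, Prod.mk_sub_mk]
  congr 3 <;> module

theorem IsStrong.innerOp_lipschitz (hS : S.IsStrong σx σy L) (zg : X) (yg : Y)
    (u v : WithLp 2 (X × Y)) :
    ‖S.innerOp σx σy zg yg u - S.innerOp σx σy zg yg v‖ ≤ 8 * L / σx * ‖u - v‖ := by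
  have h := hS.lipschitz_shift u.fst u.snd v.fst v.snd
  have hσ := hS.σx_pos
  have hL := hS.L_pos
  rw [innerOp_sub, norm_smul, Real.norm_of_nonneg (by positivity)]
  have : ‖pair (S.gradX u.fst u.snd - S.gradX v.fst v.snd - (σx / 2) • (u.fst - v.fst))
      (-(S.gradY u.fst u.snd - S.gradY v.fst v.snd - (σx / 8) • (u.snd - v.snd)))‖
      ≤ L * ‖u - v‖ := by
    refine abs_le_of_sq_le_sq' ?_ (by positivity) |>.2
    rw [norm_pair_sq, norm_neg, mul_pow, WithLp.prod_norm_sq_eq_of_L2 (u - v)]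
    exact h
  calc _ ≤ 8 * σx⁻¹ * (L * ‖u - v‖) := by gcongr
    _ = _ := by ring

theorem IsStrong.innerOp_monotone (hS : S.IsStrong σx σy L) (zg : X) (yg : Y)
    {u v : WithLp 2 (X × Y)} (hu : u.fst ∈ S.domP) (hu' : u.snd ∈ S.domQ) (hv : v.fst ∈ S.domP)
    (hv' : v.snd ∈ S.domQ) :
    0 ≤ inner ℝ (S.innerOp σx σy zg yg u - S.innerOp σx σy zg yg v) (u - v) := by
  have h := hS.monotone hu hv hu' hv'
  have hσ := hS.σx_pos
  have hσ' := hS.σy_pos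
  rw [innerOp_sub, inner_smul_left]
  refine mul_nonneg (by simp; positivity) ?_
  change 0 ≤ inner ℝ (pair _ _) (pair (u.fst - v.fst) (u.snd - v.snd))
  rw [inner_pair, inner_neg_left, inner_sub_left _ _ (u.fst - v.fst),
    inner_sub_left _ _ (u.snd - v.snd), inner_smul_left, inner_smul_left,
    real_inner_self_eq_norm_sq, real_inner_self_eq_norm_sq]
  simp only [conj_trivial]
  nlinarith [sq_nonneg ‖u.fst - v.fst‖, sq_nonneg ‖u.snd - v.snd‖]

/-- What the inner stage guarantees on return: `∇ĥ` and subgradients at the last iterate, and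
the relative accuracy. -/
structure InnerResult (S : SaddleProblem X Y) (σx σy : ℝ) (zg : X) (yg : Y)
    (r : InnerState X Y) : Prop where
  grad : r.g = (S.gradX r.x r.y - σx • r.x, S.gradY r.x r.y + σy • r.y)
  subgradX : IsSubgradOn S.domP S.p r.bX r.x
  subgradY : IsSubgradOn S.domQ S.q r.bY r.y
  accuracy : 8 * σx⁻¹ * ‖r.g.1 + (σx / 2) • (r.x - σx⁻¹ • zg) + r.bX‖ ^ 2
      + 8 * σx⁻¹ * ‖-r.g.2 + σy • r.y + (σx / 8) • (r.y - yg) + r.bY‖ ^ 2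
    ≤ (8 * σx⁻¹)⁻¹ * ‖r.x - -(σx⁻¹ • zg)‖ ^ 2 + (8 * σx⁻¹)⁻¹ * ‖r.y - yg‖ ^ 2

/-- The inner stage stops after at most `N` passes beyond the first check once `N ζ ≥ 6`. -/
theorem IsStrong.innerStage_ensures (hS : S.IsStrong σx σy L) {O : SaddleOracle X Y}
    (hO : S.AnsweredBy O) (zg : X) (yg : Y) {N : ℕ}
    (hN : 6 * (2 * √5 * (1 + 8 * L / σx)) ≤ N) :
    (innerStage O σx σy L zg yg).Ensures (4 * N + 8) (2 * N + 4)
      (S.InnerResult σx σy zg yg) := by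
  have hσ := hS.σx_pos
  have hL := hS.L_pos
  have hk : 25 ≤ 1 + 8 * L / σx := by
    have : 24 ≤ 8 * L / σx := by
      rw [le_div_iff₀ hσ]; linarith [hS.le_L, hS.σy_pos]
    linarith
  have h5 : 2 ≤ √5 := Real.le_sqrt_of_sq_le (by norm_num)
  have h5' : √5 ^ 2 = 5 := Real.sq_sqrt (by norm_num)
  unfold innerStage
  set ζ : ℝ := (2 * √5 * (1 + 8 * L / σx))⁻¹ with hζdef
  set γ : ℝ := 8 * σx⁻¹ with hγdef
  have hζ : 0 < ζ := by positivity
  have hγ : 0 < γ := by positivity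
  have hζγ : 0 < ζ * γ := by positivity
  have hζ100 : ζ ≤ 1 / 100 := by
    rw [hζdef, inv_eq_one_div]
    exact one_div_le_one_div_of_le (by norm_num) (by nlinarith)
  have hNζ : 6 ≤ ζ * N := by
    rw [hζdef, inv_mul_eq_div, le_div_iff₀ (by positivity)]
    exact hN
  set A := S.innerOp σx σy zg yg with hA
  -- `θ = ζ γ L` satisfies `20 θ² ≤ 1`.
  have hθ : 20 * (ζ * (8 * L / σx)) ^ 2 ≤ 1 := by
    have h1 : ζ * (8 * L / σx) ≤ (2 * √5)⁻¹ := by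
      rw [hζdef, inv_mul_eq_div, div_le_iff₀ (by positivity)]
      have : (2 * √5)⁻¹ * (2 * √5 * (1 + 8 * L / σx)) = 1 + 8 * L / σx := by field_simp
      linarith
    have h2 : (2 * √5)⁻¹ ^ 2 = 1 / 20 := by rw [inv_pow, mul_pow, h5']; norm_num
    have h3 : (ζ * (8 * L / σx)) ^ 2 ≤ (2 * √5)⁻¹ ^ 2 := by gcongr
    linarith
  have hLip : ∀ a b, ζ * ‖A a - A b‖ ≤ ζ * (8 * L / σx) * ‖a - b‖ := fun a b => by
    rw [mul_assoc]
    exact mul_le_mul_of_nonneg_left (hS.innerOp_lipschitz zg yg a b) hζ.le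
  have hLip' : ∀ a b, ζ * ‖A a - A b‖ ≤ 9 / 40 * ‖a - b‖ := fun a b => by
    refine (hLip a b).trans (mul_le_mul_of_nonneg_right ?_ (norm_nonneg _))
    refine abs_le_of_sq_le_sq' ?_ (by norm_num) |>.2
    linarith
  have hsub : ∀ {x x' bX bX' y y' bY bY'}, IsSubgradOn S.domP S.p bX x →
      IsSubgradOn S.domP S.p bX' x' → IsSubgradOn S.domQ S.q bY y →
      IsSubgradOn S.domQ S.q bY' y' →
      0 ≤ inner ℝ (γ • pair bX bY - γ • pair bX' bY') (pair x y - pair x' y') := by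
    intro x x' bX bX' y y' bY bY' h1 h2 h3 h4
    rw [← smul_sub, inner_smul_left]
    refine mul_nonneg (by simpa using hγ.le) ?_
    change 0 ≤ inner ℝ (pair (bX - bX') (bY - bY')) (pair (x - x') (y - y'))
    rw [inner_pair]
    exact add_nonneg (h1.monotone h2) (h3.monotone h4)
  have hcancel : ∀ w : WithLp 2 (X × Y), ζ • γ • (ζ * γ)⁻¹ • w = w := fun w => by
    rw [smul_smul ζ γ, smul_smul, mul_inv_cancel₀ hζγ.ne', one_smul]
  have hζA : ∀ x y, ζ • A (pair x y) = (ζ * γ) • pair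
      (S.gradX x y - σx • x + (σx / 2) • (x - σx⁻¹ • zg))
      (-(S.gradY x y + σy • y) + σy • y + (σx / 8) • (y - yg)) := fun x y => by
    rw [hA]
    unfold innerOp
    rw [smul_smul]
    rfl
  refine Run.Ensures.bind' (gradHat_ensures hO _ _ _ _) (g' := 4 * N + 6) (p' := 2 * N + 4)
    (by omega) (by omega) ?_
  rintro _ rfl
  refine Run.Ensures.bind' (hO.proxP _ _) (g' := 4 * N + 6) (p' := 2 * N + 3)
    (by omega) (by omega) ?_
  rintro x₀ hx₀
  refine Run.Ensures.bind' (hO.proxQ _ _) (g' := 4 * N + 6) (p' := 2 * N + 2)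
    (by omega) (by omega) ?_
  rintro y₀ hy₀
  refine Run.Ensures.bind' (gradHat_ensures hO _ _ _ _) (g' := 4 * N + 4) (p' := 2 * N + 2)
    (by omega) (by omega) ?_
  rintro g₀ hg₀
  dsimp only at hx₀ hy₀
  set xm : X := -(σx⁻¹ • zg) with hxm
  set vx : X := xm - (ζ * γ) • (S.gradX xm yg - σx • xm + (σx / 2) • (xm - σx⁻¹ • zg)) with hvx
  set vy : Y := yg - (ζ * γ) • (-(S.gradY xm yg + σy • yg) + σy • yg + (σx / 8) • (yg - yg))
    with hvy
  have hbX := hS.proxP _ hζγ vx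
  have hbY := hS.proxQ _ hζγ vy
  rw [← hx₀] at hbX
  rw [← hy₀] at hbY
  set B₀ : WithLp 2 (X × Y) := γ • pair ((ζ * γ)⁻¹ • (vx - x₀)) ((ζ * γ)⁻¹ • (vy - y₀)) with hB₀
  have hu₀ : pair x₀ y₀ + ζ • B₀ = pair xm yg - ζ • A (pair xm yg) := by
    have e : ζ • B₀ = pair vx vy - pair x₀ y₀ := by
      exact hcancel (pair (vx - x₀) (vy - y₀))
    rw [e, hζA]
    change pair x₀ y₀ + (pair vx vy - pair x₀ y₀) = pair vx vy
    abel
  -- The invariant of the loop.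
  set I : ℕ → InnerState X Y → Prop := fun j s =>
    s.t = j ∧ s.g = (S.gradX s.x s.y - σx • s.x, S.gradY s.x s.y + σy • s.y) ∧
    IsSubgradOn S.domP S.p s.bX s.x ∧ IsSubgradOn S.domQ S.q s.bY s.y ∧
    anchorPotential ζ j (pair x₀ y₀) (pair s.x s.y) (A (pair s.x s.y) + γ • pair s.bX s.bY)
      ≤ ζ * ‖A (pair x₀ y₀) + B₀‖ ^ 2 with hI
  refine Run.Ensures.mono (Run.Ensures.loop (I := I) (N := N) (g := fun _ => 4) (p := fun _ => 2)
    (Q := S.InnerResult σx σy zg yg) ?_ ?_) (by simp; omega) (by simp; omega) (fun _ h => h)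
  swap
  · refine ⟨rfl, hg₀, hbX, hbY, ?_⟩
    unfold anchorPotential
    rw [sub_self, inner_zero_right, ← hB₀]
    apply le_of_eq
    push_cast
    ring
  rintro j hj s ⟨hst, hsg, hsX, hsY, hV⟩
  have hres : ∀ s : InnerState X Y,
      s.g = (S.gradX s.x s.y - σx • s.x, S.gradY s.x s.y + σy • s.y) →
      A (pair s.x s.y) + γ • pair s.bX s.bY =
        γ • pair (s.g.1 + (σx / 2) • (s.x - σx⁻¹ • zg) + s.bX)
          (-s.g.2 + σy • s.y + (σx / 8) • (s.y - yg) + s.bY) := by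
    intro s hs
    rw [hs, hA]
    unfold innerOp
    rw [← hγdef, ← smul_add]
    rfl
  split_ifs with hdone
  · exact (Run.Ensures.pure ⟨hsg, hsX, hsY, hdone⟩).mono (by omega) (by omega) fun _ h => h
  have hnt : ‖pair s.x s.y - pair xm yg‖ < ‖A (pair s.x s.y) + γ • pair s.bX s.bY‖ := by
    refine lt_of_pow_lt_pow_left₀ 2 (norm_nonneg _) ?_
    rw [show pair s.x s.y - pair xm yg = pair (s.x - xm) (s.y - yg) from rfl, norm_pair_sq,
      hres s hsg, norm_smul, mul_pow, Real.norm_of_nonneg hγ.le, norm_pair_sq]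
    have h1 := mul_lt_mul_of_pos_left (not_le.1 hdone) hγ
    have e : γ * (γ⁻¹ * ‖s.x - xm‖ ^ 2 + γ⁻¹ * ‖s.y - yg‖ ^ 2) =
      ‖s.x - xm‖ ^ 2 + ‖s.y - yg‖ ^ 2 := by field_simp
    rw [e] at h1
    linarith
  have hjN : j < N := by
    have h1 := anchor_terminates hζ hζ100 (Nat.cast_nonneg j) hLip' hu₀ (hsub hsX hbX hsY hbY) hV hnt
    have h2 : (j : ℝ) < N := by
      have : ζ * j < ζ * N := by nlinarith
      exact lt_of_mul_lt_mul_left this hζ.le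
    exact_mod_cast h2
  refine Run.Ensures.bind' (gradHat_ensures hO _ _ _ _) (g' := 2) (p' := 2) le_rfl le_rfl ?_
  rintro _ rfl
  refine Run.Ensures.bind' (hO.proxP _ _) (g' := 2) (p' := 1) le_rfl le_rfl ?_
  rintro x' hx'
  refine Run.Ensures.bind' (hO.proxQ _ _) (g' := 2) (p' := 0) le_rfl le_rfl ?_
  rintro y' hy'
  refine Run.Ensures.bind' (gradHat_ensures hO _ _ _ _) (g' := 0) (p' := 0) le_rfl le_rfl ?_
  rintro g' hg'
  refine Run.Ensures.pure ⟨hjN, ?_⟩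
  dsimp only at hx' hy'
  set β : ℝ := 2 / ((s.t : ℝ) + 3) with hβ
  set cx : X := s.x + β • (x₀ - s.x) with hcx
  set cy : Y := s.y + β • (y₀ - s.y) with hcy
  set xh : X := cx - (ζ * γ) • (s.g.1 + (σx / 2) • (s.x - σx⁻¹ • zg) + s.bX) with hxh
  set yh : Y := cy - (ζ * γ) • (-s.g.2 + σy • s.y + (σx / 8) • (s.y - yg) + s.bY) with hyh
  set vx' : X := cx - (ζ * γ) • (S.gradX xh yh - σx • xh + (σx / 2) • (xh - σx⁻¹ • zg)) with hvx'
  set vy' : Y := cy - (ζ * γ) • (-(S.gradY xh yh + σy • yh) + σy • yh + (σx / 8) • (yh - yg))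
    with hvy'
  have hbX' := hS.proxP _ hζγ vx'
  have hbY' := hS.proxQ _ hζγ vy'
  rw [← hx'] at hbX'
  rw [← hy'] at hbY'
  refine ⟨by simp [hst], hg', hbX', hbY', le_trans ?_ hV⟩
  dsimp only
  set B' : WithLp 2 (X × Y) := γ • pair ((ζ * γ)⁻¹ • (vx' - x')) ((ζ * γ)⁻¹ • (vy' - y')) with hB'
  have hc : pair cx cy = pair s.x s.y + β • (pair x₀ y₀ - pair s.x s.y) := rfl
  have hh : pair xh yh = pair cx cy - ζ • (A (pair s.x s.y) + γ • pair s.bX s.bY) := by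
    rw [hres s hsg, smul_smul]
    rfl
  have hu' : pair x' y' = pair cx cy - ζ • (A (pair xh yh) + B') := by
    have e : ζ • B' = pair vx' vy' - pair x' y' := by
      exact hcancel (pair (vx' - x') (vy' - y'))
    have e' : pair cx cy - pair vx' vy' = ζ • A (pair xh yh) := by
      rw [hζA]
      change pair cx cy - (pair cx cy - (ζ * γ) • pair _ _) = _
      abel
    rw [smul_add, e, ← e']
    abel
  push_cast
  refine anchorPotential_step hζ.le (Nat.cast_nonneg j) (T := A (pair xh yh) + B') ?_ ?_ ?_
  · rw [hu', hc, hβ, hst]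
  · have e1 : A (pair x' y') + B' - (A (pair xh yh) + B') = A (pair x' y') - A (pair xh yh) := by
      abel
    have e2 : pair x' y' - pair xh yh = (-ζ) •
        (A (pair xh yh) + B' - (A (pair s.x s.y) + γ • pair s.bX s.bY)) := by
      rw [hu', hh]; module
    have h1 := hS.innerOp_lipschitz zg yg (pair x' y') (pair xh yh)
    rw [e2, norm_smul, norm_neg, Real.norm_of_nonneg hζ.le] at h1
    rw [e1]
    set d := ‖A (pair xh yh) + B' - (A (pair s.x s.y) + γ • pair s.bX s.bY)‖
    have h2 : ‖A (pair x' y') - A (pair xh yh)‖ ^ 2 ≤ (8 * L / σx * (ζ * d)) ^ 2 := by gcongr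
    have h3 := mul_le_mul_of_nonneg_right hθ (sq_nonneg d)
    linarith
  · have h1 := hS.innerOp_monotone zg yg (u := pair x' y') (v := pair s.x s.y)
      hbX'.1 hbY'.1 hsX.1 hsY.1
    have h2 := hsub hbX' hsX hbY' hsY
    have h3 := add_nonneg h1 h2
    rw [← inner_add_left] at h3
    convert! h3 using 2
    abel

end SaddleProblem

end InnerStage

/-! ### One step of the accelerated outer iteration -/

section OuterStep

variable {E F : Type} [NormedAddCommGroup E] [InnerProductSpace ℝ E]
  [NormedAddCommGroup F] [InnerProductSpace ℝ F]

/-- One step of `w' = w + η ν (wf - w) - η A`, where `A` is a subgradient at `wf` of a function with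
strong convexity modulus `ν`. -/
theorem sq_dist_step {η ν : ℝ} (hη : 0 < η) (hν : 0 ≤ ν) (hην : 2 * (η * ν) ≤ 1)
    {w w' wf ws A : E} (hw : w' = w + (η * ν) • (wf - w) - η • A) :
    η⁻¹ * ‖w' - ws‖ ^ 2 ≤ (η⁻¹ - ν) * ‖w - ws‖ ^ 2 + ν * ‖wf - ws‖ ^ 2
      - 2 * inner ℝ A (w - ws) + 2 * η * ‖A‖ ^ 2 := by
  obtain ⟨e, rfl⟩ : ∃ e, w = ws + e := ⟨w - ws, by abel⟩
  obtain ⟨d, rfl⟩ : ∃ d, wf = ws + e + d := ⟨wf - (ws + e), by abel⟩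
  have e1 : w' - ws = e + η • (ν • d - A) := by rw [hw]; module
  have e2 : ws + e + d - ws = e + d := by abel
  have h1 : ‖ν • d - A‖ ^ 2 ≤ 2 * ν ^ 2 * ‖d‖ ^ 2 + 2 * ‖A‖ ^ 2 := by
    have := parallelogram_law_with_norm ℝ (ν • d) A
    rw [norm_smul, Real.norm_of_nonneg hν] at this
    nlinarith [sq_nonneg ‖ν • d + A‖]
  have h3 := mul_le_mul_of_nonneg_left h1 hη.le
  have h4 : 0 ≤ ν * ‖d‖ ^ 2 * (1 - 2 * (η * ν)) :=
    mul_nonneg (by positivity) (by linarith)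
  rw [e1, e2, add_sub_cancel_left, norm_add_sq_real e d, norm_add_sq_real, norm_smul,
    inner_smul_right, inner_sub_right, inner_smul_right, mul_pow, Real.norm_of_nonneg hη.le,
    ← real_inner_comm e A]
  generalize inner ℝ e d = c at *
  generalize inner ℝ A e = b at *
  generalize ‖ν • d - A‖ ^ 2 = n at *
  have h2 : η⁻¹ * (‖e‖ ^ 2 + 2 * (η * (ν * c - b)) + η ^ 2 * n) =
      η⁻¹ * ‖e‖ ^ 2 + 2 * (ν * c - b) + η * n := by
    field_simp
  rw [h2]
  linarith

/-- The relative accuracy of the inner stage, read as a sufficient decrease condition for an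
inexact proximal step. -/
theorem decrease_of_accuracy {σ : ℝ} (hσ : 0 < σ) {A B : E} {Ay By : F}
    (h : 8 * σ⁻¹ * ‖(1 / 2 : ℝ) • (B + σ • A)‖ ^ 2 + 8 * σ⁻¹ * ‖Ay + (σ / 8) • By‖ ^ 2
      ≤ (8 * σ⁻¹)⁻¹ * ‖A - σ⁻¹ • B‖ ^ 2 + (8 * σ⁻¹)⁻¹ * ‖By‖ ^ 2) :
    3 / 5 * σ * ‖A‖ ^ 2 + 4 / σ * ‖Ay‖ ^ 2 ≤ -inner ℝ A B - inner ℝ Ay By := by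
  have hsq : 0 ≤ 15 / (8 * σ) * ‖B + (3 / 5 * σ) • A‖ ^ 2 := by positivity
  rw [norm_smul, mul_pow, norm_add_sq_real, norm_add_sq_real, norm_sub_sq_real, norm_smul,
    norm_smul, norm_smul, inner_smul_right, inner_smul_right, inner_smul_right,
    real_inner_comm A B] at h
  rw [norm_add_sq_real, norm_smul, inner_smul_right, real_inner_comm A B] at hsq
  rw [Real.norm_of_nonneg hσ.le, Real.norm_of_nonneg (by positivity : 0 ≤ σ / 8),
    Real.norm_of_nonneg (by positivity : (0 : ℝ) ≤ 1 / 2),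
    Real.norm_of_nonneg (by positivity : 0 ≤ σ⁻¹)] at h
  rw [Real.norm_of_nonneg (by positivity : 0 ≤ 3 / 5 * σ)] at hsq
  generalize inner ℝ A B = c at *
  generalize inner ℝ Ay By = d at *
  field_simp at h hsq ⊢
  linarith

/-- One step of the accelerated iteration. `Ff`, `Fk`, `Fs` play the roles of the values of a
strongly convex function at `(zf, yf)`, at the previous such point `(zk, yk)` and at the
minimizer `(zs, ys)`. -/
theorem outer_step {σ μ α η Ff Fk Fs : ℝ} (hσ : 0 < σ) (hμ : 0 ≤ μ) (hα : 0 < α) (hα1 : α ≤ 1)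
    (hη : 0 < η) (hημ : 2 * (η * μ) ≤ 1) (hηα : η * (α * σ) ≤ 4) (hαη : α ≤ 2 * (η * μ))
    {z z' zg zk zf zs A : E} {y y' yg yk yf ys B : F}
    (hzg : zg = α • z + (1 - α) • zk) (hyg : yg = α • y + (1 - α) • yk)
    (hz' : z' = z + (σ / 2 * σ⁻¹) • (zf - z) - (σ / 2) • A)
    (hy' : y' = y + (η * μ) • (yf - y) - η • B)
    (hacc : 3 / 5 * σ * ‖A‖ ^ 2 + 4 / σ * ‖B‖ ^ 2 ≤ -inner ℝ A (zf - zg) - inner ℝ B (yf - yg))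
    (hs : Ff + inner ℝ A (zs - zf) + ‖zs - zf‖ ^ 2 / (2 * σ) + inner ℝ B (ys - yf)
      + μ / 2 * ‖ys - yf‖ ^ 2 ≤ Fs)
    (hk : Ff + inner ℝ A (zk - zf) + ‖zk - zf‖ ^ 2 / (2 * σ) + inner ℝ B (yk - yf)
      + μ / 2 * ‖yk - yf‖ ^ 2 ≤ Fk) (hFk : Fs ≤ Fk) :
    2 / σ * ‖z' - zs‖ ^ 2 + η⁻¹ * ‖y' - ys‖ ^ 2 + 2 / α * (Ff - Fs) ≤
      (1 - α / 2) * (2 / σ * ‖z - zs‖ ^ 2 + η⁻¹ * ‖y - ys‖ ^ 2 + 2 / α * (Fk - Fs)) := by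
  have h1 := sq_dist_step (ws := zs) (by positivity : 0 < σ / 2) (by positivity : 0 ≤ σ⁻¹)
    (by field_simp; norm_num) hz'
  have h2 := sq_dist_step (ws := ys) hη hμ hημ hy'
  have hinv : (σ / 2)⁻¹ = 2 / σ := by field_simp
  rw [hinv] at h1
  -- Since `zg = α z + (1 - α) zk`, the vector `α (z - zs)` is a combination of `zs - zf`, `zf - zg`
  -- and `zk - zf`: the subgradient inequality at `zf` towards the minimizer, the accuracy of the
  -- inner stage, and the subgradient inequality towards the previous point.
  have e1 : α * inner ℝ A (z - zs) = -(α * inner ℝ A (zs - zf)) - inner ℝ A (zf - zg)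
      - (1 - α) * inner ℝ A (zk - zf) := by
    rw [← inner_smul_right, ← inner_smul_right, ← inner_smul_right, ← inner_neg_right,
      ← inner_sub_right, ← inner_sub_right]
    congr 1
    rw [hzg]
    module
  have e2 : α * inner ℝ B (y - ys) = -(α * inner ℝ B (ys - yf)) - inner ℝ B (yf - yg)
      - (1 - α) * inner ℝ B (yk - yf) := by
    rw [← inner_smul_right, ← inner_smul_right, ← inner_smul_right, ← inner_neg_right,
      ← inner_sub_right, ← inner_sub_right]
    congr 1
    rw [hyg]
    module
  have hk' : Ff + inner ℝ A (zk - zf) + inner ℝ B (yk - yf) ≤ Fk := by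
    have : 0 ≤ ‖zk - zf‖ ^ 2 / (2 * σ) := by positivity
    have : 0 ≤ μ / 2 * ‖yk - yf‖ ^ 2 := by positivity
    linarith
  have hk2 := mul_le_mul_of_nonneg_left hk' (by linarith : 0 ≤ 1 - α)
  have hs2 := mul_le_mul_of_nonneg_left hs hα.le
  have hA : α * (σ * ‖A‖ ^ 2) ≤ 6 / 5 * (σ * ‖A‖ ^ 2) := by
    exact mul_le_mul_of_nonneg_right (by linarith) (by positivity)
  have hB : α * (2 * η * ‖B‖ ^ 2) ≤ 2 * (4 / σ * ‖B‖ ^ 2) := by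
    have h3 : α * η ≤ 4 / σ := by rw [le_div_iff₀ hσ]; linarith
    have h4 := mul_le_mul_of_nonneg_right h3 (sq_nonneg ‖B‖)
    linarith
  have hz : (2 / σ - σ⁻¹) * ‖z - zs‖ ^ 2 ≤ (1 - α / 2) * (2 / σ * ‖z - zs‖ ^ 2) := by
    have h3 : 2 / σ - σ⁻¹ ≤ (1 - α / 2) * (2 / σ) := by
      have : (1 - α / 2) * (2 / σ) - (2 / σ - σ⁻¹) = (1 - α) / σ := by field_simp; ring
      have : 0 ≤ (1 - α) / σ := div_nonneg (by linarith) hσ.le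
      linarith
    rw [← mul_assoc]
    exact mul_le_mul_of_nonneg_right h3 (sq_nonneg _)
  have hy : (η⁻¹ - μ) * ‖y - ys‖ ^ 2 ≤ (1 - α / 2) * (η⁻¹ * ‖y - ys‖ ^ 2) := by
    have h3 : η⁻¹ - μ ≤ (1 - α / 2) * η⁻¹ := by
      have h4 : α / 2 * η⁻¹ ≤ μ := by
        rw [← div_eq_mul_inv, div_le_iff₀ hη]; linarith
      linarith
    rw [← mul_assoc]
    exact mul_le_mul_of_nonneg_right h3 (sq_nonneg _)
  have hF : 2 / α * (1 - α) * (Fk - Fs) ≤ (1 - α / 2) * (2 / α * (Fk - Fs)) := by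
    have h3 : 0 ≤ 2 / α * (Fk - Fs) := mul_nonneg (by positivity) (by linarith)
    linear_combination α / 2 * h3
  have hmain : 2 / σ * ‖z' - zs‖ ^ 2 + η⁻¹ * ‖y' - ys‖ ^ 2 + 2 / α * (Ff - Fs) ≤
      (2 / σ - σ⁻¹) * ‖z - zs‖ ^ 2 + (η⁻¹ - μ) * ‖y - ys‖ ^ 2
        + 2 / α * (1 - α) * (Fk - Fs) := by
    refine le_of_mul_le_mul_left ?_ hα
    have h1' := mul_le_mul_of_nonneg_left h1 hα.le
    have h2' := mul_le_mul_of_nonneg_left h2 hα.le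
    rw [norm_sub_rev zf zs] at h1'
    rw [norm_sub_rev yf ys] at h2'
    have e3 : α * (2 / α * (Ff - Fs)) = 2 * (Ff - Fs) := by field_simp
    have e4 : α * (2 / α * (1 - α) * (Fk - Fs)) = 2 * (1 - α) * (Fk - Fs) := by field_simp
    have e5 : ‖zs - zf‖ ^ 2 / (2 * σ) = 1 / 2 * (σ⁻¹ * ‖zs - zf‖ ^ 2) := by field_simp
    rw [e5] at hs2
    linear_combination h1' + h2' + 2 * hs2 + 2 * hk2 + hA + hB + 2 * hacc - 2 * e1 - 2 * e2
      + e3 - e4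
  linear_combination hmain + hz + hy + hF

end OuterStep

/-! ### Forward-backward steps and the saddle point -/

section ForwardBackward

variable {X Y : Type} [NormedAddCommGroup X] [InnerProductSpace ℝ X]
  [NormedAddCommGroup Y] [InnerProductSpace ℝ Y]

theorem IsProxMap.norm_sub_le {D : Set X} {φ : X → ℝ} {π : ℝ → X → X} (h : IsProxMap D φ π)
    {γ : ℝ} (hγ : 0 < γ) (v w : X) : ‖π γ v - π γ w‖ ≤ ‖v - w‖ := by
  have h1 := norm_le_norm_add_smul hγ.le ((h γ hγ v).monotone (h γ hγ w))
  rwa [← smul_sub, smul_smul, mul_inv_cancel₀ hγ.ne', one_smul,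
    show π γ v - π γ w + (v - π γ v - (w - π γ w)) = v - w by abel] at h1

/-- A point is fixed by the proximal step along a subgradient. -/
theorem IsProxMap.eq_of_isSubgradOn {D : Set X} {φ : X → ℝ} {π : ℝ → X → X}
    (h : IsProxMap D φ π) {γ : ℝ} (hγ : 0 < γ) {x s : X} (hs : IsSubgradOn D φ s x) :
    π γ (x + γ • s) = x := by
  have h1 := norm_le_norm_add_smul hγ.le ((h γ hγ (x + γ • s)).monotone hs)
  rw [smul_sub, smul_smul, mul_inv_cancel₀ hγ.ne', one_smul,
    show π γ (x + γ • s) - x + (x + γ • s - π γ (x + γ • s) - γ • s) = 0 by abel, norm_zero] at h1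
  exact sub_eq_zero.1 (norm_le_zero_iff.1 h1)

namespace SaddleProblem

variable {S : SaddleProblem X Y} {σx σy L : ℝ}

/-- The forward-backward map with step `ζ` of the saddle operator. -/
noncomputable def forwardBackward (S : SaddleProblem X Y) (ζ : ℝ) (u : WithLp 2 (X × Y)) :
    WithLp 2 (X × Y) :=
  pair (S.proxP ζ (u.fst - ζ • S.gradX u.fst u.snd)) (S.proxQ ζ (u.snd + ζ • S.gradY u.fst u.snd))

theorem IsStrong.forwardBackward_sq_le (hS : S.IsStrong σx σy L) {ζ : ℝ} (hζ : 0 < ζ)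
    (u v : WithLp 2 (X × Y)) :
    ‖S.forwardBackward ζ u - S.forwardBackward ζ v‖ ^ 2 ≤ (1 + ζ ^ 2 * L ^ 2) * ‖u - v‖ ^ 2
      - 2 * ζ * (inner ℝ (S.gradX u.fst u.snd - S.gradX v.fst v.snd) (u.fst - v.fst)
        - inner ℝ (S.gradY u.fst u.snd - S.gradY v.fst v.snd) (u.snd - v.snd)) := by
  have h1 := hS.proxP.norm_sub_le hζ (u.fst - ζ • S.gradX u.fst u.snd)
    (v.fst - ζ • S.gradX v.fst v.snd)
  have h2 := hS.proxQ.norm_sub_le hζ (u.snd + ζ • S.gradY u.fst u.snd)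
    (v.snd + ζ • S.gradY v.fst v.snd)
  have h3 := hS.lipschitz u.fst u.snd v.fst v.snd
  have e1 : u.fst - ζ • S.gradX u.fst u.snd - (v.fst - ζ • S.gradX v.fst v.snd) =
      (u.fst - v.fst) - ζ • (S.gradX u.fst u.snd - S.gradX v.fst v.snd) := by module
  have e2 : u.snd + ζ • S.gradY u.fst u.snd - (v.snd + ζ • S.gradY v.fst v.snd) =
      (u.snd - v.snd) + ζ • (S.gradY u.fst u.snd - S.gradY v.fst v.snd) := by module
  rw [e1] at h1
  rw [e2] at h2
  have h1' := pow_le_pow_left₀ (norm_nonneg _) h1 2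
  have h2' := pow_le_pow_left₀ (norm_nonneg _) h2 2
  rw [norm_sub_sq_real (u.fst - v.fst), norm_smul, inner_smul_right, mul_pow,
    Real.norm_of_nonneg hζ.le, real_inner_comm] at h1'
  rw [norm_add_sq_real (u.snd - v.snd), norm_smul, inner_smul_right, mul_pow,
    Real.norm_of_nonneg hζ.le, real_inner_comm] at h2'
  have h3' := mul_le_mul_of_nonneg_left h3 (sq_nonneg ζ)
  rw [show S.forwardBackward ζ u - S.forwardBackward ζ v = pair _ _ from rfl, norm_pair_sq,
    show u - v = pair (u.fst - v.fst) (u.snd - v.snd) from rfl, norm_pair_sq]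
  refine (add_le_add h1' h2').trans ?_
  linarith

/-- Off the domain the saddle operator need not be monotone; only its Lipschitz bound is left. -/
theorem IsStrong.forwardBackward_norm_le (hS : S.IsStrong σx σy L) {ζ : ℝ} (hζ : 0 < ζ)
    (u v : WithLp 2 (X × Y)) :
    ‖S.forwardBackward ζ u - S.forwardBackward ζ v‖ ≤ (1 + ζ * L) * ‖u - v‖ := by
  have hL := hS.L_pos
  refine abs_le_of_sq_le_sq' ?_ (by positivity) |>.2
  refine (hS.forwardBackward_sq_le hζ u v).trans ?_
  set gx := S.gradX u.fst u.snd - S.gradX v.fst v.snd with hgx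
  set gy := S.gradY u.fst u.snd - S.gradY v.fst v.snd with hgy
  have h1 : ‖pair gx (-gy)‖ ≤ L * ‖u - v‖ := by
    refine abs_le_of_sq_le_sq' ?_ (by positivity) |>.2
    rw [norm_pair_sq, norm_neg, mul_pow, WithLp.prod_norm_sq_eq_of_L2 (u - v)]
    exact hS.lipschitz u.fst u.snd v.fst v.snd
  have h2 := (abs_le.1 (abs_real_inner_le_norm (pair gx (-gy)) (u - v))).1
  have h3 : inner ℝ (pair gx (-gy)) (u - v) =
      inner ℝ gx (u.fst - v.fst) - inner ℝ gy (u.snd - v.snd) := by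
    rw [show u - v = pair (u.fst - v.fst) (u.snd - v.snd) from rfl, inner_pair, inner_neg_left]
    ring
  have h4 := mul_le_mul_of_nonneg_right h1 (norm_nonneg (u - v))
  have h5 : -(L * ‖u - v‖ ^ 2) ≤ inner ℝ gx (u.fst - v.fst) - inner ℝ gy (u.snd - v.snd) := by
    rw [← h3]; linarith
  have h6 := mul_le_mul_of_nonneg_left h5 (by positivity : 0 ≤ 2 * ζ)
  linarith

/-- The saddle point exists: on the domain the forward-backward map with step
`min σx σy / L²` is a contraction. -/
theorem IsStrong.exists_saddle [CompleteSpace X] [CompleteSpace Y] (hS : S.IsStrong σx σy L)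
    (hP : IsClosed S.domP) (hQ : IsClosed S.domQ) :
    ∃ xs ys, IsSubgradOn S.domP S.p (-S.gradX xs ys) xs ∧
      IsSubgradOn S.domQ S.q (S.gradY xs ys) ys := by
  have hL := hS.L_pos
  have hσx := hS.σx_pos
  have hσy := hS.σy_pos
  set m := min σx σy with hm
  have hm0 : 0 < m := lt_min hσx hσy
  have hmL : m ≤ L := by
    have := min_le_left σx σy
    linarith [hS.le_L]
  set ζ := m / L ^ 2 with hζdef
  have hζ : 0 < ζ := by positivity
  set D : Set (WithLp 2 (X × Y)) := {u | u.fst ∈ S.domP ∧ u.snd ∈ S.domQ} with hD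
  have hDc : IsClosed D :=
    (hP.preimage (by fun_prop)).inter (hQ.preimage (by fun_prop))
  have hmaps : ∀ u, S.forwardBackward ζ u ∈ D := fun u =>
    ⟨(hS.proxP ζ hζ _).1, (hS.proxQ ζ hζ _).1⟩
  have hK0 : 0 ≤ 1 - m ^ 2 / L ^ 2 := by
    rw [sub_nonneg, div_le_one (by positivity)]
    gcongr
  have hlip : ∀ u ∈ D, ∀ v ∈ D, ‖S.forwardBackward ζ u - S.forwardBackward ζ v‖ ≤
      √(1 - m ^ 2 / L ^ 2) * ‖u - v‖ := by
    intro u hu v hv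
    refine abs_le_of_sq_le_sq' ?_ (by positivity) |>.2
    rw [mul_pow, Real.sq_sqrt hK0]
    refine (hS.forwardBackward_sq_le hζ u v).trans ?_
    have h1 := hS.monotone hu.1 hv.1 hu.2 hv.2
    have h2 : m * ‖u - v‖ ^ 2 ≤ σx * ‖u.fst - v.fst‖ ^ 2 + σy * ‖u.snd - v.snd‖ ^ 2 := by
      rw [WithLp.prod_norm_sq_eq_of_L2 (u - v), mul_add]
      exact add_le_add (mul_le_mul_of_nonneg_right (min_le_left _ _) (sq_nonneg _))
        (mul_le_mul_of_nonneg_right (min_le_right _ _) (sq_nonneg _))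
    have h3 := mul_le_mul_of_nonneg_left (h2.trans h1) (by positivity : 0 ≤ 2 * ζ)
    have h4 : (1 - m ^ 2 / L ^ 2) * ‖u - v‖ ^ 2 =
        (1 + ζ ^ 2 * L ^ 2) * ‖u - v‖ ^ 2 - 2 * ζ * (m * ‖u - v‖ ^ 2) := by
      rw [hζdef]; field_simp; ring
    rw [h4]
    linarith
  have hcontr : ContractingWith (√(1 - m ^ 2 / L ^ 2)).toNNReal
      (MapsTo.restrict (S.forwardBackward ζ) D D fun u _ => hmaps u) := by
    refine ⟨?_, LipschitzWith.of_dist_le_mul fun u v => ?_⟩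
    · rw [Real.toNNReal_lt_one, Real.sqrt_lt' one_pos]
      have : 0 < m ^ 2 / L ^ 2 := by positivity
      linarith
    · rw [Subtype.dist_eq, Subtype.dist_eq, dist_eq_norm, dist_eq_norm,
        Real.coe_toNNReal _ (Real.sqrt_nonneg _)]
      exact hlip u u.2 v v.2
  obtain ⟨u, -, hu, -⟩ := hcontr.exists_fixedPoint' hDc.isComplete _ (hmaps 0) (edist_ne_top _ _)
  have h1 := hS.proxP ζ hζ (u.fst - ζ • S.gradX u.fst u.snd)
  have h2 := hS.proxQ ζ hζ (u.snd + ζ • S.gradY u.fst u.snd)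
  have e1 : S.proxP ζ (u.fst - ζ • S.gradX u.fst u.snd) = u.fst := congrArg WithLp.fst hu
  have e2 : S.proxQ ζ (u.snd + ζ • S.gradY u.fst u.snd) = u.snd := congrArg WithLp.snd hu
  rw [e1, sub_sub_cancel_left, smul_neg, smul_smul, inv_mul_cancel₀ hζ.ne', one_smul] at h1
  rw [e2, add_sub_cancel_left, smul_smul, inv_mul_cancel₀ hζ.ne', one_smul] at h2
  exact ⟨u.fst, u.snd, h1, h2⟩

/-- Quadratic growth in `x` of the objective at a point with a subgradient. -/
theorem IsStrong.value_growth_left (hS : S.IsStrong σx σy L) {x b x' : X} {y : Y}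
    (hx : IsSubgradOn S.domP S.p b x) (hy : y ∈ S.domQ) (hx' : x' ∈ S.domP) :
    S.value x y + inner ℝ (S.gradX x y + b) (x' - x) + σx / 2 * ‖x' - x‖ ^ 2 ≤ S.value x' y := by
  have h1 := hS.convex x hx.1 x' hx' y hy
  have h2 := hx.2 x' hx'
  rw [inner_add_left]
  unfold value
  linarith

theorem IsStrong.value_growth_right (hS : S.IsStrong σx σy L) {x : X} {y b y' : Y}
    (hx : x ∈ S.domP) (hy : IsSubgradOn S.domQ S.q b y) (hy' : y' ∈ S.domQ) :
    S.value x y' ≤ S.value x y - inner ℝ (-S.gradY x y + b) (y' - y)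
      - σy / 2 * ‖y' - y‖ ^ 2 := by
  have h1 := hS.concave x hx y hy.1 y' hy'
  have h2 := hy.2 y' hy'
  rw [inner_add_left, inner_neg_left]
  unfold value
  linarith

end SaddleProblem

end ForwardBackward

/-! ### The method for strongly convex-strongly concave problems -/

section OptimalMethod

variable {X Y : Type} [NormedAddCommGroup X] [InnerProductSpace ℝ X]
  [NormedAddCommGroup Y] [InnerProductSpace ℝ Y]

namespace SaddleProblem

variable {S : SaddleProblem X Y} {σx σy L : ℝ}

/-- `(x, y)` is stationary up to an error `(rx, ry)` of norm at most `τ`. -/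
def IsApproxSaddle (S : SaddleProblem X Y) (τ : ℝ) (r : X × Y) : Prop :=
  ∃ rx ry, ‖rx‖ ^ 2 + ‖ry‖ ^ 2 ≤ τ ^ 2 ∧ IsSubgradOn S.domP S.p (rx - S.gradX r.1 r.2) r.1 ∧
    IsSubgradOn S.domQ S.q (S.gradY r.1 r.2 - ry) r.2

/-- The dual objective before maximization over `x`: with `z` in place of `-σx x`, the supremum over
`x` of this function is a strongly convex function of `(z, y)` whose minimum is minus the saddle
value. -/
noncomputable def dualValue (S : SaddleProblem X Y) (σx : ℝ) (x z : X) (y : Y) : ℝ :=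
  ‖z + σx • x‖ ^ 2 / (2 * σx) - S.value x y

theorem IsStrong.dualValue_le (hS : S.IsStrong σx σy L) {x b x' : X} {y : Y}
    (hx : IsSubgradOn S.domP S.p b x) (hy : y ∈ S.domQ) (hx' : x' ∈ S.domP) :
    S.dualValue σx x' (S.gradX x y - σx • x + b) y ≤
      S.dualValue σx x (S.gradX x y - σx • x + b) y := by
  have hσ := hS.σx_pos
  have h1 := hS.value_growth_left hx hy hx'
  unfold dualValue
  have e1 : S.gradX x y - σx • x + b + σx • x = S.gradX x y + b := by abel
  have e2 : S.gradX x y - σx • x + b + σx • x' = (S.gradX x y + b) + σx • (x' - x) := by module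
  rw [e1, e2, norm_add_sq_real, norm_smul, inner_smul_right, mul_pow, Real.norm_of_nonneg hσ.le]
  have e3 : (‖S.gradX x y + b‖ ^ 2 + 2 * (σx * inner ℝ (S.gradX x y + b) (x' - x))
      + σx ^ 2 * ‖x' - x‖ ^ 2) / (2 * σx) = ‖S.gradX x y + b‖ ^ 2 / (2 * σx)
      + inner ℝ (S.gradX x y + b) (x' - x) + σx / 2 * ‖x' - x‖ ^ 2 := by field_simp
  rw [e3]
  linarith

/-- The strong subgradient inequality for the dual objective at `(z, y)`. -/
theorem IsStrong.le_dualValue (hS : S.IsStrong σx σy L) {x z z' : X} {y b y' : Y}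
    (hx : x ∈ S.domP) (hy : IsSubgradOn S.domQ S.q b y) (hy' : y' ∈ S.domQ) :
    S.dualValue σx x z y + inner ℝ (x + σx⁻¹ • z) (z' - z) + ‖z' - z‖ ^ 2 / (2 * σx)
      + inner ℝ (-S.gradY x y + b) (y' - y) + σy / 2 * ‖y' - y‖ ^ 2
      ≤ S.dualValue σx x z' y' := by
  have hσ := hS.σx_pos
  have h1 := hS.value_growth_right hx hy hy'
  unfold dualValue
  have e1 : x + σx⁻¹ • z = σx⁻¹ • (z + σx • x) := by
    rw [smul_add, smul_smul, inv_mul_cancel₀ hσ.ne', one_smul, add_comm]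
  have e2 : z' + σx • x = (z + σx • x) + (z' - z) := by abel
  rw [e1, e2, norm_add_sq_real (z + σx • x), inner_smul_left, conj_trivial]
  have e3 : (‖z + σx • x‖ ^ 2 + 2 * inner ℝ (z + σx • x) (z' - z) + ‖z' - z‖ ^ 2) / (2 * σx) =
      ‖z + σx • x‖ ^ 2 / (2 * σx) + σx⁻¹ * inner ℝ (z + σx • x) (z' - z)
        + ‖z' - z‖ ^ 2 / (2 * σx) := by field_simp
  rw [e3]
  linarith

/-- Residual of the output test at `û = forwardBackward u'` in terms of the distance of `u'` to the
saddle point. -/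
theorem IsStrong.residual_le (hS : S.IsStrong σx σy L) {ζ : ℝ} (hζ : 0 < ζ) (hζL : ζ * L ≤ 1 / 4)
    {xs : X} {ys : Y} (hxs : IsSubgradOn S.domP S.p (-S.gradX xs ys) xs)
    (hys : IsSubgradOn S.domQ S.q (S.gradY xs ys) ys) {x' xh : X} {y' yh : Y}
    (hxh : xh = S.proxP ζ (x' - ζ • S.gradX x' y')) (hyh : yh = S.proxQ ζ (y' + ζ • S.gradY x' y')) :
    ‖ζ⁻¹ • (x' - xh) - (S.gradX x' y' - S.gradX xh yh)‖ ^ 2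
      + ‖ζ⁻¹ • (yh - y') - (S.gradY x' y' - S.gradY xh yh)‖ ^ 2
      ≤ 81 / 16 * ((ζ⁻¹ + L) ^ 2 * (‖x' - xs‖ ^ 2 + ‖y' - ys‖ ^ 2)) := by
  have hL := hS.L_pos
  have hfix : S.forwardBackward ζ (pair xs ys) = pair xs ys := by
    have h1 := hS.proxP.eq_of_isSubgradOn hζ hxs
    have h2 := hS.proxQ.eq_of_isSubgradOn hζ hys
    rw [smul_neg, ← sub_eq_add_neg] at h1
    change pair (S.proxP ζ (xs - ζ • S.gradX xs ys)) (S.proxQ ζ (ys + ζ • S.gradY xs ys)) = _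
    rw [h1, h2]
  have hfb : S.forwardBackward ζ (pair x' y') = pair xh yh := by rw [hxh, hyh]; rfl
  have h1 := hS.forwardBackward_norm_le hζ (pair x' y') (pair xs ys)
  rw [hfix, hfb] at h1
  have h2 : ‖pair x' y' - pair xh yh‖ ≤ 9 / 4 * ‖pair x' y' - pair xs ys‖ := by
    have h3 := norm_sub_le_norm_sub_add_norm_sub (pair x' y') (pair xs ys) (pair xh yh)
    rw [norm_sub_rev (pair xs ys)] at h3
    have h4 := mul_le_mul_of_nonneg_right hζL (norm_nonneg (pair x' y' - pair xs ys))
    linarith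
  set g : WithLp 2 (X × Y) := pair (S.gradX x' y' - S.gradX xh yh) (S.gradY x' y' - S.gradY xh yh)
    with hg
  set d : WithLp 2 (X × Y) := pair (ζ⁻¹ • (x' - xh)) (ζ⁻¹ • (yh - y')) with hd
  have h3 : ‖g‖ ≤ L * ‖pair x' y' - pair xh yh‖ := by
    refine abs_le_of_sq_le_sq' ?_ (by positivity) |>.2
    rw [hg, mul_pow, show pair x' y' - pair xh yh = pair (x' - xh) (y' - yh) from rfl,
      norm_pair_sq, norm_pair_sq]
    exact hS.lipschitz x' y' xh yh
  have h4 : ‖d‖ = ζ⁻¹ * ‖pair x' y' - pair xh yh‖ := by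
    rw [← sq_eq_sq₀ (norm_nonneg _) (by positivity), hd, mul_pow,
      show pair x' y' - pair xh yh = pair (x' - xh) (y' - yh) from rfl, norm_pair_sq, norm_pair_sq,
      norm_smul, norm_smul, norm_sub_rev yh y', Real.norm_of_nonneg (by positivity)]
    ring
  have h5 : ‖d - g‖ ≤ (ζ⁻¹ + L) * (9 / 4 * ‖pair x' y' - pair xs ys‖) := by
    calc ‖d - g‖ ≤ ‖d‖ + ‖g‖ := norm_sub_le _ _
      _ ≤ (ζ⁻¹ + L) * ‖pair x' y' - pair xh yh‖ := by rw [h4]; linarith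
      _ ≤ _ := by gcongr
  have h6 := pow_le_pow_left₀ (norm_nonneg _) h5 2
  rw [show d - g = pair (ζ⁻¹ • (x' - xh) - (S.gradX x' y' - S.gradX xh yh))
    (ζ⁻¹ • (yh - y') - (S.gradY x' y' - S.gradY xh yh)) from rfl, norm_pair_sq, mul_pow, mul_pow,
    show pair x' y' - pair xs ys = pair (x' - xs) (y' - ys) from rfl, norm_pair_sq] at h6
  linarith

/-- `optimalMethod` started at `(-σx x₀, y₀)` reaches the tolerance `τ` within `K` passes, where
`Ψ` bounds the initial potential. Each pass costs one inner stage and the output test. -/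
theorem IsStrong.optimalMethod_ensures [CompleteSpace X] [CompleteSpace Y]
    (hS : S.IsStrong σx σy L) (hP : IsClosed S.domP) (hQ : IsClosed S.domQ)
    {O : SaddleOracle X Y} (hO : S.AnsweredBy O) {x₀ : X} {y₀ : Y} (hy₀ : y₀ ∈ S.domQ)
    {Rx Ry low up Ψ τ α η ζ : ℝ} (hτ : 0 ≤ τ)
    (hα : α = min 1 √(8 * σy / σx)) (hη : η = min (1 / (2 * σy)) (4 / (α * σx)))
    (hζ : ζ = min σx σy / L ^ 2)
    (hRx : ∀ x ∈ S.domP, ‖x - x₀‖ ^ 2 ≤ Rx) (hRy : ∀ y ∈ S.domQ, ‖y - y₀‖ ^ 2 ≤ Ry)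
    (hlow : ∀ x ∈ S.domP, low ≤ S.value x y₀)
    (hup : ∀ y ∈ S.domQ, ∀ c, (∀ x ∈ S.domP, c ≤ S.value x y) → c ≤ up)
    (hΨ : 2 * σx * Rx + η⁻¹ * Ry + 2 / α * (σx / 2 * Rx + up - low) ≤ Ψ)
    {N K : ℕ} (hN : 6 * (2 * √5 * (1 + 8 * L / σx)) ≤ N) (hK : 0 < K)
    (hKτ : 81 / 16 * ((ζ⁻¹ + L) ^ 2 * (max (1 / (2 * σx)) η * ((1 - α / 2) ^ K * Ψ))) ≤ τ ^ 2) :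
    (optimalMethod O σx σy L τ (-(σx • x₀)) y₀).Ensures (K * (4 * N + 12)) (K * (4 * N + 12))
      (S.IsApproxSaddle τ) := by
  have hσx := hS.σx_pos
  have hσy := hS.σy_pos
  have hL := hS.L_pos
  have hα0 : 0 < α := by rw [hα]; exact lt_min one_pos (by positivity)
  have hα1 : α ≤ 1 := by rw [hα]; exact min_le_left _ _
  have hα2 : α ^ 2 * σx ≤ 8 * σy := by
    have h1 : α ≤ √(8 * σy / σx) := by rw [hα]; exact min_le_right _ _
    have h2 : α ^ 2 ≤ 8 * σy / σx := (Real.le_sqrt hα0.le (by positivity)).1 h1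
    rwa [le_div_iff₀ hσx] at h2
  have hη0 : 0 < η := by rw [hη]; exact lt_min (by positivity) (by positivity)
  have hημ : 2 * (η * σy) ≤ 1 := by
    have : η ≤ 1 / (2 * σy) := by rw [hη]; exact min_le_left _ _
    rw [le_div_iff₀ (by positivity)] at this
    linarith
  have hηα : η * (α * σx) ≤ 4 := by
    have : η ≤ 4 / (α * σx) := by rw [hη]; exact min_le_right _ _
    rwa [le_div_iff₀ (by positivity)] at this
  have hαη : α ≤ 2 * (η * σy) := by
    have h1 : α / (2 * σy) ≤ η := by
      rw [hη]
      refine le_min ?_ ?_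
      · gcongr
      · rw [div_le_div_iff₀ (by positivity) (by positivity)]
        linarith
    rw [div_le_iff₀ (by positivity)] at h1
    linarith
  have hζ0 : 0 < ζ := by
    rw [hζ]; exact div_pos (lt_min hσx hσy) (by positivity)
  have hζL : ζ * L ≤ 1 / 4 := by
    have h1 : min σx σy ≤ L / 4 := by
      have h1 := min_le_left σx σy
      have h2 := min_le_right σx σy
      linarith [hS.le_L]
    have e : ζ * L = min σx σy / L := by rw [hζ]; field_simp
    rw [e, div_le_iff₀ hL]
    linarith
  obtain ⟨xs, ys, hxs, hys⟩ := hS.exists_saddle hP hQ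
  -- The saddle value is `-Fs`.
  set Fs : ℝ := -S.value xs ys with hFs
  have hright : ∀ y ∈ S.domQ, S.value xs y ≤ -Fs := fun y hy => by
    have h1 := hS.value_growth_right hxs.1 hys hy
    rw [neg_add_cancel, inner_zero_left] at h1
    have : 0 ≤ σy / 2 * ‖y - ys‖ ^ 2 := by positivity
    linarith
  have hleft : ∀ x ∈ S.domP, -Fs ≤ S.value x ys := fun x hx => by
    have h1 := hS.value_growth_left hxs hys.1 hx
    rw [add_neg_cancel, inner_zero_left] at h1
    have : 0 ≤ σx / 2 * ‖x - xs‖ ^ 2 := by positivity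
    linarith
  have hFs_dual : ∀ x ∈ S.domP, S.dualValue σx x (-(σx • xs)) ys ≤ Fs := fun x hx => by
    have h1 := hS.dualValue_le hxs hys.1 hx
    rw [show S.gradX xs ys - σx • xs + -S.gradX xs ys = -(σx • xs) by abel] at h1
    refine h1.trans (le_of_eq ?_)
    simp [dualValue, hFs]
  have hdual_Fs : ∀ z, ∀ y ∈ S.domQ, Fs ≤ S.dualValue σx xs z y := fun z y hy => by
    have h1 := hright y hy
    have : 0 ≤ ‖z + σx • xs‖ ^ 2 / (2 * σx) := by positivity
    unfold dualValue
    linarith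
  set I : ℕ → OuterState X Y → Prop := fun j s =>
    ∃ Φ : ℝ, s.yf ∈ S.domQ ∧ (∀ x ∈ S.domP, S.dualValue σx x s.zf s.yf ≤ Φ) ∧
      2 / σx * ‖s.z - -(σx • xs)‖ ^ 2 + η⁻¹ * ‖s.y - ys‖ ^ 2 + 2 / α * (Φ - Fs)
        ≤ (1 - α / 2) ^ j * Ψ with hI
  unfold optimalMethod
  refine Run.Ensures.mono (Run.Ensures.loop (I := I) (N := K - 1) (g := fun _ => 4 * N + 12)
    (p := fun _ => 4 * N + 12) (Q := S.IsApproxSaddle τ) ?_ ?_) ?_ ?_ (fun _ h => h)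
  rotate_left
  · refine ⟨σx / 2 * Rx - low, hy₀, fun x hx => ?_, ?_⟩
    · have h1 := hlow x hx
      have h2 := mul_le_mul_of_nonneg_left (hRx x hx) (by positivity : 0 ≤ σx / 2)
      unfold dualValue
      rw [show -(σx • x₀) + σx • x = σx • (x - x₀) by module, norm_smul, mul_pow,
        Real.norm_of_nonneg hσx.le]
      have e : σx ^ 2 * ‖x - x₀‖ ^ 2 / (2 * σx) = σx / 2 * ‖x - x₀‖ ^ 2 := by field_simp
      rw [e]
      linarith
    · have h1 := hup ys hys.1 (-Fs) hleft
      have h2 := hRx xs hxs.1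
      have h3 := hRy ys hys.1
      have e : 2 / σx * ‖-(σx • x₀) - -(σx • xs)‖ ^ 2 = 2 * σx * ‖xs - x₀‖ ^ 2 := by
        rw [show -(σx • x₀) - -(σx • xs) = σx • (xs - x₀) by module, norm_smul, mul_pow,
          Real.norm_of_nonneg hσx.le]
        field_simp
      simp only [pow_zero, one_mul]
      rw [e, norm_sub_rev y₀ ys]
      refine le_trans ?_ hΨ
      have h4 : 2 / α * (σx / 2 * Rx - low - Fs) ≤ 2 / α * (σx / 2 * Rx + up - low) := by
        refine mul_le_mul_of_nonneg_left ?_ (by positivity)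
        linarith
      gcongr
  · rw [Nat.sub_add_cancel hK]; simp
  · rw [Nat.sub_add_cancel hK]; simp
  rintro j hj s ⟨Φ, hyf, hΦ, hpot⟩
  refine Run.Ensures.bind' (hS.innerStage_ensures hO _ _ hN) (g' := 4) (p' := 2)
    (by omega) (by omega) ?_
  intro r hr
  refine Run.Ensures.bind' (hO.grad _ _) (g' := 2) (p' := 2) le_rfl le_rfl ?_
  rintro _ rfl
  refine Run.Ensures.bind' (hO.proxP _ _) (g' := 2) (p' := 1) le_rfl le_rfl ?_
  rintro xh hxh
  refine Run.Ensures.bind' (hO.proxQ _ _) (g' := 2) (p' := 0) le_rfl le_rfl ?_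
  rintro yh hyh
  refine Run.Ensures.bind' (hO.grad _ _) (g' := 0) (p' := 0) le_rfl le_rfl ?_
  rintro _ rfl
  rw [← hα, ← hζ] at hxh hyh ⊢
  rw [← hη] at hxh hyh ⊢
  rw [← hα] at hr
  dsimp only at hxh hyh ⊢
  set zg : X := α • s.z + (1 - α) • s.zf with hzg
  set yg : Y := α • s.y + (1 - α) • s.yf with hyg
  set zf : X := r.g.1 + r.bX with hzf
  set z' : X := s.z + (σx / 2 * σx⁻¹) • (zf - s.z) - (σx / 2) • (r.x + σx⁻¹ • zf) with hz'
  set y' : Y := s.y + (η * σy) • (r.y - s.y) - η • (-r.g.2 + r.bY + σy • r.y) with hy'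
  set x' : X := -(σx⁻¹ • z') with hx'
  have hzf' : zf = S.gradX r.x r.y - σx • r.x + r.bX := by rw [hzf, hr.grad]
  have hB : -r.g.2 + r.bY + σy • r.y = -S.gradY r.x r.y + r.bY := by
    rw [hr.grad]; simp only; abel
  -- One accelerated step.
  have hacc : 3 / 5 * σx * ‖r.x + σx⁻¹ • zf‖ ^ 2 + 4 / σx * ‖-r.g.2 + r.bY + σy • r.y‖ ^ 2 ≤
      -inner ℝ (r.x + σx⁻¹ • zf) (zf - zg)
        - inner ℝ (-r.g.2 + r.bY + σy • r.y) (r.y - yg) := by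
    refine decrease_of_accuracy hσx ?_
    have h1 := hr.accuracy
    have e1 : r.g.1 + (σx / 2) • (r.x - σx⁻¹ • zg) + r.bX =
        (1 / 2 : ℝ) • (zf - zg + σx • (r.x + σx⁻¹ • zf)) := by
      rw [smul_sub, smul_smul, smul_add σx, smul_smul, mul_inv_cancel₀ hσx.ne', one_smul,
        show σx / 2 * σx⁻¹ = 1 / 2 by field_simp, hzf]
      module
    have e2 : r.x - -(σx⁻¹ • zg) = r.x + σx⁻¹ • zf - σx⁻¹ • (zf - zg) := by module
    have e3 : -r.g.2 + σy • r.y + (σx / 8) • (r.y - yg) + r.bY =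
        -r.g.2 + r.bY + σy • r.y + (σx / 8) • (r.y - yg) := by abel
    rw [e1, e2, e3] at h1
    exact h1
  have hstep := outer_step (Ff := S.dualValue σx r.x zf r.y) (Fk := Φ) (Fs := Fs) hσx hσy.le
    hα0 hα1 hη0 hημ hηα hαη hzg hyg hz' hy' hacc
    (zs := -(σx • xs)) (ys := ys)
    (by rw [hB]
        exact (hS.le_dualValue hr.subgradX.1 hr.subgradY hys.1).trans
          (hFs_dual r.x hr.subgradX.1))
    (by rw [hB]
        exact (hS.le_dualValue hr.subgradX.1 hr.subgradY hyf).trans (hΦ r.x hr.subgradX.1))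
    ((hdual_Fs s.zf s.yf hyf).trans (hΦ xs hxs.1))
  have hdual : ∀ x ∈ S.domP, S.dualValue σx x zf r.y ≤ S.dualValue σx r.x zf r.y :=
    fun x hx => by
      rw [hzf']
      exact hS.dualValue_le hr.subgradX hr.subgradY.1 hx
  have hpot' : 2 / σx * ‖z' - -(σx • xs)‖ ^ 2 + η⁻¹ * ‖y' - ys‖ ^ 2
      + 2 / α * (S.dualValue σx r.x zf r.y - Fs) ≤ (1 - α / 2) ^ (j + 1) * Ψ := by
    refine hstep.trans ?_
    rw [pow_succ' (1 - α / 2), mul_assoc (1 - α / 2)]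
    exact mul_le_mul_of_nonneg_left hpot (by linarith)
  -- The output test succeeds once the potential is small.
  have hres := hS.residual_le hζ0 hζL hxs hys hxh hyh
  have hdist : ‖x' - xs‖ ^ 2 + ‖y' - ys‖ ^ 2 ≤
      max (1 / (2 * σx)) η * ((1 - α / 2) ^ (j + 1) * Ψ) := by
    have h1 : ‖x' - xs‖ ^ 2 = 1 / (2 * σx) * (2 / σx * ‖z' - -(σx • xs)‖ ^ 2) := by
      have e : x' - xs = -(σx⁻¹ • (z' - -(σx • xs))) := by
        rw [smul_sub, smul_neg, smul_smul, inv_mul_cancel₀ hσx.ne', one_smul, hx']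
        abel
      rw [e, norm_neg, norm_smul, mul_pow, Real.norm_of_nonneg (by positivity)]
      field_simp
    have h2 : ‖y' - ys‖ ^ 2 = η * (η⁻¹ * ‖y' - ys‖ ^ 2) := by field_simp
    have h3 : 0 ≤ 2 / α * (S.dualValue σx r.x zf r.y - Fs) := by
      have h4 := hdual xs hxs.1
      have h5 := hdual_Fs zf r.y hr.subgradY.1
      exact mul_nonneg (by positivity) (by linarith)
    have h4 : 1 / (2 * σx) * (2 / σx * ‖z' - -(σx • xs)‖ ^ 2) ≤
        max (1 / (2 * σx)) η * (2 / σx * ‖z' - -(σx • xs)‖ ^ 2) :=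
      mul_le_mul_of_nonneg_right (le_max_left _ _) (by positivity)
    have h5 : η * (η⁻¹ * ‖y' - ys‖ ^ 2) ≤ max (1 / (2 * σx)) η * (η⁻¹ * ‖y' - ys‖ ^ 2) :=
      mul_le_mul_of_nonneg_right (le_max_right _ _) (by positivity)
    have h6 : max (1 / (2 * σx)) η * (2 / σx * ‖z' - -(σx • xs)‖ ^ 2 + η⁻¹ * ‖y' - ys‖ ^ 2) ≤
        max (1 / (2 * σx)) η * ((1 - α / 2) ^ (j + 1) * Ψ) :=
      mul_le_mul_of_nonneg_left (by linarith) (le_max_of_le_right hη0.le)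
    rw [h1, h2]
    linarith
  have hres' : ‖ζ⁻¹ • (x' - xh) - (S.gradX x' y' - S.gradX xh yh)‖ ^ 2
      + ‖ζ⁻¹ • (yh - y') - (S.gradY x' y' - S.gradY xh yh)‖ ^ 2
      ≤ 81 / 16 * ((ζ⁻¹ + L) ^ 2 * (max (1 / (2 * σx)) η * ((1 - α / 2) ^ (j + 1) * Ψ))) :=
    hres.trans (by gcongr)
  split_ifs with hdone
  · refine Run.Ensures.pure ⟨ζ⁻¹ • (x' - xh) - (S.gradX x' y' - S.gradX xh yh),
      ζ⁻¹ • (yh - y') - (S.gradY x' y' - S.gradY xh yh), (Real.sqrt_le_left hτ).1 hdone, ?_, ?_⟩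
    · have h1 := hS.proxP ζ hζ0 (x' - ζ • S.gradX x' y')
      rw [← hxh] at h1
      convert! h1 using 1
      rw [sub_right_comm x', smul_sub ζ⁻¹ (x' - xh), smul_smul, inv_mul_cancel₀ hζ0.ne', one_smul]
      simp only
      abel
    · have h1 := hS.proxQ ζ hζ0 (y' + ζ • S.gradY x' y')
      rw [← hyh] at h1
      convert! h1 using 1
      rw [show y' + ζ • S.gradY x' y' - yh = ζ • S.gradY x' y' - (yh - y') by abel,
        smul_sub ζ⁻¹ (ζ • _), smul_smul, inv_mul_cancel₀ hζ0.ne', one_smul]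
      simp only
      abel
  · refine Run.Ensures.pure ⟨?_, S.dualValue σx r.x zf r.y, hr.subgradY.1, hdual, hpot'⟩
    by_contra hjK
    refine hdone ((Real.sqrt_le_left hτ).2 (hres'.trans ?_))
    rwa [show j + 1 = K by omega]

end SaddleProblem

end OptimalMethod

/-! ### The method for nonconvex-concave problems -/

section MinimaxMethod

variable {X Y : Type} [NormedAddCommGroup X] [InnerProductSpace ℝ X]
  [NormedAddCommGroup Y] [InnerProductSpace ℝ Y]

namespace SaddleProblem

/-- `S` is `Lh`-weakly convex in `x` and concave in `y` on its domain, in terms of the first-order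
inequalities for the oracle answers, which are `Lh`-Lipschitz on the whole space. -/
structure IsWeak (S : SaddleProblem X Y) (Lh : ℝ) : Prop where
  pos : 0 < Lh
  proxP : IsProxMap S.domP S.p S.proxP
  proxQ : IsProxMap S.domQ S.q S.proxQ
  weaklyConvex : ∀ x ∈ S.domP, ∀ x' ∈ S.domP, ∀ y ∈ S.domQ,
    S.h x y + inner ℝ (S.gradX x y) (x' - x) - Lh / 2 * ‖x' - x‖ ^ 2 ≤ S.h x' y
  concave : ∀ x ∈ S.domP, ∀ y ∈ S.domQ, ∀ y' ∈ S.domQ,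
    S.h x y' ≤ S.h x y + inner ℝ (S.gradY x y) (y' - y)
  lipschitz : ∀ x y x' y', ‖S.gradX x y - S.gradX x' y'‖ ^ 2 + ‖S.gradY x y - S.gradY x' y'‖ ^ 2
    ≤ Lh ^ 2 * (‖x - x'‖ ^ 2 + ‖y - y'‖ ^ 2)

/-- The subproblem with `h x y - μ ‖y - y₀‖² / 2 + Lh ‖x - xk‖²` in place of `h`. -/
noncomputable def regularize (S : SaddleProblem X Y) (Lh μ : ℝ) (xk : X) (y₀ : Y) :
    SaddleProblem X Y where
  domP := S.domP
  domQ := S.domQ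
  p := S.p
  q := S.q
  h x y := S.h x y - μ / 2 * ‖y - y₀‖ ^ 2 + Lh * ‖x - xk‖ ^ 2
  gradX x y := S.gradX x y + (2 * Lh) • (x - xk)
  gradY x y := S.gradY x y - μ • (y - y₀)
  proxP := S.proxP
  proxQ := S.proxQ

variable {S : SaddleProblem X Y} {Lh μ : ℝ}

theorem regularize_value (xk x : X) (y₀ y : Y) : (S.regularize Lh μ xk y₀).value x y =
    S.value x y - μ / 2 * ‖y - y₀‖ ^ 2 + Lh * ‖x - xk‖ ^ 2 := by
  unfold value regularize
  ring

/-- Adding a linear map with coefficients bounded by `c` to the oracle answers increases their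
Lipschitz constant by at most `c`. -/
theorem IsWeak.lipschitz_add (hS : S.IsWeak Lh) {a b c : ℝ} (ha : |a| ≤ c) (hb : |b| ≤ c)
    (x x' : X) (y y' : Y) :
    ‖S.gradX x y - S.gradX x' y' + a • (x - x')‖ ^ 2
      + ‖S.gradY x y - S.gradY x' y' + b • (y - y')‖ ^ 2
      ≤ (Lh + c) ^ 2 * (‖x - x'‖ ^ 2 + ‖y - y'‖ ^ 2) := by
  have hL := hS.pos
  have hc : 0 ≤ c := (abs_nonneg a).trans ha
  have h1 : ‖pair (S.gradX x y - S.gradX x' y') (S.gradY x y - S.gradY x' y')‖ ≤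
      Lh * ‖pair (x - x') (y - y')‖ := by
    refine abs_le_of_sq_le_sq' ?_ (by positivity) |>.2
    rw [mul_pow, norm_pair_sq, norm_pair_sq]
    exact hS.lipschitz x y x' y'
  have h2 : ‖pair (a • (x - x')) (b • (y - y'))‖ ≤ c * ‖pair (x - x') (y - y')‖ := by
    refine abs_le_of_sq_le_sq' ?_ (by positivity) |>.2
    rw [mul_pow, norm_pair_sq, norm_pair_sq, norm_smul, norm_smul, mul_pow, mul_pow, mul_add]
    rw [Real.norm_eq_abs, Real.norm_eq_abs]
    gcongr
  have h3 := (norm_add_le _ _).trans (add_le_add h1 h2)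
  rw [← add_mul] at h3
  have h4 := pow_le_pow_left₀ (norm_nonneg _) h3 2
  rw [mul_pow, norm_pair_sq, show pair (S.gradX x y - S.gradX x' y') (S.gradY x y - S.gradY x' y')
    + pair (a • (x - x')) (b • (y - y')) = pair (S.gradX x y - S.gradX x' y' + a • (x - x'))
      (S.gradY x y - S.gradY x' y' + b • (y - y')) from rfl, norm_pair_sq] at h4
  exact h4

theorem IsWeak.regularize_isStrong (hS : S.IsWeak Lh) (hμ : 0 < μ) (xk : X) (y₀ : Y) :
    (S.regularize Lh μ xk y₀).IsStrong Lh μ (3 * Lh + μ) where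
  σx_pos := hS.pos
  σy_pos := hμ
  le_L := le_rfl
  proxP := hS.proxP
  proxQ := hS.proxQ
  convex x hx x' hx' y hy := by
    have h1 := hS.weaklyConvex x hx x' hx' y hy
    have e : x' - xk = (x - xk) + (x' - x) := by abel
    simp only [regularize]
    rw [e, norm_add_sq_real, inner_add_left, inner_smul_left, conj_trivial]
    linarith
  concave x hx y hy y' hy' := by
    have h1 := hS.concave x hx y hy y' hy'
    have e : y' - y₀ = (y - y₀) + (y' - y) := by abel
    simp only [regularize]
    rw [e, norm_add_sq_real, inner_sub_left (S.gradY x y), inner_smul_left, conj_trivial]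
    linarith
  lipschitz x y x' y' := by
    have hL := hS.pos
    have h1 := hS.lipschitz_add (a := 2 * Lh) (b := -μ) (c := 2 * Lh + μ)
      (by rw [abs_of_pos (by positivity)]; linarith) (by rw [abs_neg, abs_of_pos hμ]; linarith)
      x x' y y'
    simp only [regularize]
    convert! h1 using 1
    · congr 3 <;> module
    · ring
  lipschitz_shift x y x' y' := by
    have hL := hS.pos
    have h1 := hS.lipschitz_add (a := 3 / 2 * Lh) (b := -(μ + Lh / 8)) (c := 2 * Lh + μ)
      (by rw [abs_of_pos (by positivity)]; linarith)
      (by rw [abs_neg, abs_of_pos (by positivity)]; linarith) x x' y y'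
    simp only [regularize]
    convert! h1 using 1
    · congr 3 <;> module
    · ring

theorem AnsweredBy.regularize {O : SaddleOracle X Y} (hO : S.AnsweredBy O) (Lh Dq ε : ℝ) (xk : X)
    (y₀ : Y) :
    (S.regularize Lh (ε / (2 * Dq)) xk y₀).AnsweredBy (subproblemOracle O Lh Dq ε xk y₀) where
  grad x y := (hO.grad x y).bind (g' := 0) (p' := 0) fun g hg =>
    Run.Ensures.pure (by rw [hg]; rfl)
  proxP := hO.proxP
  proxQ := hO.proxQ

theorem neg_sq_div_le_inner {E : Type} [NormedAddCommGroup E] [InnerProductSpace ℝ E] {σ : ℝ}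
    (hσ : 0 < σ) (r d : E) : -(‖r‖ ^ 2 / (2 * σ)) ≤ inner ℝ r d + σ / 2 * ‖d‖ ^ 2 := by
  have h : 0 ≤ ‖r + σ • d‖ ^ 2 / (2 * σ) := by positivity
  rw [norm_add_sq_real, inner_smul_right, norm_smul, mul_pow, Real.norm_of_nonneg hσ.le] at h
  have e : (‖r‖ ^ 2 + 2 * (σ * inner ℝ r d) + σ ^ 2 * ‖d‖ ^ 2) / (2 * σ) =
      ‖r‖ ^ 2 / (2 * σ) + inner ℝ r d + σ / 2 * ‖d‖ ^ 2 := by field_simp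
  rw [e] at h
  linarith

/-- An approximate saddle point of the subproblem decreases the primal function
`x ↦ max_y (value x y - μ ‖y - y₀‖² / 2)` by `Lh ‖r.1 - xk‖²`, up to an error of order `τ²`. -/
theorem IsWeak.primal_decrease (hS : S.IsWeak Lh) (hμ : 0 < μ) {xk : X} {y₀ : Y}
    (hxk : xk ∈ S.domP) {τ Φ : ℝ} {r : X × Y}
    (hr : (S.regularize Lh μ xk y₀).IsApproxSaddle τ r)
    (hΦ : ∀ y ∈ S.domQ, S.value xk y - μ / 2 * ‖y - y₀‖ ^ 2 ≤ Φ) {y : Y} (hy : y ∈ S.domQ) :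
    S.value r.1 y - μ / 2 * ‖y - y₀‖ ^ 2 ≤
      Φ - Lh * ‖r.1 - xk‖ ^ 2 + τ ^ 2 * (1 / (2 * Lh) + 1 / (2 * μ)) := by
  obtain ⟨rx, ry, hτ, hx, hy'⟩ := hr
  have hR := hS.regularize_isStrong hμ xk y₀
  have hL := hS.pos
  have h1 := hR.value_growth_left hx hy'.1 hxk
  have h2 := hR.value_growth_right hx.1 hy' hy
  rw [add_sub_cancel] at h1
  rw [neg_add_eq_sub, sub_sub_cancel_left] at h2
  have h3 := neg_sq_div_le_inner hL rx (xk - r.1)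
  have h4 := neg_sq_div_le_inner hμ (-ry) (y - r.2)
  have h5 := hΦ r.2 hy'.1
  rw [norm_neg] at h4
  rw [regularize_value, regularize_value, sub_self, norm_zero] at h1
  rw [regularize_value, regularize_value] at h2
  have h6 : ‖rx‖ ^ 2 / (2 * Lh) ≤ τ ^ 2 * (1 / (2 * Lh)) := by
    rw [div_eq_mul_one_div]
    exact mul_le_mul_of_nonneg_right (by linarith [sq_nonneg ‖ry‖]) (by positivity)
  have h7 : ‖ry‖ ^ 2 / (2 * μ) ≤ τ ^ 2 * (1 / (2 * μ)) := by
    rw [div_eq_mul_one_div]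
    exact mul_le_mul_of_nonneg_right (by linarith [sq_nonneg ‖rx‖]) (by positivity)
  linarith

theorem sum_inv_sq_le_two (k : ℕ) : ∑ j ∈ Finset.range k, 1 / ((j : ℝ) + 1) ^ 2 ≤ 2 := by
  have h : ∀ k : ℕ, ∑ j ∈ Finset.range (k + 1), 1 / ((j : ℝ) + 1) ^ 2 ≤ 2 - 1 / ((k : ℝ) + 1) := by
    intro k
    induction k with
    | zero => norm_num
    | succ k ih =>
      rw [Finset.sum_range_succ]
      have : 1 / (((k + 1 : ℕ) : ℝ) + 1) ^ 2 ≤ 1 / ((k : ℝ) + 1) - 1 / (((k + 1 : ℕ) : ℝ) + 1) := by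
        push_cast
        rw [div_sub_div _ _ (by positivity) (by positivity), div_le_div_iff₀ (by positivity)
          (by positivity)]
        nlinarith [(Nat.cast_nonneg k : (0 : ℝ) ≤ k)]
      linarith
  rcases k with _ | k
  · simp
  · have : 0 ≤ 1 / ((k : ℝ) + 1) := by positivity
    linarith [h k]

/-- `minimaxMethod` stops within `K + 1` passes; the bound `T k` on the number of passes of
`optimalMethod` in pass `k` is that of `IsStrong.optimalMethod_ensures`. Here `Φ₀` bounds the primal
function at the starting point from above and `φlow` bounds it from below everywhere. -/
theorem IsWeak.minimaxMethod_ensures [CompleteSpace X] [CompleteSpace Y] (hS : S.IsWeak Lh)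
    (hP : IsClosed S.domP) (hQ : IsClosed S.domQ) {O : SaddleOracle X Y} (hO : S.AnsweredBy O)
    {x₀ : X} {y₀ : Y} (hx₀ : x₀ ∈ S.domP) (hy₀ : y₀ ∈ S.domQ) {Dq ε ε₀ : ℝ} (hDq : 0 < Dq)
    (hε : 0 < ε) (hε₀ : 0 ≤ ε₀) (hμ : μ = ε / (2 * Dq))
    {Rx Ry low up Φ₀ φlow Ψ α η ζ : ℝ}
    (hα : α = min 1 √(8 * μ / Lh)) (hη : η = min (1 / (2 * μ)) (4 / (α * Lh)))
    (hζ : ζ = min Lh μ / (3 * Lh + μ) ^ 2)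
    (hRx : ∀ x ∈ S.domP, ∀ x' ∈ S.domP, ‖x - x'‖ ^ 2 ≤ Rx)
    (hRy : ∀ y ∈ S.domQ, ∀ y' ∈ S.domQ, ‖y - y'‖ ^ 2 ≤ Ry)
    (hlow : ∀ x ∈ S.domP, ∀ y ∈ S.domQ, low ≤ S.value x y - μ / 2 * ‖y - y₀‖ ^ 2)
    (hup : ∀ y ∈ S.domQ, ∀ c,
      (∀ x ∈ S.domP, c ≤ S.value x y - μ / 2 * ‖y - y₀‖ ^ 2) → c ≤ up)
    (hΦ₀ : ∀ y ∈ S.domQ, S.value x₀ y - μ / 2 * ‖y - y₀‖ ^ 2 ≤ Φ₀)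
    (hφlow : ∀ x ∈ S.domP, ∃ y ∈ S.domQ, φlow ≤ S.value x y - μ / 2 * ‖y - y₀‖ ^ 2)
    (hΨ : 2 * Lh * Rx + η⁻¹ * Ry + 2 / α * (Lh / 2 * Rx + (up + Lh * Rx) - low) ≤ Ψ)
    {N K : ℕ} {T : ℕ → ℕ} (hN : 6 * (2 * √5 * (1 + 8 * (3 * Lh + μ) / Lh)) ≤ N)
    (hK : 16 * Lh / ε ^ 2 * (Φ₀ - φlow + 2 * ε₀ ^ 2 * (1 / (2 * Lh) + 1 / (2 * μ))) ≤ K + 1)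
    (hT0 : ∀ k, 0 < T k)
    (hT : ∀ k, 81 / 16 * ((ζ⁻¹ + (3 * Lh + μ)) ^ 2 *
      (max (1 / (2 * Lh)) η * ((1 - α / 2) ^ T k * Ψ))) ≤ (ε₀ / ((k : ℝ) + 1)) ^ 2) :
    (minimaxMethod O Lh Dq ε ε₀ x₀ y₀).Ensures
      (∑ k ∈ Finset.range (K + 1), T k * (4 * N + 12))
      (∑ k ∈ Finset.range (K + 1), T k * (4 * N + 12))
      fun r => ∃ xk ∈ S.domP, (S.regularize Lh μ xk y₀).IsApproxSaddle ε₀ r ∧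
        ‖r.1 - xk‖ ≤ ε / (4 * Lh) ∧ ∀ y ∈ S.domQ, S.value r.1 y - μ / 2 * ‖y - y₀‖ ^ 2 ≤
          Φ₀ + 2 * ε₀ ^ 2 * (1 / (2 * Lh) + 1 / (2 * μ)) := by
  have hL := hS.pos
  have hμ0 : 0 < μ := by rw [hμ]; positivity
  have hRx0 : 0 ≤ Rx := (sq_nonneg _).trans (hRx x₀ hx₀ x₀ hx₀)
  set c : ℝ := 1 / (2 * Lh) + 1 / (2 * μ) with hc
  have hc0 : 0 < c := by positivity
  set e : ℝ := ε ^ 2 / (16 * Lh) with he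
  have he0 : 0 < e := by positivity
  set I : ℕ → ℕ × X × Y → Prop := fun k s => s.1 = k ∧ s.2.1 ∈ S.domP ∧ s.2.2 ∈ S.domQ ∧
    ∃ Φ, (∀ y ∈ S.domQ, S.value s.2.1 y - μ / 2 * ‖y - y₀‖ ^ 2 ≤ Φ) ∧
      Φ + k * e ≤ Φ₀ + ε₀ ^ 2 * c * ∑ j ∈ Finset.range k, 1 / ((j : ℝ) + 1) ^ 2 with hI
  have hsum : ∀ k : ℕ, Φ₀ + ε₀ ^ 2 * c * ∑ j ∈ Finset.range k, 1 / ((j : ℝ) + 1) ^ 2 ≤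
      Φ₀ + 2 * ε₀ ^ 2 * c := fun k => by
    have := mul_le_mul_of_nonneg_left (sum_inv_sq_le_two k) (by positivity : 0 ≤ ε₀ ^ 2 * c)
    linarith
  unfold minimaxMethod
  refine Run.Ensures.loop (I := I) (N := K) ?_ ⟨rfl, hx₀, hy₀, Φ₀, hΦ₀, by simp⟩
  rintro _ hk ⟨k, xk, yk⟩ ⟨rfl, hxk, hyk, Φ, hΦ, hpot⟩
  dsimp only at hxk hyk hΦ hpot hk ⊢
  rw [← hμ]
  set τ : ℝ := ε₀ / ((k : ℝ) + 1) with hτdef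
  have hτ0 : 0 ≤ τ := by positivity
  have hOk := hO.regularize Lh Dq ε xk y₀
  rw [← hμ] at hOk
  have hopt := (hS.regularize_isStrong hμ0 xk y₀).optimalMethod_ensures hP hQ hOk (x₀ := xk)
    (y₀ := yk) (Rx := Rx) (Ry := Ry) (low := low) (up := up + Lh * Rx) (Ψ := Ψ) (τ := τ)
    (K := T k) hyk hτ0 hα hη hζ (fun x hx => hRx x hx xk hxk) (fun y hy => hRy y hy yk hyk)
    (fun x hx => by
      rw [regularize_value]
      have := hlow x hx yk hyk
      have : 0 ≤ Lh * ‖x - xk‖ ^ 2 := by positivity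
      linarith)
    (fun y hy a ha => by
      have h1 := hup y hy (a - Lh * Rx) fun x hx => by
        have h2 := ha x hx
        rw [regularize_value] at h2
        have h3 := mul_le_mul_of_nonneg_left (hRx x hx xk hxk) hL.le
        linarith
      linarith)
    hΨ hN (hT0 k) (hT k)
  refine Run.Ensures.bind' hopt (g' := 0) (p' := 0) le_rfl le_rfl ?_
  rintro ⟨x, y⟩ hr
  have hx : x ∈ S.domP := by obtain ⟨_, _, _, h, _⟩ := hr; exact h.1
  have hy : y ∈ S.domQ := by obtain ⟨_, _, _, _, h⟩ := hr; exact h.1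
  have hdec := fun y hy => hS.primal_decrease hμ0 hxk hr hΦ (y := y) hy
  dsimp only at hdec ⊢
  have hsum' : τ ^ 2 * c = ε₀ ^ 2 * c * (1 / ((k : ℝ) + 1) ^ 2) := by
    rw [hτdef, div_pow]; ring
  have hpot' : Φ + τ ^ 2 * c + k * e ≤
      Φ₀ + ε₀ ^ 2 * c * ∑ j ∈ Finset.range (k + 1), 1 / ((j : ℝ) + 1) ^ 2 := by
    rw [Finset.sum_range_succ, mul_add (ε₀ ^ 2 * c), hsum']
    linarith
  have hke : 0 ≤ k * e := by positivity
  split_ifs with hdone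
  · refine Run.Ensures.pure ⟨xk, hxk, ?_, hdone, fun y hy => ?_⟩
    · obtain ⟨rx, ry, h, h1, h2⟩ := hr
      refine ⟨rx, ry, h.trans (pow_le_pow_left₀ hτ0 ?_ 2), h1, h2⟩
      exact div_le_self hε₀ (by linarith [(Nat.cast_nonneg k : (0 : ℝ) ≤ k)])
    · have h1 := hdec y hy
      have h2 := hsum (k + 1)
      have : 0 ≤ Lh * ‖x - xk‖ ^ 2 := by positivity
      linarith
  · -- A pass that does not stop decreases the primal function by more than `e`.
    have hbig : e < Lh * ‖x - xk‖ ^ 2 := by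
      have h1 := pow_lt_pow_left₀ (not_le.1 hdone) (by positivity) two_ne_zero
      have h2 := mul_lt_mul_of_pos_left h1 hL
      have h3 : Lh * (ε / (4 * Lh)) ^ 2 = e := by rw [he]; field_simp; norm_num
      rwa [h3] at h2
    refine Run.Ensures.pure ⟨?_, rfl, hx, hy, Φ - Lh * ‖x - xk‖ ^ 2 + τ ^ 2 * c, hdec, ?_⟩
    · obtain ⟨y', hy', hφ⟩ := hφlow x hx
      have h1 := hdec y' hy'
      have h2 := hsum (k + 1)
      have h3 : ((k : ℝ) + 1) * e < Φ₀ - φlow + 2 * ε₀ ^ 2 * c := by linarith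
      have h4 : (k : ℝ) + 1 < K + 1 := by
        refine lt_of_lt_of_le ?_ hK
        rw [← lt_div_iff₀ he0] at h3
        refine h3.trans_eq ?_
        rw [he]
        field_simp
      have h5 : (k : ℝ) < K := by linarith
      exact_mod_cast h5
    · push_cast
      linarith

end SaddleProblem

end MinimaxMethod

/-! ### Proper closed convex functions and their proximal operator -/

theorem eq_top_of_notMem_effDom {E : Type} {φ : E → EReal} {x : E} (hx : x ∉ effDom φ) :
    φ x = ⊤ :=
  not_lt_top_iff.1 hx

section ProperClosedConvex

variable {E : Type} [NormedAddCommGroup E] [InnerProductSpace ℝ E] {φ : E → EReal}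

theorem IsProperClosedConvex.coe_toReal (hφ : IsProperClosedConvex φ) {x : E}
    (hx : x ∈ effDom φ) : ((φ x).toReal : EReal) = φ x :=
  EReal.coe_toReal (ne_of_lt hx) (hφ.ne_bot x)

theorem IsProperClosedConvex.segment (hφ : IsProperClosedConvex φ) {x y : E}
    (hx : x ∈ effDom φ) (hy : y ∈ effDom φ) {t : ℝ} (ht0 : 0 ≤ t) (ht1 : t ≤ 1) :
    x + t • (y - x) ∈ effDom φ ∧
      (φ (x + t • (y - x))).toReal ≤ (φ x).toReal + t * ((φ y).toReal - (φ x).toReal) := by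
  have h := hφ.convex (x := (x, (φ x).toReal)) (hφ.coe_toReal hx).ge
    (y := (y, (φ y).toReal)) (hφ.coe_toReal hy).ge (by linarith : 0 ≤ 1 - t) ht0 (by ring)
  have e : (1 - t) • x + t • y = x + t • (y - x) := by module
  have h' : φ (x + t • (y - x)) ≤
      (((1 - t) * (φ x).toReal + t * (φ y).toReal : ℝ) : EReal) := by
    rw [← e]; exact h
  have hd : x + t • (y - x) ∈ effDom φ := h'.trans_lt (EReal.coe_lt_top _)
  refine ⟨hd, ?_⟩
  rw [← hφ.coe_toReal hd, EReal.coe_le_coe_iff] at h'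
  linarith

theorem IsProperClosedConvex.convex_effDom (hφ : IsProperClosedConvex φ) :
    Convex ℝ (effDom φ) := by
  intro x hx y hy a b ha hb hab
  have h := (hφ.segment hx hy hb (by linarith)).1
  rwa [show x + b • (y - x) = a • x + b • y by
    rw [← sub_eq_iff_eq_add'.2 (show (1 : ℝ) = b + a by linarith)]; module] at h

theorem IsProperClosedConvex.lowerSemicontinuousOn (hφ : IsProperClosedConvex φ) :
    LowerSemicontinuousOn (fun x => (φ x).toReal) (effDom φ) := by
  intro x hx c hc
  have h1 : (c : EReal) < φ x := by
    rw [← hφ.coe_toReal hx]; exact_mod_cast hc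
  filter_upwards [(hφ.closed x c h1).filter_mono nhdsWithin_le_nhds, self_mem_nhdsWithin]
    with y hy hy'
  rw [← hφ.coe_toReal hy'] at hy
  exact_mod_cast hy

theorem IsProperClosedConvex.exists_isProx (hφ : IsProperClosedConvex φ)
    (hc : IsCompact (effDom φ)) {γ : ℝ} (hγ : 0 < γ) (x : E) : ∃ u, IsProx γ φ x u := by
  have hlsc : LowerSemicontinuousOn (fun u => ‖u - x‖ ^ 2 / 2 + γ * (φ u).toReal) (effDom φ) := by
    refine LowerSemicontinuousOn.add ?_ ?_
    · exact (Continuous.continuousOn (by fun_prop)).lowerSemicontinuousOn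
    · exact (continuous_const_mul γ).comp_lowerSemicontinuousOn hφ.lowerSemicontinuousOn
        fun a b hab => mul_le_mul_of_nonneg_left hab hγ.le
  obtain ⟨u, hu, hmin⟩ := hlsc.exists_isMinOn hφ.nonempty_dom hc
  refine ⟨u, fun v => ?_⟩
  by_cases hv : v ∈ effDom φ
  · rw [← hφ.coe_toReal hu, ← hφ.coe_toReal hv]
    exact_mod_cast hmin hv
  · rw [eq_top_of_notMem_effDom hv, EReal.coe_mul_top_of_pos hγ, EReal.coe_add_top]
    exact le_top

theorem nonneg_of_forall_add_mul_nonneg {a b : ℝ}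
    (h : ∀ t : ℝ, 0 < t → t ≤ 1 → 0 ≤ a + t * b) : 0 ≤ a := by
  have hlim : Tendsto (fun t : ℝ => a + t * b) (𝓝[>] 0) (𝓝 (a + 0 * b)) :=
    (Continuous.tendsto (by fun_prop) 0).mono_left nhdsWithin_le_nhds
  rw [zero_mul, add_zero] at hlim
  refine ge_of_tendsto hlim ?_
  filter_upwards [Ioc_mem_nhdsGT one_pos] with t ht using h t ht.1 ht.2

theorem IsProperClosedConvex.isSubgradOn_of_isProx (hφ : IsProperClosedConvex φ) {γ : ℝ}
    (hγ : 0 < γ) {x u : E} (hu : IsProx γ φ x u) :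
    IsSubgradOn (effDom φ) (fun v => (φ v).toReal) (γ⁻¹ • (x - u)) u := by
  have hud : u ∈ effDom φ := by
    by_contra hud
    obtain ⟨v, hv⟩ := hφ.nonempty_dom
    have h := hu v
    rw [eq_top_of_notMem_effDom hud, EReal.coe_mul_top_of_pos hγ, EReal.coe_add_top,
      ← hφ.coe_toReal hv, ← EReal.coe_mul, ← EReal.coe_add] at h
    exact absurd (top_le_iff.1 h) (EReal.coe_ne_top _)
  refine ⟨hud, fun w hw => ?_⟩
  -- The first-order condition along the segment from `u` to `w`.
  have h : 0 ≤ inner ℝ (u - x) (w - u) + γ * ((φ w).toReal - (φ u).toReal) := by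
    refine nonneg_of_forall_add_mul_nonneg (b := ‖w - u‖ ^ 2 / 2) fun t ht0 ht1 => ?_
    obtain ⟨hd, hle⟩ := hφ.segment hud hw ht0.le ht1
    have h1 := hu (u + t • (w - u))
    rw [← hφ.coe_toReal hud, ← hφ.coe_toReal hd, ← EReal.coe_mul, ← EReal.coe_mul,
      ← EReal.coe_add, ← EReal.coe_add, EReal.coe_le_coe_iff,
      show u + t • (w - u) - x = (u - x) + t • (w - u) by abel, norm_add_sq_real, norm_smul,
      inner_smul_right, mul_pow, Real.norm_of_nonneg ht0.le] at h1
    have h2 := mul_le_mul_of_nonneg_left hle hγ.le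
    have h3 : 0 ≤ t * (inner ℝ (u - x) (w - u) + γ * ((φ w).toReal - (φ u).toReal)
        + t * (‖w - u‖ ^ 2 / 2)) := by linarith
    exact nonneg_of_mul_nonneg_right h3 ht0
  rw [inner_smul_left, conj_trivial]
  have e : inner ℝ (x - u) (w - u) = -inner ℝ (u - x) (w - u) := by
    rw [← inner_neg_left, neg_sub]
  have h2 : γ⁻¹ * inner ℝ (x - u) (w - u) ≤ (φ w).toReal - (φ u).toReal := by
    rw [inv_mul_le_iff₀ hγ, e]
    linarith
  linarith

theorem IsProperClosedConvex.isProxMap (hφ : IsProperClosedConvex φ)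
    (hc : IsCompact (effDom φ)) :
    IsProxMap (effDom φ) (fun v => (φ v).toReal) (fun γ => prox γ φ) := fun _ hγ x =>
  hφ.isSubgradOn_of_isProx hγ (Classical.epsilon_spec (hφ.exists_isProx hc hγ x))

end ProperClosedConvex

/-! ### First-order inequalities -/

section FirstOrder

variable {E : Type} [NormedAddCommGroup E] [InnerProductSpace ℝ E] [CompleteSpace E]

theorem hasDerivAt_segment {φ : E → ℝ} {u v g : E} {t : ℝ}
    (h : HasGradientAt φ g (u + t • (v - u))) :
    HasDerivAt (fun s : ℝ => φ (u + s • (v - u))) (inner ℝ g (v - u)) t := by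
  have h1 : HasDerivAt (fun s : ℝ => u + s • (v - u)) (v - u) t := by
    simpa using ((hasDerivAt_id t).smul_const (v - u)).const_add u
  exact (h.hasFDerivAt.comp_hasDerivAt t h1).congr_deriv (by simp)

/-- The descent lemma on a convex set. -/
theorem SmoothOn.abs_sub_le {φ : E → ℝ} {L : ℝ} {D : Set E} (h : SmoothOn L φ D)
    (hD : Convex ℝ D) {u v : E} (hu : u ∈ D) (hv : v ∈ D) :
    |φ v - φ u - inner ℝ (gradient φ u) (v - u)| ≤ L / 2 * ‖v - u‖ ^ 2 := by
  have hseg : ∀ t ∈ Icc (0 : ℝ) 1, u + t • (v - u) ∈ D := fun t ht => by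
    have := hD hu hv (by linarith [ht.2] : 0 ≤ 1 - t) ht.1 (by ring)
    rwa [show (1 - t) • u + t • v = u + t • (v - u) by module] at this
  set k : ℝ → ℝ := fun t => φ (u + t • (v - u)) with hk
  set k' : ℝ → ℝ := fun t => inner ℝ (gradient φ (u + t • (v - u))) (v - u) with hk'
  have hderiv : ∀ t ∈ Icc (0 : ℝ) 1, HasDerivAt k (k' t) t := fun t ht =>
    hasDerivAt_segment (h.1 _ (hseg t ht)).hasGradientAt
  set c := inner ℝ (gradient φ u) (v - u) with hc
  have hbound : ∀ t ∈ Icc (0 : ℝ) 1, |k' t - c| ≤ L * ‖v - u‖ ^ 2 * t := fun t ht => by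
    have h1 := h.2 _ (hseg t ht) u hu
    rw [add_sub_cancel_left, norm_smul, Real.norm_of_nonneg ht.1] at h1
    rw [hk', hc, ← inner_sub_left]
    refine (abs_real_inner_le_norm _ _).trans ?_
    have h2 := mul_le_mul_of_nonneg_right h1 (norm_nonneg (v - u))
    linarith
  have hcont : ContinuousOn k (Icc 0 1) := fun t ht => (hderiv t ht).continuousAt.continuousWithinAt
  have hB : ∀ a b : ℝ, ∀ t, HasDerivAt (fun s : ℝ => k 0 + c * s + a * (s ^ 2 / 2))
      (c + a * t) t := fun a b t => by
    have h1 := (((hasDerivAt_id t).const_mul c).const_add (k 0)).add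
      ((((hasDerivAt_id t).pow 2).div_const 2).const_mul a)
    convert! h1 using 1
    simp
  have h01 : (1 : ℝ) ∈ Icc (0 : ℝ) 1 := ⟨zero_le_one, le_rfl⟩
  have hup := image_le_of_deriv_right_le_deriv_boundary hcont
    (fun t ht => (hderiv t ⟨ht.1, ht.2.le⟩).hasDerivWithinAt)
    (B := fun s => k 0 + c * s + L * ‖v - u‖ ^ 2 * (s ^ 2 / 2)) (by simp)
    (fun t _ => (hB _ 0 t).continuousAt.continuousWithinAt)
    (fun t _ => (hB _ 0 t).hasDerivWithinAt)
    (fun t ht => by have := (abs_le.1 (hbound t ⟨ht.1, ht.2.le⟩)).2; linarith) h01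
  have hlo := image_le_of_deriv_right_le_deriv_boundary
    (f := fun s => k 0 + c * s + -(L * ‖v - u‖ ^ 2) * (s ^ 2 / 2)) (B := k)
    (fun t _ => (hB _ 0 t).continuousAt.continuousWithinAt)
    (fun t _ => (hB _ 0 t).hasDerivWithinAt) (by simp) hcont
    (fun t ht => (hderiv t ⟨ht.1, ht.2.le⟩).hasDerivWithinAt)
    (fun t ht => by have := (abs_le.1 (hbound t ⟨ht.1, ht.2.le⟩)).1; linarith) h01
  have e0 : k 0 = φ u := by simp [hk]
  have e1 : k 1 = φ v := by simp [hk]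
  rw [e0, e1] at hup hlo
  rw [abs_le]
  constructor <;> linarith

theorem ConvexOn.add_inner_le {φ : E → ℝ} {D : Set E} (h : ConvexOn ℝ D φ) {u v g : E}
    (hu : u ∈ D) (hv : v ∈ D) (hg : HasGradientAt φ g u) : φ u + inner ℝ g (v - u) ≤ φ v := by
  have h1 : ConvexOn ℝ (Icc (0 : ℝ) 1) (fun t : ℝ => φ (u + t • (v - u))) := by
    have h2 := h.comp_affineMap (AffineMap.lineMap u v)
    refine (h2.subset (fun t ht => ?_) (convex_Icc 0 1)).congr fun t _ => ?_
    · have h3 := h.1 hu hv (by linarith [ht.2] : 0 ≤ 1 - t) ht.1 (by ring)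
      rwa [mem_preimage, AffineMap.lineMap_apply_module]
    · simp [AffineMap.lineMap_apply, add_comm]
  have h2 := h1.le_slope_of_hasDerivAt (left_mem_Icc.2 zero_le_one) (right_mem_Icc.2 zero_le_one)
    one_pos (hasDerivAt_segment (by simpa using hg))
  rw [slope_def_field] at h2
  simp at h2
  linarith

end FirstOrder

/-! ### Subgradients of a smooth plus a convex function -/

section Subdifferential

variable {E : Type} [NormedAddCommGroup E] [InnerProductSpace ℝ E] [CompleteSpace E]

/-- The gradient of the smooth part plus a convex subgradient belongs to the subdifferential. The
limsup defining the upper subderivative is bounded below along `x' = u`. -/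
theorem add_mem_subdifferential {F : E → EReal} {φ : E → ℝ} {ψ : E → EReal} {u g s : E} {a : ℝ}
    (hF : ∀ v, F v = (φ v : EReal) + ψ v) (hφ : HasGradientAt φ g u) (hψ : ψ u = (a : EReal))
    (hs : ∀ v, ((a + inner ℝ s (v - u) : ℝ) : EReal) ≤ ψ v) :
    g + s ∈ subdifferential F u := by
  have hFu : F u = ((φ u + a : ℝ) : EReal) := by rw [hF, hψ, ← EReal.coe_add]
  refine ⟨?_, fun d => ?_⟩
  · change F u < ⊤
    rw [hFu]
    exact EReal.coe_lt_top _
  refine EReal.ge_of_forall_gt_iff_ge.1 fun c hc => ?_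
  rw [EReal.coe_lt_coe_iff] at hc
  set δ := inner ℝ (g + s) d - c with hδ
  have hδ0 : 0 < δ := by linarith
  set r := δ / (2 * (‖g + s‖ + 1)) with hr
  have hr0 : 0 < r := by positivity
  set η := δ / (2 * (‖d‖ + r)) with hη
  have hη0 : 0 < η := by positivity
  refine le_iSup₂_of_le r hr0 (le_limsup_of_frequently_le' ?_)
  have hle : (pure u : Filter E) ×ˢ 𝓝[>] (0 : ℝ) ≤ (𝓝 u ⊓ comap F (𝓝 (F u))) ×ˢ 𝓝[>] (0 : ℝ) := by
    refine prod_mono ?_ le_rfl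
    exact le_inf (pure_le_nhds u) (map_le_iff_le_comap.1 (by rw [map_pure]; exact pure_le_nhds _))
  refine Filter.Frequently.filter_mono (Eventually.frequently ?_) hle
  rw [pure_prod, eventually_map]
  have h1 := (hasGradientAt_iff_isLittleO_nhds_zero.1 hφ).def hη0
  obtain ⟨ρ, hρ0, hρ⟩ := Metric.eventually_nhds_iff.1 h1
  filter_upwards [Ioo_mem_nhdsGT (show 0 < ρ / (‖d‖ + r) by positivity)] with t ht
  refine le_iInf₂ fun d' hd' => ?_
  have ht0 : 0 < t := ht.1
  have hd'1 : ‖d' - d‖ < r := by rwa [mem_ball_iff_norm] at hd'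
  have hd'2 : ‖d'‖ ≤ ‖d‖ + r := by
    have := norm_add_le d (d' - d)
    rw [add_sub_cancel] at this
    linarith
  have h2 := @hρ (t • d') (by
    rw [dist_zero_right, norm_smul, Real.norm_of_nonneg ht0.le]
    have := (lt_div_iff₀ (by positivity)).1 ht.2
    exact (mul_le_mul_of_nonneg_left hd'2 ht0.le).trans_lt this)
  rw [norm_smul, Real.norm_of_nonneg ht0.le, inner_smul_right, Real.norm_eq_abs] at h2
  have h3 := (abs_le.1 h2).1
  have h4 : η * ‖d'‖ ≤ δ / 2 := by
    calc η * ‖d'‖ ≤ η * (‖d‖ + r) := by gcongr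
      _ = δ / 2 := by rw [hη]; field_simp
  have h5 : inner ℝ (g + s) d - δ / 2 ≤ inner ℝ (g + s) d' := by
    have h6 := (abs_le.1 (abs_real_inner_le_norm (g + s) (d' - d))).1
    rw [inner_sub_right] at h6
    have h7 : ‖g + s‖ * ‖d' - d‖ ≤ δ / 2 := by
      calc ‖g + s‖ * ‖d' - d‖ ≤ (‖g + s‖ + 1) * r := by gcongr; linarith
        _ = δ / 2 := by rw [hr]; field_simp
    linarith
  have h6 : ((φ u + a + t * c : ℝ) : EReal) ≤ F (u + t • d') := by
    rw [hF]
    have h7 := hs (u + t • d')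
    rw [add_sub_cancel_left, inner_smul_right] at h7
    refine le_trans ?_ (add_le_add_right h7 _)
    rw [← EReal.coe_add, EReal.coe_le_coe_iff]
    rw [inner_add_left g s d'] at h5
    have h8 := mul_le_mul_of_nonneg_left h5 ht0.le
    have h9 := mul_le_mul_of_nonneg_left h4 ht0.le
    have h10 : t * (inner ℝ (g + s) d - δ / 2) - t * (δ / 2) = t * c := by rw [hδ]; ring
    linarith
  change (c : EReal) ≤ (F (u + t • d') - F u) / (t : EReal)
  have h7 : ((t * c : ℝ) : EReal) ≤ F (u + t • d') - F u := by
    refine le_trans (le_of_eq ?_) (EReal.sub_le_sub h6 le_rfl)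
    rw [hFu, ← EReal.coe_sub]
    congr 1
    ring
  refine le_trans (le_of_eq ?_) (EReal.div_le_div_right_of_nonneg
    (EReal.coe_nonneg.2 ht0.le) h7)
  rw [← EReal.coe_div]
  congr 1
  field_simp

theorem HasGradientAt.partial_fst {n m : ℕ} {f : Pair n m → ℝ} {g : Pair n m} {x : Vec n}
    {z : Vec m} (h : HasGradientAt f g (stack x z)) :
    HasGradientAt (fun x' => f (stack x' z)) g.fst x := by
  rw [hasGradientAt_iff_isLittleO] at h ⊢
  have hc : Continuous fun x' : Vec n => stack x' z := by fun_prop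
  have h1 := h.comp_tendsto (hc.tendsto x)
  have e : ∀ x', stack x' z - stack x z = stack (x' - x) 0 := fun x' => by
    change stack (x' - x) (z - z) = _
    rw [sub_self]
  refine (h1.congr_left fun x' => ?_).trans_le fun x' => ?_
  · simp only [Function.comp]
    rw [e, WithLp.prod_inner_apply]
    simp
  · simp only [Function.comp]
    rw [e, ← sq_le_sq₀ (norm_nonneg _) (norm_nonneg _), WithLp.prod_norm_sq_eq_of_L2]
    simp

theorem HasGradientAt.partial_snd {n m : ℕ} {f : Pair n m → ℝ} {g : Pair n m} {x : Vec n}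
    {z : Vec m} (h : HasGradientAt f g (stack x z)) :
    HasGradientAt (fun z' => f (stack x z')) g.snd z := by
  rw [hasGradientAt_iff_isLittleO] at h ⊢
  have hc : Continuous fun z' : Vec m => stack x z' := by fun_prop
  have h1 := h.comp_tendsto (hc.tendsto z)
  have e : ∀ z', stack x z' - stack x z = stack 0 (z' - z) := fun z' => by
    change stack (x - x) (z' - z) = _
    rw [sub_self]
  refine (h1.congr_left fun z' => ?_).trans_le fun z' => ?_
  · simp only [Function.comp]
    rw [e, WithLp.prod_inner_apply]
    simp
  · simp only [Function.comp]
    rw [e, ← sq_le_sq₀ (norm_nonneg _) (norm_nonneg _), WithLp.prod_norm_sq_eq_of_L2]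
    simp

end Subdifferential

namespace Problem

/-! ### The penalty problem as a saddle problem -/

variable {n m : ℕ} {P : Problem n m} {Lf Lft : ℝ}

/-- The finite values of `f` on `𝒳 × 𝒴`. -/
noncomputable def fReal (P : Problem n m) (u : Pair n m) : ℝ := P.f₁ u + (P.f₂ u.fst).toReal

/-- The finite values of `f̃` on `𝒳 × 𝒴`. -/
noncomputable def ftReal (P : Problem n m) (u : Pair n m) : ℝ := P.ft₁ u + (P.ft₂ u.snd).toReal

/-- The data of `min_{x,y} max_z f(x, y) + ρ (f̃(x, y) - f̃(x, z))`, with the gradients answered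
by `G` and `Gt`. -/
noncomputable def penaltySaddle (P : Problem n m) (G Gt : Pair n m → Pair n m) (ρ : ℝ) :
    SaddleProblem (Pair n m) (Vec m) where
  domP := P.setXY
  domQ := P.setY
  p u := (P.f₂ u.fst).toReal + ρ * (P.ft₂ u.snd).toReal
  q z := ρ * (P.ft₂ z).toReal
  h u z := P.f₁ u + ρ * P.ft₁ u - ρ * P.ft₁ (stack u.fst z)
  gradX u z := G u + ρ • Gt u - ρ • stack (Gt (stack u.fst z)).fst 0
  gradY u z := -(ρ • (Gt (stack u.fst z)).snd)
  proxP γ u := stack (prox γ P.f₂ u.fst) (prox (γ * ρ) P.ft₂ u.snd)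
  proxQ γ z := prox (γ * ρ) P.ft₂ z

theorem penaltySaddle_value (G Gt : Pair n m → Pair n m) (ρ : ℝ) (u : Pair n m) (z : Vec m) :
    (P.penaltySaddle G Gt ρ).value u z =
      P.fReal u + ρ * (P.ftReal u - P.ftReal (stack u.fst z)) := by
  unfold SaddleProblem.value penaltySaddle fReal ftReal
  change _ = _ + ρ * (_ - (P.ft₁ (stack u.fst z) + (P.ft₂ z).toReal))
  ring

theorem ft_eq_top {u : Pair n m} (hu : u.snd ∉ P.setY) : P.ft u = ⊤ := by
  unfold ft
  rw [eq_top_of_notMem_effDom hu, EReal.coe_add_top]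

theorem f_eq_top {u : Pair n m} (hu : u.fst ∉ P.setX) : P.f u = ⊤ := by
  unfold f
  rw [eq_top_of_notMem_effDom hu, EReal.coe_add_top]

/-- One evaluation of `∇h` uses `∇f₁` once and `∇f̃₁` twice; this is the factor `2` in `AnsweredBy`. -/
theorem penaltySaddle_answeredBy (G Gt : Pair n m → Pair n m) (ρ : ℝ) :
    (P.penaltySaddle G Gt ρ).AnsweredBy (P.penaltyOracle G Gt ρ) where
  grad u z c := by
    refine ⟨_, { c with gradF := c.gradF + 1, gradFt := c.gradFt + 1 + 1 }, ?_, rfl, ?_⟩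
    · exact Run.mem_bind (Part.mem_some _) (Run.mem_bind (Part.mem_some _)
        (Run.mem_bind (Part.mem_some _) (Part.mem_some _)))
    · simp
  proxP γ u c := by
    refine ⟨_, { c with proxF := c.proxF + 1, proxFt := c.proxFt + 1 }, ?_, rfl, ?_⟩
    · exact Run.mem_bind (Part.mem_some _) (Run.mem_bind (Part.mem_some _) (Part.mem_some _))
    · simp
  proxQ γ z c := ⟨_, { c with proxFt := c.proxFt + 1 }, Part.mem_some _, rfl, by simp⟩

namespace Assumption

theorem f_eq (hP : P.Assumption Lf Lft) {u : Pair n m} (hu : u ∈ P.setXY) :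
    P.f u = (P.fReal u : EReal) := by
  unfold f fReal
  rw [EReal.coe_add, hP.f₂_convex.coe_toReal hu.1]

theorem ft_eq (hP : P.Assumption Lf Lft) {u : Pair n m} (hu : u.snd ∈ P.setY) :
    P.ft u = (P.ftReal u : EReal) := by
  unfold ft ftReal
  rw [EReal.coe_add, hP.ft₂_convex.coe_toReal hu]

theorem convex_setXY (hP : P.Assumption Lf Lft) : Convex ℝ P.setXY :=
  fun _ hu _ hv _ _ ha hb hab => ⟨hP.f₂_convex.convex_effDom hu.1 hv.1 ha hb hab,
    hP.ft₂_convex.convex_effDom hu.2 hv.2 ha hb hab⟩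

theorem isCompact_setXY (hP : P.Assumption Lf Lft) : IsCompact P.setXY := by
  have h := (hP.compact_X.prod hP.compact_Y).image (WithLp.prod_continuous_toLp 2 (Vec n) (Vec m))
  convert! h using 1
  ext u
  exact ⟨fun hu => ⟨(u.fst, u.snd), hu, rfl⟩, by rintro ⟨v, hv, rfl⟩; exact hv⟩

theorem sq_dist_Y (hP : P.Assumption Lf Lft) {y y' : Vec m} (hy : y ∈ P.setY) (hy' : y' ∈ P.setY) :
    ‖y - y'‖ ^ 2 ≤ P.Dy ^ 2 := by
  rw [← dist_eq_norm]
  exact pow_le_pow_left₀ dist_nonneg (Metric.dist_le_diam_of_mem hP.compact_Y.isBounded hy hy') 2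

theorem sq_dist_XY (hP : P.Assumption Lf Lft) {u v : Pair n m} (hu : u ∈ P.setXY)
    (hv : v ∈ P.setXY) : ‖u - v‖ ^ 2 ≤ P.Dx ^ 2 + P.Dy ^ 2 := by
  rw [WithLp.prod_norm_sq_eq_of_L2]
  refine add_le_add ?_ (hP.sq_dist_Y hu.2 hv.2)
  have h := Metric.dist_le_diam_of_mem hP.compact_X.isBounded hu.1 hv.1
  rw [dist_eq_norm] at h
  exact pow_le_pow_left₀ (norm_nonneg _) h 2

theorem fLow_le (hP : P.Assumption Lf Lft) {u : Pair n m} (hu : u ∈ P.setXY) :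
    P.fLow ≤ P.fReal u := by
  obtain ⟨v, hv, hmin⟩ := hP.isCompact_setXY.exists_isMinOn ⟨u, hu⟩ hP.f_continuousOn
  have h : ⨅ w ∈ P.setXY, P.f w = P.f v :=
    le_antisymm (iInf₂_le v hv) (le_iInf₂ fun w hw => hmin hw)
  have h1 : P.f v ≤ P.f u := hmin hu
  rw [hP.f_eq hv, hP.f_eq hu, EReal.coe_le_coe_iff] at h1
  rwa [fLow, h, hP.f_eq hv, EReal.toReal_coe]

theorem exists_fReal_le (hP : P.Assumption Lf Lft) : ∃ c, ∀ u ∈ P.setXY, P.fReal u ≤ c := by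
  obtain ⟨x, hx⟩ := hP.f₂_convex.nonempty_dom
  obtain ⟨y, hy⟩ := hP.ft₂_convex.nonempty_dom
  obtain ⟨v, hv, hmax⟩ := hP.isCompact_setXY.exists_isMaxOn ⟨stack x y, hx, hy⟩ hP.f_continuousOn
  refine ⟨P.fReal v, fun u hu => ?_⟩
  have h1 : P.f u ≤ P.f v := hmax hu
  rwa [hP.f_eq hv, hP.f_eq hu, EReal.coe_le_coe_iff] at h1

theorem ftLow_le (hP : P.Assumption Lf Lft) {u : Pair n m} (hu : u ∈ P.setXY) :
    P.ftLow ≤ P.ftReal u := by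
  obtain ⟨v, hv, hmin⟩ := hP.isCompact_setXY.exists_isMinOn ⟨u, hu⟩ hP.ft_continuousOn
  have h : ⨅ w ∈ P.setXY, P.ft w = P.ft v :=
    le_antisymm (iInf₂_le v hv) (le_iInf₂ fun w hw => hmin hw)
  have h1 : P.ft v ≤ P.ft u := hmin hu
  rw [hP.ft_eq hv.2, hP.ft_eq hu.2, EReal.coe_le_coe_iff] at h1
  rwa [ftLow, h, hP.ft_eq hv.2, EReal.toReal_coe]

theorem le_ftHi (hP : P.Assumption Lf Lft) {u : Pair n m} (hu : u ∈ P.setXY) :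
    P.ftReal u ≤ P.ftHi := by
  obtain ⟨v, hv, hmax⟩ := hP.isCompact_setXY.exists_isMaxOn ⟨u, hu⟩ hP.ft_continuousOn
  have h : ⨆ w ∈ P.setXY, P.ft w = P.ft v :=
    le_antisymm (iSup₂_le fun w hw => hmax hw) (le_iSup₂ (f := fun w _ => P.ft w) v hv)
  have h1 : P.ft u ≤ P.ft v := hmax hu
  rw [hP.ft_eq hv.2, hP.ft_eq hu.2, EReal.coe_le_coe_iff] at h1
  rwa [ftHi, h, hP.ft_eq hv.2, EReal.toReal_coe]

/-- A lower bound of `f` over the bilevel feasible points is a lower bound of the optimal value. -/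
theorem le_fStar (hP : P.Assumption Lf Lft) {c : ℝ}
    (hc : ∀ u ∈ P.setXY, (∀ z ∈ P.setY, P.ftReal u ≤ P.ftReal (stack u.fst z)) →
      c ≤ P.fReal u) : c ≤ P.fStar := by
  obtain ⟨x, hx⟩ := hP.f₂_convex.nonempty_dom
  -- A feasible point above `x`, so that the infimum is not `∞`.
  have hcont : ContinuousOn (fun y => P.ft (stack x y)) P.setY :=
    hP.ft_continuousOn.comp (Continuous.continuousOn (by fun_prop)) fun y hy => ⟨hx, hy⟩
  obtain ⟨y, hy, hmin⟩ := hP.compact_Y.exists_isMinOn hP.ft₂_convex.nonempty_dom hcont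
  have hfeas : ∀ z, P.ft (stack x y) ≤ P.ft (stack x z) := fun z => by
    by_cases hz : z ∈ P.setY
    · exact hmin hz
    · rw [ft_eq_top (u := stack x z) hz]
      exact le_top
  have htop : (⨅ (x : Vec n) (y : Vec m) (_ : ∀ z, P.ft (stack x y) ≤ P.ft (stack x z)),
      P.f (stack x y)) ≠ ⊤ := by
    refine ne_of_lt (lt_of_le_of_lt (iInf₂_le_of_le x y (iInf_le _ hfeas)) ?_)
    rw [hP.f_eq (u := stack x y) ⟨hx, hy⟩]
    exact EReal.coe_lt_top _
  have hle : (c : EReal) ≤ ⨅ (x : Vec n) (y : Vec m)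
      (_ : ∀ z, P.ft (stack x y) ≤ P.ft (stack x z)), P.f (stack x y) := by
    refine le_iInf fun x' => le_iInf₂ fun y' h => ?_
    by_cases hx' : x' ∈ P.setX
    · have hy' : y' ∈ P.setY := by
        by_contra hy'
        have h1 := h y
        rw [ft_eq_top (u := stack x' y') hy', hP.ft_eq (u := stack x' y) hy] at h1
        exact absurd (top_le_iff.1 h1) (EReal.coe_ne_top _)
      rw [hP.f_eq (u := stack x' y') ⟨hx', hy'⟩, EReal.coe_le_coe_iff]
      refine hc _ ⟨hx', hy'⟩ fun z hz => ?_
      have h1 := h z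
      rwa [hP.ft_eq (u := stack x' y') hy', hP.ft_eq (u := stack x' z) hz,
        EReal.coe_le_coe_iff] at h1
    · rw [f_eq_top (u := stack x' y') hx']
      exact le_top
  have h1 := hle.trans (EReal.le_coe_toReal htop)
  rwa [EReal.coe_le_coe_iff] at h1

theorem le_of_le_lowerValue (hP : P.Assumption Lf Lft) {x : Vec n} {y : Vec m} {c : ℝ}
    (hy : y ∈ P.setY) (h : P.ft (stack x y) ≤ P.lowerValue x + (c : EReal)) {z : Vec m}
    (hz : z ∈ P.setY) : P.ftReal (stack x y) ≤ P.ftReal (stack x z) + c := by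
  have h1 : P.lowerValue x ≤ P.ft (stack x z) := iInf_le _ z
  have h2 := h.trans (add_le_add_left h1 _)
  rwa [hP.ft_eq (u := stack x y) hy, hP.ft_eq (u := stack x z) hz, ← EReal.coe_add,
    EReal.coe_le_coe_iff] at h2

theorem le_lowerValue (hP : P.Assumption Lf Lft) {x : Vec n} {y : Vec m} {c : ℝ}
    (hy : y ∈ P.setY) (h : ∀ z ∈ P.setY, P.ftReal (stack x y) ≤ P.ftReal (stack x z) + c) :
    P.ft (stack x y) ≤ P.lowerValue x + (c : EReal) := by
  have h1 : ((P.ftReal (stack x y) - c : ℝ) : EReal) ≤ P.lowerValue x := by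
    refine le_iInf fun z => ?_
    by_cases hz : z ∈ P.setY
    · rw [hP.ft_eq (u := stack x z) hz, EReal.coe_le_coe_iff]
      linarith [h z hz]
    · rw [ft_eq_top (u := stack x z) hz]
      exact le_top
  refine le_trans (le_of_eq ?_) (add_le_add_left h1 _)
  rw [hP.ft_eq (u := stack x y) hy, ← EReal.coe_add, sub_add_cancel]

/-- The proximal operator of `γ (ρ f̃₂)` is that of `(γ ρ) f̃₂`. -/
theorem isProxMap_scaled (hP : P.Assumption Lf Lft) {ρ : ℝ} (hρ : 0 < ρ) :
    IsProxMap P.setY (fun z => ρ * (P.ft₂ z).toReal) (fun γ => prox (γ * ρ) P.ft₂) := by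
  intro γ hγ v
  obtain ⟨h1, h2⟩ := hP.ft₂_convex.isProxMap hP.compact_Y (γ * ρ) (mul_pos hγ hρ) v
  refine ⟨h1, fun w hw => ?_⟩
  have h3 := mul_le_mul_of_nonneg_left (h2 w hw) hρ.le
  refine le_trans (le_of_eq ?_) h3
  rw [inner_smul_left, inner_smul_left, conj_trivial, conj_trivial, mul_add]
  field_simp

/-- The proximal operator of a separable sum acts on each block. -/
theorem isProxMap_penalty (hP : P.Assumption Lf Lft) (G Gt : Pair n m → Pair n m) {ρ : ℝ}
    (hρ : 0 < ρ) :
    IsProxMap P.setXY (P.penaltySaddle G Gt ρ).p (P.penaltySaddle G Gt ρ).proxP := by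
  intro γ hγ v
  obtain ⟨h1, h2⟩ := hP.f₂_convex.isProxMap hP.compact_X γ hγ v.fst
  obtain ⟨h3, h4⟩ := hP.isProxMap_scaled hρ γ hγ v.snd
  refine ⟨⟨h1, h3⟩, fun w hw => ?_⟩
  have h5 := add_le_add (h2 w.fst hw.1) (h4 w.snd hw.2)
  refine le_trans (le_of_eq ?_) h5
  rw [WithLp.prod_inner_apply]
  simp only [penaltySaddle]
  change (P.f₂ (prox γ P.f₂ v.fst)).toReal + ρ * (P.ft₂ (prox (γ * ρ) P.ft₂ v.snd)).toReal +
    (inner ℝ (γ⁻¹ • (v.fst - prox γ P.f₂ v.fst)) (w.fst - prox γ P.f₂ v.fst) +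
    inner ℝ (γ⁻¹ • (v.snd - prox (γ * ρ) P.ft₂ v.snd)) (w.snd - prox (γ * ρ) P.ft₂ v.snd)) = _
  ring

/-- The three terms of `h` contribute the constants `Lf`, `ρ Lft` and `ρ Lft`. Concavity in `z` is the
convexity of `f̃₁(x, ·)`. -/
theorem penaltySaddle_isWeak (hP : P.Assumption Lf Lft) {G Gt : Pair n m → Pair n m}
    (hG : IsGradientOracle Lf P.f₁ P.setXY G) (hGt : IsGradientOracle Lft P.ft₁ P.setXY Gt)
    {ρ : ℝ} (hρ : 0 < ρ) (hL : 0 < Lf + 2 * ρ * Lft) :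
    (P.penaltySaddle G Gt ρ).IsWeak (Lf + 2 * ρ * Lft) where
  pos := hL
  proxP := hP.isProxMap_penalty G Gt hρ
  proxQ := hP.isProxMap_scaled hρ
  weaklyConvex u hu u' hu' z hz := by
    have hz1 : stack u.fst z ∈ P.setXY := ⟨hu.1, hz⟩
    have hz2 : stack u'.fst z ∈ P.setXY := ⟨hu'.1, hz⟩
    have h1 := (abs_le.1 (hP.f₁_smooth.abs_sub_le hP.convex_setXY hu hu')).1
    have h2 := (abs_le.1 (hP.ft₁_smooth.abs_sub_le hP.convex_setXY hu hu')).1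
    have h3 := (abs_le.1 (hP.ft₁_smooth.abs_sub_le hP.convex_setXY hz1 hz2)).2
    rw [← hG.1 u hu] at h1
    rw [← hGt.1 u hu] at h2
    rw [← hGt.1 _ hz1, show stack u'.fst z - stack u.fst z = stack (u'.fst - u.fst) 0 by
      change stack (u'.fst - u.fst) (z - z) = _; rw [sub_self]] at h3
    have h4 : ‖stack (u'.fst - u.fst) (0 : Vec m)‖ ^ 2 ≤ ‖u' - u‖ ^ 2 := by
      rw [WithLp.prod_norm_sq_eq_of_L2, WithLp.prod_norm_sq_eq_of_L2]
      refine add_le_add le_rfl ?_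
      change ‖(0 : Vec m)‖ ^ 2 ≤ _
      rw [norm_zero, zero_pow two_ne_zero]
      exact sq_nonneg _
    have e1 : inner ℝ (Gt (stack u.fst z)) (stack (u'.fst - u.fst) (0 : Vec m)) =
        inner ℝ (stack (Gt (stack u.fst z)).fst 0) (u' - u) := by
      rw [WithLp.prod_inner_apply, WithLp.prod_inner_apply]
      simp
    rw [e1] at h3
    simp only [penaltySaddle]
    rw [inner_sub_left, inner_add_left, inner_smul_left, inner_smul_left, conj_trivial]
    have h2' := mul_le_mul_of_nonneg_left h2 hρ.le
    have h3' := mul_le_mul_of_nonneg_left h3 hρ.le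
    have h4' := mul_le_mul_of_nonneg_left h4
      (mul_nonneg hρ.le (by linarith [hP.Lft_nonneg] : 0 ≤ Lft / 2))
    linarith
  concave u hu z hz z' hz' := by
    have hz1 : stack u.fst z ∈ P.setXY := ⟨hu.1, hz⟩
    have hg : HasGradientAt P.ft₁ (Gt (stack u.fst z)) (stack u.fst z) := by
      rw [hGt.1 _ hz1]; exact (hP.ft₁_smooth.1 _ hz1).hasGradientAt
    have h1 := ConvexOn.add_inner_le (hP.ft₁_convex u.fst hu.1) hz hz'
      (HasGradientAt.partial_snd hg)
    have h2 := mul_le_mul_of_nonneg_left h1 hρ.le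
    simp only [penaltySaddle]
    rw [inner_neg_left, inner_smul_left, conj_trivial]
    linarith
  lipschitz u z u' z' := by
    -- The difference splits into three increments of the two oracles.
    set d : WithLp 2 (Pair n m × Vec m) := pair (u - u') (z - z') with hd
    have hdu : ‖u - u'‖ ≤ ‖d‖ := by
      rw [← sq_le_sq₀ (norm_nonneg _) (norm_nonneg _), hd, norm_pair_sq (u - u') (z - z')]
      exact le_add_of_nonneg_right (sq_nonneg _)
    have hds : ‖stack u.fst z - stack u'.fst z'‖ ≤ ‖d‖ := by
      have e : ‖stack u.fst z - stack u'.fst z'‖ ^ 2 = ‖u.fst - u'.fst‖ ^ 2 + ‖z - z'‖ ^ 2 :=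
        WithLp.prod_norm_sq_eq_of_L2 _
      have e' : ‖u - u'‖ ^ 2 = ‖u.fst - u'.fst‖ ^ 2 + ‖u.snd - u'.snd‖ ^ 2 :=
        WithLp.prod_norm_sq_eq_of_L2 _
      rw [← sq_le_sq₀ (norm_nonneg _) (norm_nonneg _), hd, norm_pair_sq (u - u') (z - z'), e, e']
      linarith [sq_nonneg ‖u.snd - u'.snd‖]
    set a := G u - G u' with ha
    set b := Gt u - Gt u' with hb
    set c := Gt (stack u.fst z) - Gt (stack u'.fst z') with hc
    have h1 : ‖pair a (0 : Vec m)‖ ≤ Lf * ‖d‖ := by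
      rw [show ‖pair a (0 : Vec m)‖ = ‖a‖ by
        rw [← sq_eq_sq₀ (norm_nonneg _) (norm_nonneg _), norm_pair_sq]; simp]
      exact (hG.2 u u').trans (mul_le_mul_of_nonneg_left hdu hP.Lf_nonneg)
    have h2 : ‖ρ • pair b (0 : Vec m)‖ ≤ ρ * (Lft * ‖d‖) := by
      rw [norm_smul, Real.norm_of_nonneg hρ.le, show ‖pair b (0 : Vec m)‖ = ‖b‖ by
        rw [← sq_eq_sq₀ (norm_nonneg _) (norm_nonneg _), norm_pair_sq]; simp]
      exact mul_le_mul_of_nonneg_left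
        ((hGt.2 u u').trans (mul_le_mul_of_nonneg_left hdu hP.Lft_nonneg)) hρ.le
    have h3 : ‖ρ • pair (stack c.fst (0 : Vec m)) c.snd‖ ≤ ρ * (Lft * ‖d‖) := by
      rw [norm_smul, Real.norm_of_nonneg hρ.le,
        show ‖pair (stack c.fst (0 : Vec m)) c.snd‖ = ‖c‖ by
          rw [← sq_eq_sq₀ (norm_nonneg _) (norm_nonneg _), norm_pair_sq, norm_pair_sq,
            WithLp.prod_norm_sq_eq_of_L2 c]
          simp]
      exact mul_le_mul_of_nonneg_left
        ((hGt.2 _ _).trans (mul_le_mul_of_nonneg_left hds hP.Lft_nonneg)) hρ.le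
    have h4 := norm_sub_le (pair a (0 : Vec m) + ρ • pair b (0 : Vec m))
      (ρ • pair (stack c.fst (0 : Vec m)) c.snd)
    have h5 := norm_add_le (pair a (0 : Vec m)) (ρ • pair b (0 : Vec m))
    have h6 : ‖pair a (0 : Vec m) + ρ • pair b (0 : Vec m)
        - ρ • pair (stack c.fst (0 : Vec m)) c.snd‖ ≤ (Lf + 2 * ρ * Lft) * ‖d‖ := by linarith
    have h7 := pow_le_pow_left₀ (norm_nonneg _) h6 2
    rw [mul_pow, hd, norm_pair_sq (u - u') (z - z')] at h7
    refine le_trans (le_of_eq ?_) h7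
    have e1 : (P.penaltySaddle G Gt ρ).gradX u z - (P.penaltySaddle G Gt ρ).gradX u' z' =
        a + ρ • b - ρ • stack c.fst 0 := by
      rw [show stack c.fst (0 : Vec m) = stack (Gt (stack u.fst z)).fst 0
        - stack (Gt (stack u'.fst z')).fst 0 by
          change stack c.fst (0 : Vec m) = stack _ ((0 : Vec m) - 0); rw [sub_zero]; rfl, ha, hb]
      simp only [penaltySaddle]
      module
    have e2 : (P.penaltySaddle G Gt ρ).gradY u z - (P.penaltySaddle G Gt ρ).gradY u' z' =
        (0 : Vec m) + ρ • (0 : Vec m) - ρ • c.snd := by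
      rw [show c.snd = (Gt (stack u.fst z)).snd - (Gt (stack u'.fst z')).snd from rfl]
      simp only [penaltySaddle]
      module
    rw [e1, e2]
    exact (norm_pair_sq (a + ρ • b - ρ • stack c.fst 0)
      ((0 : Vec m) + ρ • (0 : Vec m) - ρ • c.snd)).symm

end Assumption

end Problem

/-! ### Numbers of passes of the nested loops -/

theorem two_div_min_one_sqrt_le {c : ℝ} (hc : 0 < c) : 2 / min 1 √(4 / c) ≤ max 2 √c := by
  rcases le_total 1 √(4 / c) with h | h
  · rw [min_eq_left h, div_one]
    exact le_max_left _ _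
  · rw [min_eq_right h, div_le_iff₀ (by positivity)]
    have e : √c * √(4 / c) = 2 := by
      rw [← Real.sqrt_mul hc.le, mul_div_cancel₀ _ hc.ne', show (4 : ℝ) = 2 ^ 2 by norm_num,
        Real.sqrt_sq (by norm_num)]
    calc (2 : ℝ) = √c * √(4 / c) := e.symm
      _ ≤ _ := by gcongr; exact le_max_right _ _

/-- A number of iterations of the strongly-convex-strongly-concave method that suffices in pass `k`
of the outer method: `C (1 - α/2) ^ T` has to drop below a multiple of `1 / (k + 1)²`. -/
noncomputable def epochs (α C : ℝ) (k : ℕ) : ℕ :=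
  ⌈2 / α * (max (Real.log C) 0 + 2 * Real.log (k + 1) + 1 / 3)⌉₊

section epochs

variable {α C : ℝ}

theorem log_add_one_nonneg (k : ℕ) : 0 ≤ Real.log ((k : ℝ) + 1) :=
  Real.log_nonneg (le_add_of_nonneg_left k.cast_nonneg)

theorem epochs_pos (hα : 0 < α) (k : ℕ) : 0 < epochs α C k := by
  have h1 := log_add_one_nonneg k
  have h2 : 0 ≤ max (Real.log C) 0 := le_max_right _ _
  exact Nat.ceil_pos.2 (mul_pos (by positivity) (by linarith))

theorem epochs_le (hα : 0 < α) (hα1 : α ≤ 1) (k : ℕ) :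
    (epochs α C k : ℝ) ≤ 2 / α * (max (Real.log C) 0 + 1 + 2 * Real.log (k + 1)) := by
  have h1 := log_add_one_nonneg k
  have h2 : 0 ≤ max (Real.log C) 0 := le_max_right _ _
  have h3 : 2 ≤ 2 / α := by rw [le_div_iff₀ hα]; linarith
  have h4 := Nat.ceil_lt_add_one (a := 2 / α * (max (Real.log C) 0 + 2 * Real.log (k + 1) + 1 / 3))
    (mul_nonneg (by linarith) (by linarith))
  refine h4.le.trans ?_
  linarith

theorem sum_epochs_le (hα : 0 < α) (hα1 : α ≤ 1) (K : ℕ) :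
    ((∑ k ∈ Finset.range (K + 1), epochs α C k : ℕ) : ℝ) ≤ 2 / α *
      (((K : ℝ) + 1) * max (Real.log C) 0 + K + 1 + 2 * K * Real.log (K + 1)) := by
  have hlog : ∑ k ∈ Finset.range (K + 1), Real.log ((k : ℝ) + 1) ≤ K * Real.log (K + 1) := by
    rw [Finset.sum_range_succ', Nat.cast_zero, zero_add, Real.log_one, add_zero]
    refine (Finset.sum_le_card_nsmul _ _ (Real.log (K + 1)) fun k hk => ?_).trans
      (by rw [Finset.card_range, nsmul_eq_mul])
    have : ((k : ℝ) + 1) ≤ K := by exact_mod_cast Finset.mem_range.1 hk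
    push_cast
    exact Real.log_le_log (by positivity) (by linarith)
  push_cast
  refine (Finset.sum_le_sum fun k _ => epochs_le hα hα1 k).trans ?_
  rw [← Finset.mul_sum]
  refine mul_le_mul_of_nonneg_left ?_ (by positivity)
  rw [Finset.sum_add_distrib, ← Finset.mul_sum, Finset.sum_const, Finset.card_range, nsmul_eq_mul]
  push_cast
  linarith

/-- The slack `1/3` in the definition of `epochs` pays for the constant: `81/64 ≤ 4/3 ≤ exp (1/3)`. -/
theorem mul_pow_epochs_le (hα : 0 < α) (hα1 : α ≤ 1) (k : ℕ) :
    81 / 64 * (C * (1 - α / 2) ^ epochs α C k) ≤ 1 / ((k : ℝ) + 1) ^ 2 := by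
  have hpow : 0 ≤ (1 - α / 2) ^ epochs α C k := pow_nonneg (by linarith) _
  rcases le_or_gt C 0 with hC | hC
  · have := mul_nonneg_of_nonpos_of_nonpos hC (neg_nonpos.2 hpow)
    have h2 : 0 ≤ 1 / ((k : ℝ) + 1) ^ 2 := by positivity
    linarith
  have hT : max (Real.log C) 0 + 2 * Real.log (k + 1) + 1 / 3 ≤ α / 2 * epochs α C k := by
    have h := mul_le_mul_of_nonneg_left (Nat.le_ceil
      (2 / α * (max (Real.log C) 0 + 2 * Real.log (k + 1) + 1 / 3))) (by positivity : 0 ≤ α / 2)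
    rw [← mul_assoc, show α / 2 * (2 / α) = 1 by field_simp, one_mul] at h
    exact h
  have h1 : (1 - α / 2) ^ epochs α C k ≤ Real.exp (-(α / 2 * epochs α C k)) := by
    rw [show -(α / 2 * (epochs α C k : ℝ)) = (epochs α C k : ℝ) * (-(α / 2)) by ring,
      Real.exp_nat_mul]
    exact pow_le_pow_left₀ (by linarith) (by linarith [Real.add_one_le_exp (-(α / 2))]) _
  have h2 : Real.exp (-(α / 2 * epochs α C k)) ≤
      Real.exp (-(Real.log C + 2 * Real.log (k + 1) + 1 / 3)) :=
    Real.exp_le_exp.2 (by linarith [le_max_left (Real.log C) 0])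
  have hk : (0 : ℝ) < (k : ℝ) + 1 := by positivity
  have h3 : Real.exp (Real.log C + 2 * Real.log (k + 1) + 1 / 3) =
      C * ((k : ℝ) + 1) ^ 2 * Real.exp (1 / 3) := by
    rw [Real.exp_add, Real.exp_add, Real.exp_log hC, mul_comm 2, Real.exp_mul, Real.exp_log hk]
    norm_cast
  have h4 : (81 / 64 : ℝ) ≤ Real.exp (1 / 3) := by linarith [Real.add_one_le_exp (1 / 3 : ℝ)]
  calc 81 / 64 * (C * (1 - α / 2) ^ epochs α C k)
      ≤ Real.exp (1 / 3) * (C * (C * ((k : ℝ) + 1) ^ 2 * Real.exp (1 / 3))⁻¹) := by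
        rw [← h3, ← Real.exp_neg]
        gcongr
        exact h1.trans h2
    _ = _ := by field_simp

end epochs

/-- The number of evaluations in one iteration of the strongly-convex-strongly-concave method, with
`⌈6 ζ⁻¹⌉` passes of its inner loop. -/
theorem four_mul_ceil_add_le {κ : ℝ} (hκ : 25 ≤ κ) :
    4 * (⌈6 * (2 * √5 * κ)⌉₊ : ℝ) + 12 ≤ (⌈96 * √2 * κ⌉ : ℝ) + 2 := by
  have h5 : √5 ≤ 9 / 4 := by rw [Real.sqrt_le_iff]; norm_num
  have h2 : 7 / 5 ≤ √2 := by rw [Real.le_sqrt (by norm_num) (by norm_num)]; norm_num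
  have h3 := Nat.ceil_lt_add_one (a := 6 * (2 * √5 * κ)) (by positivity)
  have h4 := Int.le_ceil (96 * √2 * κ)
  have h6 : √5 * κ ≤ 9 / 4 * κ := by gcongr
  have h7 : 7 / 5 * κ ≤ √2 * κ := by gcongr
  linarith

namespace Problem

variable {n m : ℕ} {P : Problem n m} {Lf Lft : ℝ}

/-! ### From approximate saddle points to stationarity -/

namespace Assumption

theorem add_mem_subdifferential_f (hP : P.Assumption Lf Lft) {u : Pair n m} (hu : u ∈ P.setXY)
    {s : Vec n} (hs : ∀ x ∈ P.setX, (P.f₂ u.fst).toReal + inner ℝ s (x - u.fst) ≤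
      (P.f₂ x).toReal) : gradient P.f₁ u + stack s 0 ∈ subdifferential P.f u := by
  refine add_mem_subdifferential (φ := P.f₁) (ψ := fun v => P.f₂ v.fst) (fun _ => rfl)
    (hP.f₁_smooth.1 u hu).hasGradientAt (hP.f₂_convex.coe_toReal hu.1).symm fun v => ?_
  by_cases hv : v.fst ∈ P.setX
  · have e : inner ℝ (stack s (0 : Vec m)) (v - u) = inner ℝ s (v.fst - u.fst) := by
      rw [WithLp.prod_inner_apply]
      simp
    rw [e, ← hP.f₂_convex.coe_toReal hv, EReal.coe_le_coe_iff]
    exact hs _ hv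
  · rw [eq_top_of_notMem_effDom hv]
    exact le_top

theorem add_mem_subdifferential_ft (hP : P.Assumption Lf Lft) {u : Pair n m} (hu : u ∈ P.setXY)
    {s : Vec m} (hs : ∀ y ∈ P.setY, (P.ft₂ u.snd).toReal + inner ℝ s (y - u.snd) ≤
      (P.ft₂ y).toReal) : gradient P.ft₁ u + stack 0 s ∈ subdifferential P.ft u := by
  refine add_mem_subdifferential (φ := P.ft₁) (ψ := fun v => P.ft₂ v.snd) (fun _ => rfl)
    (hP.ft₁_smooth.1 u hu).hasGradientAt (hP.ft₂_convex.coe_toReal hu.2).symm fun v => ?_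
  by_cases hv : v.snd ∈ P.setY
  · have e : inner ℝ (stack (0 : Vec n) s) (v - u) = inner ℝ s (v.snd - u.snd) := by
      rw [WithLp.prod_inner_apply]
      simp
    rw [e, ← hP.ft₂_convex.coe_toReal hv, EReal.coe_le_coe_iff]
    exact hs _ hv
  · rw [eq_top_of_notMem_effDom hv]
    exact le_top

theorem add_mem_subdifferential_ft_snd (hP : P.Assumption Lf Lft) {x : Vec n} {z : Vec m}
    (hx : x ∈ P.setX) (hz : z ∈ P.setY) {s : Vec m}
    (hs : ∀ y ∈ P.setY, (P.ft₂ z).toReal + inner ℝ s (y - z) ≤ (P.ft₂ y).toReal) :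
    (gradient P.ft₁ (stack x z)).snd + s ∈ subdifferential (fun z' => P.ft (stack x z')) z := by
  refine add_mem_subdifferential (φ := fun z' => P.ft₁ (stack x z')) (ψ := P.ft₂) (fun _ => rfl)
    (HasGradientAt.partial_snd (hP.ft₁_smooth.1 (stack x z) ⟨hx, hz⟩).hasGradientAt)
    (hP.ft₂_convex.coe_toReal hz).symm fun v => ?_
  by_cases hv : v ∈ P.setY
  · rw [← hP.ft₂_convex.coe_toReal hv, EReal.coe_le_coe_iff]
    exact hs _ hv
  · rw [eq_top_of_notMem_effDom hv]
    exact le_top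

variable {G Gt : Pair n m → Pair n m} {ρ : ℝ}

/-- A subgradient of `f₂(x) + ρ f̃₂(y)` splits into subgradients of `f₂` and of `f̃₂`. -/
theorem add_mem_upperStationarity (hP : P.Assumption Lf Lft)
    (hG : IsGradientOracle Lf P.f₁ P.setXY G) (hGt : IsGradientOracle Lft P.ft₁ P.setXY Gt)
    (hρ : 0 < ρ) {u b : Pair n m} {z : Vec m} (hz : z ∈ P.setY)
    (hb : IsSubgradOn P.setXY (P.penaltySaddle G Gt ρ).p b u) :
    (P.penaltySaddle G Gt ρ).gradX u z + b ∈ P.upperStationarity ρ u.fst u.snd z := by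
  obtain ⟨hu, hb⟩ := hb
  have h1 : gradient P.f₁ u + stack b.fst 0 ∈ subdifferential P.f u := by
    refine hP.add_mem_subdifferential_f hu fun x hx => ?_
    have h := hb (stack x u.snd) ⟨hx, hu.2⟩
    rw [WithLp.prod_inner_apply] at h
    change (P.f₂ u.fst).toReal + ρ * (P.ft₂ u.snd).toReal + (inner ℝ b.fst (x - u.fst) +
      inner ℝ b.snd (u.snd - u.snd)) ≤ (P.f₂ x).toReal + ρ * (P.ft₂ u.snd).toReal at h
    rw [sub_self, inner_zero_right] at h
    linarith
  have h2 : gradient P.ft₁ u + stack 0 (ρ⁻¹ • b.snd) ∈ subdifferential P.ft u := by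
    refine hP.add_mem_subdifferential_ft hu fun y hy => ?_
    have h := hb (stack u.fst y) ⟨hu.1, hy⟩
    rw [WithLp.prod_inner_apply] at h
    change (P.f₂ u.fst).toReal + ρ * (P.ft₂ u.snd).toReal + (inner ℝ b.fst (u.fst - u.fst) +
      inner ℝ b.snd (y - u.snd)) ≤ (P.f₂ u.fst).toReal + ρ * (P.ft₂ y).toReal at h
    rw [sub_self, inner_zero_right] at h
    rw [inner_smul_left, conj_trivial]
    refine le_of_mul_le_mul_left ?_ hρ
    rw [mul_add, ← mul_assoc, mul_inv_cancel₀ hρ.ne', one_mul]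
    linarith
  have hz1 : stack u.fst z ∈ P.setXY := ⟨hu.1, hz⟩
  have h3 : gradient (fun x' => P.ft₁ (stack x' z)) u.fst = (Gt (stack u.fst z)).fst := by
    rw [hGt.1 _ hz1]
    exact (HasGradientAt.partial_fst (hP.ft₁_smooth.1 _ hz1).hasGradientAt).gradient
  refine Set.mem_sub.2 ⟨_, Set.add_mem_add h1 (Set.smul_mem_smul_set h2), _, rfl, ?_⟩
  rw [h3, ← hG.1 u hu, ← hGt.1 u hu]
  have e1 : stack (ρ • (Gt (stack u.fst z)).fst) (0 : Vec m) =
      ρ • stack (Gt (stack u.fst z)).fst 0 :=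
    congrArg (stack _) (smul_zero ρ).symm
  have e2 : stack b.fst 0 + ρ • stack 0 (ρ⁻¹ • b.snd) = b := by
    change stack (b.fst + ρ • (0 : Vec n)) (0 + ρ • (ρ⁻¹ • b.snd)) = b
    rw [smul_zero, add_zero, zero_add, smul_inv_smul₀ hρ.ne']
    rfl
  rw [e1]
  simp only [penaltySaddle]
  nth_rw 3 [← e2]
  module

/-- Here `-gradY = ρ ∇_z f̃₁(x, z)`, and `b` is a subgradient of `ρ f̃₂`. -/
theorem smul_mem_lowerStationarity (hP : P.Assumption Lf Lft)
    (hGt : IsGradientOracle Lft P.ft₁ P.setXY Gt) (hρ : 0 < ρ) {u : Pair n m} {b z : Vec m}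
    (hu : u ∈ P.setXY) (hb : IsSubgradOn P.setY (P.penaltySaddle G Gt ρ).q b z) :
    b - (P.penaltySaddle G Gt ρ).gradY u z ∈ P.lowerStationarity ρ u.fst z := by
  obtain ⟨hz, hb⟩ := hb
  have h1 : (gradient P.ft₁ (stack u.fst z)).snd + ρ⁻¹ • b ∈
      subdifferential (fun z' => P.ft (stack u.fst z')) z := by
    refine hP.add_mem_subdifferential_ft_snd hu.1 hz fun y hy => ?_
    have h := hb y hy
    simp only [penaltySaddle] at h
    rw [inner_smul_left, conj_trivial]
    refine le_of_mul_le_mul_left ?_ hρ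
    rw [mul_add, ← mul_assoc ρ ρ⁻¹, mul_inv_cancel₀ hρ.ne', one_mul]
    linarith
  refine Set.mem_smul_set.2 ⟨_, h1, ?_⟩
  rw [← hGt.1 (stack u.fst z) ⟨hu.1, hz⟩, smul_add, smul_inv_smul₀ hρ.ne']
  simp only [penaltySaddle]
  module

end Assumption

theorem infEDist_zero_le {F : Type*} [NormedAddCommGroup F] {S : Set F} {e : F} {c : ℝ}
    (he : e ∈ S) (hc : ‖e‖ ≤ c) : Metric.infEDist 0 S ≤ ENNReal.ofReal c := by
  refine (Metric.infEDist_le_edist_of_mem he).trans ?_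
  rw [edist_dist, dist_zero_left]
  exact ENNReal.ofReal_le_ofReal hc

variable {n m : ℕ} {P : Problem n m} {Lf Lft : ℝ}

/-! ### The penalty method -/

section Parameters

variable {ε : ℝ}

theorem add_le_Lhat (hLft : 0 ≤ Lft) (hε : 0 < ε) (hε1 : ε ≤ 1 / 4) : Lf + Lft ≤ Lhat Lf Lft ε := by
  have h : 1 ≤ 2 * ε⁻¹ := by
    rw [← div_eq_mul_inv, le_div_iff₀ hε]
    linarith
  have := mul_le_mul_of_nonneg_right h hLft
  unfold Lhat
  linarith

theorem alphaHat_pos (hLh : 0 < Lhat Lf Lft ε) (hD : 0 < P.Dy) (hε : 0 < ε) :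
    0 < P.alphaHat Lf Lft ε :=
  lt_min one_pos (by positivity)

theorem alphaHat_le_one : P.alphaHat Lf Lft ε ≤ 1 := min_le_left _ _

theorem two_div_alphaHat_le (hLh : 0 < Lhat Lf Lft ε) (hD : 0 < P.Dy) (hε : 0 < ε) :
    2 / P.alphaHat Lf Lft ε ≤ max 2 √(P.Dy * Lhat Lf Lft ε * ε⁻¹) := by
  have h := two_div_min_one_sqrt_le (c := P.Dy * Lhat Lf Lft ε * ε⁻¹) (by positivity)
  unfold alphaHat
  convert! h using 4
  field_simp

end Parameters

theorem rpow_three_halves_sq {ε : ℝ} (hε : 0 ≤ ε) : (ε ^ (3 / 2 : ℝ)) ^ 2 = ε ^ 3 := by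
  rw [← Real.rpow_natCast, ← Real.rpow_mul hε, ← Real.rpow_natCast]
  norm_num

namespace Assumption

/-- Total correctness of the penalty method as a method for the penalized minimax problem. -/
theorem penaltyMethod_ensures (hP : P.Assumption Lf Lft) (hL : 0 < Lf + Lft) (hD : 0 < P.Dy)
    {G Gt : Pair n m → Pair n m} (hG : IsGradientOracle Lf P.f₁ P.setXY G)
    (hGt : IsGradientOracle Lft P.ft₁ P.setXY Gt) {ε : ℝ} (hε : 0 < ε) (hε1 : ε ≤ 1 / 4)
    {x₀ : Vec n} (hx₀ : x₀ ∈ P.setX) {y₀ : Vec m} (hy₀ : y₀ ∈ P.setY)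
    (h₀ : P.ft (stack x₀ y₀) ≤ P.lowerValue x₀ + (ε : EReal)) :
    ∃ g : ℕ, (g : ℝ) ≤ P.NHat Lf Lft ε x₀ y₀ ∧
      (P.penaltyMethod G Gt Lf Lft ε x₀ y₀).Ensures g g fun r =>
        ∃ xk ∈ P.setXY, ((P.penaltySaddle G Gt ε⁻¹).regularize (Lhat Lf Lft ε) (ε / (2 * P.Dy))
            xk y₀).IsApproxSaddle (ε ^ (3 / 2 : ℝ)) r ∧
          ‖r.1 - xk‖ ≤ ε / (4 * Lhat Lf Lft ε) ∧ ∀ z ∈ P.setY,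
            P.fReal r.1 + ε⁻¹ * (P.ftReal r.1 - P.ftReal (stack r.1.fst z))
              - ε / (2 * P.Dy) / 2 * ‖z - y₀‖ ^ 2 ≤ P.fReal (stack x₀ y₀) + 1
                + 2 * ε ^ 3 * (1 / (2 * Lhat Lf Lft ε) + P.Dy / ε) := by
  have hLh : 0 < Lhat Lf Lft ε := hL.trans_le (add_le_Lhat hP.Lft_nonneg hε hε1)
  have hu₀ : stack x₀ y₀ ∈ P.setXY := ⟨hx₀, hy₀⟩
  have hfx : (P.f (stack x₀ y₀)).toReal = P.fReal (stack x₀ y₀) := by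
    rw [hP.f_eq hu₀, EReal.toReal_coe]
  have hα0 := alphaHat_pos (P := P) hLh hD hε
  have hα1 : P.alphaHat Lf Lft ε ≤ 1 := alphaHat_le_one
  have h2α := two_div_alphaHat_le (P := P) hLh hD hε
  have hρ : 0 < ε⁻¹ := inv_pos.2 hε
  set L := Lhat Lf Lft ε with hLdef
  set α := P.alphaHat Lf Lft ε with hαdef
  set D := P.Dy with hDdef
  set S := P.penaltySaddle G Gt ε⁻¹ with hS
  set μ := ε / (2 * D) with hμ
  have hμ0 : 0 < μ := by positivity
  set η := min (1 / (2 * μ)) (4 / (α * L)) with hη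
  have hμinv : 1 / (2 * μ) = D / ε := by rw [hμ]; field_simp
  -- The regularization changes values by at most `ε D_y / 4`.
  have hreg : ∀ z ∈ P.setY, 0 ≤ μ / 2 * ‖z - y₀‖ ^ 2 ∧ μ / 2 * ‖z - y₀‖ ^ 2 ≤ ε * D / 4 :=
    fun z hz => ⟨by positivity, by
      calc μ / 2 * ‖z - y₀‖ ^ 2 ≤ μ / 2 * D ^ 2 :=
          mul_le_mul_of_nonneg_left (hP.sq_dist_Y hz hy₀) (by positivity)
        _ = ε * D / 4 := by rw [hμ]; field_simp; ring⟩
  have hval : ∀ u z, S.value u z = P.fReal u + ε⁻¹ * (P.ftReal u - P.ftReal (stack u.fst z)) :=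
    penaltySaddle_value G Gt ε⁻¹
  set Ψ := P.deltaHat Lf Lft ε + 2 * α⁻¹ * (P.fStar - P.fLow + ε⁻¹ * (P.ftHi - P.ftLow)
    + ε * D / 4 + L * (P.Dx ^ 2 + D ^ 2)) with hΨ
  have hη0 : 0 < η := lt_min (by positivity) (by positivity)
  have hηinv : η⁻¹ = max (ε / D) (α * L / 4) := by
    rw [hη, hμinv]
    rcases le_total (D / ε) (4 / (α * L)) with h | h
    · rw [min_eq_left h, max_eq_left, inv_div]
      have := inv_anti₀ (by positivity) h
      rwa [inv_div, inv_div] at this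
    · rw [min_eq_right h, max_eq_right, inv_div]
      have := inv_anti₀ (by positivity) h
      rwa [inv_div, inv_div] at this
  set Q := (3 * L + μ) ^ 2 / min L μ + 3 * L + μ with hQ
  have hmin : 0 < min L μ := lt_min hLh hμ0
  have hQ0 : 0 < Q := by positivity
  have hC : P.CHat Lf Lft ε = 4 * max (1 / (2 * L)) η * Ψ / ((Q ^ 2)⁻¹ * ε ^ 3) := by
    rw [hη, hμinv]
    rfl
  set K := P.KHat Lf Lft ε x₀ y₀ with hK
  set N := ⌈6 * (2 * √5 * (1 + 8 * (3 * L + μ) / L))⌉₊ with hN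
  refine ⟨∑ k ∈ Finset.range (K + 1), epochs α (P.CHat Lf Lft ε) k * (4 * N + 12), ?_, ?_⟩
  · rw [← Finset.sum_mul]
    have h1 := sum_epochs_le (C := P.CHat Lf Lft ε) hα0 hα1 K
    have hκ : 1 + 8 * (3 * L + μ) / L = 1 + (24 * L + 4 * ε / D) * L⁻¹ := by
      rw [hμ]; field_simp; ring
    have h2 := four_mul_ceil_add_le (κ := 1 + 8 * (3 * L + μ) / L) (by
      rw [mul_add, add_div, show 8 * (3 * L) / L = 24 by field_simp; norm_num]
      have : 0 ≤ 8 * μ / L := by positivity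
      linarith)
    rw [← hN, hκ] at h2
    have h3 : 0 ≤ ((K : ℝ) + 1) * max (Real.log (P.CHat Lf Lft ε)) 0 + K + 1
        + 2 * K * Real.log (K + 1) := by
      have := log_add_one_nonneg K
      have : 0 ≤ max (Real.log (P.CHat Lf Lft ε)) 0 := le_max_right _ _
      positivity
    rw [Nat.cast_mul, mul_comm]
    push_cast at h1 ⊢
    calc _ ≤ ((⌈96 * √2 * (1 + (24 * L + 4 * ε / D) * L⁻¹)⌉ : ℝ) + 2) *
          (max 2 √(D * L * ε⁻¹) * (((K : ℝ) + 1) * max (Real.log (P.CHat Lf Lft ε)) 0 + K + 1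
            + 2 * K * Real.log (K + 1))) :=
          mul_le_mul h2 (h1.trans (mul_le_mul_of_nonneg_right h2α h3))
            (Finset.sum_nonneg fun _ _ => Nat.cast_nonneg _) (le_trans (by positivity) h2)
      _ = _ := by rw [← mul_assoc]; rfl
  · have hmain := (hP.penaltySaddle_isWeak hG hGt hρ (by
        rwa [hLdef, Lhat] at hLh)).minimaxMethod_ensures (μ := μ) (α := α) (η := η)
      (Rx := P.Dx ^ 2 + D ^ 2) (Ry := D ^ 2) (low := P.fLow + ε⁻¹ * (P.ftLow - P.ftHi) - ε * D / 4)
      (up := P.fStar) (Φ₀ := P.fReal (stack x₀ y₀) + 1) (φlow := P.fLow - ε * D / 4) (Ψ := Ψ)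
      (N := N) (K := K) (T := epochs α (P.CHat Lf Lft ε)) (ε₀ := ε ^ (3 / 2 : ℝ))
      hP.isCompact_setXY.isClosed hP.compact_Y.isClosed (penaltySaddle_answeredBy G Gt ε⁻¹)
      hu₀ hy₀ hD hε (by positivity) hμ ?_ hη rfl (fun _ hu _ hv => hP.sq_dist_XY hu hv)
      (fun _ hy _ hy' => hP.sq_dist_Y hy hy') ?_ ?_ ?_ ?_ ?_ (Nat.le_ceil _) ?_
      (epochs_pos hα0) ?_
    · rw [rpow_three_halves_sq hε.le, hμinv] at hmain
      refine hmain.mono le_rfl le_rfl ?_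
      rintro r ⟨xk, hxk, h1, h2, h3⟩
      refine ⟨xk, hxk, h1, h2, fun z hz => ?_⟩
      have h4 := h3 z hz
      rwa [← hS, hval] at h4
    · change α = min 1 √(8 * μ / L)
      rw [hαdef, alphaHat, ← hLdef, ← hDdef, hμ]
      congr 2
      field_simp
      norm_num
    · intro u hu z hz
      rw [← hS, hval]
      have h1 := hP.fLow_le hu
      have h2 := hP.ftLow_le hu
      have h3 := hP.le_ftHi (u := stack u.fst z) ⟨hu.1, hz⟩
      have h4 := mul_le_mul_of_nonneg_left (sub_le_sub h2 h3) hρ.le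
      linarith [(hreg z hz).2]
    · intro z hz c hc
      refine hP.le_fStar fun u hu hmin => ?_
      have h1 := hc u hu
      rw [← hS, hval] at h1
      have h2 := mul_nonneg hρ.le (sub_nonneg.2 (hmin z hz))
      linarith [(hreg z hz).1]
    · intro z hz
      rw [← hS, hval]
      have h1 := hP.le_of_le_lowerValue hy₀ h₀ hz
      have h2 : ε⁻¹ * (P.ftReal (stack x₀ y₀) - P.ftReal (stack x₀ z)) ≤ ε⁻¹ * ε :=
        mul_le_mul_of_nonneg_left (by linarith) hρ.le
      rw [inv_mul_cancel₀ hε.ne'] at h2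
      change P.fReal (stack x₀ y₀) + ε⁻¹ * (P.ftReal (stack x₀ y₀) - P.ftReal (stack x₀ z)) - _ ≤ _
      linarith [(hreg z hz).1]
    · intro u hu
      refine ⟨u.snd, hu.2, ?_⟩
      rw [← hS, hval]
      change _ ≤ P.fReal u + ε⁻¹ * (P.ftReal u - P.ftReal u) - _
      rw [sub_self, mul_zero, add_zero]
      linarith [hP.fLow_le hu, (hreg u.snd hu.2).2]
    · change 2 * L * _ + _ + 2 / α * (L / 2 * _ + (P.fStar + L * _) - _) ≤ _
      rw [hηinv, hΨ, deltaHat]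
      refine le_of_eq ?_
      rw [← hLdef, ← hDdef, ← hαdef]
      field_simp
      ring
    · change 16 * L / ε ^ 2 * (P.fReal (stack x₀ y₀) + 1 - (P.fLow - ε * D / 4)
        + 2 * (ε ^ (3 / 2 : ℝ)) ^ 2 * (1 / (2 * L) + 1 / (2 * μ))) ≤ (K : ℝ) + 1
      rw [rpow_three_halves_sq hε.le, hμinv]
      have h1 := Nat.le_ceil (16 * (1 + (P.f (stack x₀ y₀)).toReal - P.fLow + ε * D / 4) * L
        * (ε ^ 2)⁻¹ + 32 * (1 + 4 * D ^ 2 * L ^ 2 * (ε ^ 2)⁻¹) * ε - 1)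
      rw [hfx] at h1
      have h2 : (K : ℝ) = (⌈16 * (1 + P.fReal (stack x₀ y₀) - P.fLow + ε * D / 4) * L
        * (ε ^ 2)⁻¹ + 32 * (1 + 4 * D ^ 2 * L ^ 2 * (ε ^ 2)⁻¹) * ε - 1⌉₊ : ℝ) := by
        rw [hK, KHat, hfx]
      rw [← h2] at h1
      have h3 : 16 * L / ε ^ 2 * (2 * ε ^ 3 * (1 / (2 *
        L) + D / ε)) = 32 * (1 / 2 + D * L * ε⁻¹) * ε := by
        field_simp
        ring
      have h4 : 1 / 2 + D * L * ε⁻¹ ≤ 1 + 4 * D ^ 2 * L ^ 2 * (ε ^ 2)⁻¹ := by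
        have e : 4 * D ^ 2 * L ^ 2 * (ε ^ 2)⁻¹ = 4 * (D * L * ε⁻¹) ^ 2 := by
          rw [mul_pow, mul_pow, inv_pow]; ring
        rw [e]
        nlinarith [sq_nonneg (4 * (D * L * ε⁻¹) - 1 / 2)]
      have h5 := mul_le_mul_of_nonneg_right
        (mul_le_mul_of_nonneg_left h4 (by norm_num : (0 : ℝ) ≤ 32)) hε.le
      calc _ = 16 * (1 + P.fReal (stack x₀ y₀) - P.fLow + ε * D / 4) * L * (ε ^ 2)⁻¹
            + 16 * L / ε ^ 2 * (2 * ε ^ 3 * (1 / (2 * L) + D / ε)) := by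
            rw [div_eq_mul_inv (16 * L)]; ring
        _ ≤ _ := by rw [h3]; linarith
    · intro k
      change 81 / 16 * ((((min L μ / (3 * L + μ) ^ 2)⁻¹ + (3 * L + μ)) ^ 2 *
        (max (1 / (2 * L)) η * _))) ≤ _
      rw [inv_div, ← add_assoc, ← hQ, div_pow, rpow_three_halves_sq hε.le]
      have h1 := mul_le_mul_of_nonneg_left (mul_pow_epochs_le (C := P.CHat Lf Lft ε) hα0 hα1 k)
        (by positivity : 0 ≤ ε ^ 3)
      refine le_trans (le_of_eq ?_) (h1.trans (le_of_eq (mul_one_div _ _)))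
      generalize (1 - α / 2) ^ epochs α (P.CHat Lf Lft ε) k = t
      rw [hC]
      field_simp
      ring

/-- The output of the penalty method is approximately stationary at both levels and approximately
optimal at the lower level. -/
theorem penaltyMethod_stationarity (hP : P.Assumption Lf Lft) (hL : 0 < Lf + Lft) (hD : 0 < P.Dy)
    {G Gt : Pair n m → Pair n m} (hG : IsGradientOracle Lf P.f₁ P.setXY G)
    (hGt : IsGradientOracle Lft P.ft₁ P.setXY Gt) {ε : ℝ} (hε : 0 < ε) (hε1 : ε ≤ 1 / 4)
    {x₀ : Vec n} (hx₀ : x₀ ∈ P.setX) {y₀ : Vec m} (hy₀ : y₀ ∈ P.setY) {xk u : Pair n m}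
    {z : Vec m}
    (hr : ((P.penaltySaddle G Gt ε⁻¹).regularize (Lhat Lf Lft ε) (ε / (2 * P.Dy))
      xk y₀).IsApproxSaddle (ε ^ (3 / 2 : ℝ)) (u, z))
    (hstep : ‖u - xk‖ ≤ ε / (4 * Lhat Lf Lft ε))
    (hval : ∀ z ∈ P.setY, P.fReal u + ε⁻¹ * (P.ftReal u - P.ftReal (stack u.fst z))
      - ε / (2 * P.Dy) / 2 * ‖z - y₀‖ ^ 2 ≤ P.fReal (stack x₀ y₀) + 1
        + 2 * ε ^ 3 * (1 / (2 * Lhat Lf Lft ε) + P.Dy / ε)) :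
    Metric.infEDist 0 (P.upperStationarity ε⁻¹ u.fst u.snd z) ≤ ENNReal.ofReal ε ∧
      Metric.infEDist 0 (P.lowerStationarity ε⁻¹ u.fst z) ≤ ENNReal.ofReal ε ∧
      P.ft (stack u.fst u.snd)
        ≤ P.lowerValue u.fst + ((ε * P.gapFactor Lf Lft ε x₀ y₀ : ℝ) : EReal) := by
  have hLh : 0 < Lhat Lf Lft ε := hL.trans_le (add_le_Lhat hP.Lft_nonneg hε hε1)
  have hρ : 0 < ε⁻¹ := inv_pos.2 hε
  obtain ⟨rx, ry, hnorm, hx, hy⟩ := hr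
  rw [rpow_three_halves_sq hε.le] at hnorm
  have hu : u ∈ P.setXY := hx.1
  have hz : z ∈ P.setY := hy.1
  have hgap : P.ft (stack u.fst u.snd)
      ≤ P.lowerValue u.fst + ((ε * P.gapFactor Lf Lft ε x₀ y₀ : ℝ) : EReal) := by
    refine hP.le_lowerValue hu.2 fun z' hz' => ?_
    have h1 := hval z' hz'
    have h2 := hP.fLow_le hu
    have h3 : ε / (2 * P.Dy) / 2 * ‖z' - y₀‖ ^ 2 ≤ ε * P.Dy / 4 := by
      calc _ ≤ ε / (2 * P.Dy) / 2 * P.Dy ^ 2 :=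
            mul_le_mul_of_nonneg_left (hP.sq_dist_Y hz' hy₀) (by positivity)
        _ = _ := by field_simp; ring
    rw [gapFactor, hP.f_eq (u := stack x₀ y₀) ⟨hx₀, hy₀⟩, EReal.toReal_coe]
    set L := Lhat Lf Lft ε
    have h4 : 1 / (2 * L) + P.Dy / ε ≤ L⁻¹ + 4 * P.Dy ^ 2 * L * (ε ^ 2)⁻¹ := by
      have e : L⁻¹ + 4 * P.Dy ^ 2 * L * (ε ^ 2)⁻¹ - (1 / (2 * L) + P.Dy / ε) =
          L⁻¹ * (1 / 2 - P.Dy * L / ε + 4 * (P.Dy * L / ε) ^ 2) := by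
        field_simp
        ring
      have h5 : 0 ≤ L⁻¹ * (1 / 2 - P.Dy * L / ε + 4 * (P.Dy * L / ε) ^ 2) :=
        mul_nonneg (inv_nonneg.2 hLh.le)
          (by nlinarith [sq_nonneg (4 * (P.Dy * L / ε) - 1 / 2)])
      linarith
    have h6 := mul_le_mul_of_nonneg_left h4 (by positivity : 0 ≤ 2 * ε ^ 3)
    have h7 : ε⁻¹ * (P.ftReal u - P.ftReal (stack u.fst z')) ≤ 1 + P.fReal (stack x₀ y₀) - P.fLow
        + 2 * ε ^ 3 * (L⁻¹ + 4 * P.Dy ^ 2 * L * (ε ^ 2)⁻¹) + P.Dy * ε / 4 := by linarith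
    have h8 := mul_le_mul_of_nonneg_left h7 hε.le
    rw [← mul_assoc, mul_inv_cancel₀ hε.ne', one_mul] at h8
    change P.ftReal u ≤ _
    linarith
  -- `‖rx‖` and `‖ry‖` are at most `ε ^ (3 / 2) ≤ ε / 2`.
  have hsmall : ε ^ 3 ≤ (ε / 2) ^ 2 := by
    have := mul_le_mul_of_nonneg_left hε1 (sq_nonneg ε)
    calc ε ^ 3 = ε ^ 2 * ε := by ring
      _ ≤ _ := by linarith
  have hrx : ‖rx‖ ≤ ε / 2 := by
    rw [← sq_le_sq₀ (norm_nonneg _) (by positivity)]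
    linarith [sq_nonneg ‖ry‖]
  have hry : ‖ry‖ ≤ ε / 2 := by
    rw [← sq_le_sq₀ (norm_nonneg _) (by positivity)]
    linarith [sq_nonneg ‖rx‖]
  refine ⟨?_, ?_, hgap⟩
  · refine infEDist_zero_le (hP.add_mem_upperStationarity hG hGt hρ hz hx) ?_
    have e : (P.penaltySaddle G Gt ε⁻¹).gradX u z + (rx - ((P.penaltySaddle G Gt ε⁻¹).regularize
        (Lhat Lf Lft ε) (ε / (2 * P.Dy)) xk y₀).gradX u z) =
        rx - (2 * Lhat Lf Lft ε) • (u - xk) := by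
      simp only [SaddleProblem.regularize]
      module
    rw [e]
    refine (norm_sub_le _ _).trans ?_
    rw [norm_smul, Real.norm_of_nonneg (by positivity)]
    have h1 := mul_le_mul_of_nonneg_left hstep (by positivity : 0 ≤ 2 * Lhat Lf Lft ε)
    have h2 : 2 * Lhat Lf Lft ε * (ε / (4 * Lhat Lf Lft ε)) = ε / 2 := by field_simp; norm_num
    linarith
  · refine infEDist_zero_le (hP.smul_mem_lowerStationarity (G := G) hGt hρ hu hy) ?_
    have e : ((P.penaltySaddle G Gt ε⁻¹).regularize (Lhat Lf Lft ε) (ε / (2 * P.Dy)) xk y₀).gradY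
        u z - ry - (P.penaltySaddle G Gt ε⁻¹).gradY u z =
        -((ε / (2 * P.Dy)) • (z - y₀)) - ry := by
      simp only [SaddleProblem.regularize]
      module
    rw [e]
    refine (norm_sub_le _ _).trans ?_
    rw [norm_neg, norm_smul, Real.norm_of_nonneg (by positivity)]
    have h1 : ‖z - y₀‖ ≤ P.Dy := by
      rw [← sq_le_sq₀ (norm_nonneg _) hD.le]
      exact hP.sq_dist_Y hz hy₀
    have h2 := mul_le_mul_of_nonneg_left h1 (by positivity : 0 ≤ ε / (2 * P.Dy))
    have h3 : ε / (2 * P.Dy) * P.Dy = ε / 2 := by field_simp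
    linarith

end Assumption
end Problem

/-! ### Growth of the constants -/

open Asymptotics in
/-- `F` is bounded on `S` by a constant multiple of the power `t ^ k`. -/
def PolyBounded {ι : Type} (S : Set ι) (t : ι → ℝ) (k : ℕ) (F : ι → ℝ) : Prop :=
  F =O[𝓟 S] fun i => t i ^ k

namespace PolyBounded

open Asymptotics

variable {ι : Type} {S : Set ι} {t : ι → ℝ} {k l : ℕ} {F H : ι → ℝ}

theorem const (c : ℝ) : PolyBounded S t 0 fun _ => c :=
  isBigO_principal.2 ⟨‖c‖, fun i _ => by simp⟩

theorem base : PolyBounded S t 1 t :=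
  isBigO_principal.2 ⟨1, fun i _ => by simp⟩

theorem add (hF : PolyBounded S t k F) (hH : PolyBounded S t k H) :
    PolyBounded S t k fun i => F i + H i :=
  IsBigO.add hF hH

theorem sub (hF : PolyBounded S t k F) (hH : PolyBounded S t k H) :
    PolyBounded S t k fun i => F i - H i :=
  IsBigO.sub hF hH

theorem mul (hF : PolyBounded S t k F) (hH : PolyBounded S t l H) :
    PolyBounded S t (k + l) fun i => F i * H i := by
  unfold PolyBounded
  simp only [pow_add]
  exact IsBigO.mul hF hH

theorem pow (hF : PolyBounded S t k F) (j : ℕ) : PolyBounded S t (k * j) fun i => F i ^ j := by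
  unfold PolyBounded
  simp only [pow_mul]
  exact IsBigO.pow hF j

theorem of_le (hF : PolyBounded S t k F) (h : ∀ i ∈ S, ‖H i‖ ≤ ‖F i‖) : PolyBounded S t k H :=
  IsBigO.trans (isBigO_principal.2 ⟨1, fun i hi => by rw [one_mul]; exact h i hi⟩) hF

theorem mono (ht : ∀ i ∈ S, 1 ≤ t i) (hF : PolyBounded S t k F) (hkl : k ≤ l) :
    PolyBounded S t l F := by
  refine IsBigO.trans hF (isBigO_principal.2 ⟨1, fun i hi => ?_⟩)
  have h0 : 0 ≤ t i := zero_le_one.trans (ht i hi)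
  rw [one_mul, Real.norm_of_nonneg (pow_nonneg h0 _), Real.norm_of_nonneg (pow_nonneg h0 _)]
  exact pow_le_pow_right₀ (ht i hi) hkl

theorem abs (hF : PolyBounded S t k F) : PolyBounded S t k fun i => |F i| :=
  hF.of_le fun i _ => by simp

theorem max (hF : PolyBounded S t k F) (hH : PolyBounded S t k H) :
    PolyBounded S t k fun i => max (F i) (H i) := by
  refine (hF.abs.add hH.abs).of_le fun i _ => ?_
  rw [Real.norm_eq_abs, Real.norm_of_nonneg (by positivity)]
  refine abs_max_le_max_abs_abs.trans (max_le ?_ ?_)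
  · linarith [abs_nonneg (H i)]
  · linarith [abs_nonneg (F i)]

theorem min (hF : PolyBounded S t k F) (hH : PolyBounded S t k H) :
    PolyBounded S t k fun i => min (F i) (H i) := by
  refine (hF.abs.add hH.abs).of_le fun i _ => ?_
  rw [Real.norm_eq_abs, Real.norm_of_nonneg (by positivity)]
  rcases min_choice (F i) (H i) with h | h <;> rw [h]
  · linarith [abs_nonneg (H i)]
  · linarith [abs_nonneg (F i)]

theorem inv_min (hF : PolyBounded S t k fun i => (F i)⁻¹)
    (hH : PolyBounded S t k fun i => (H i)⁻¹) :
    PolyBounded S t k fun i => (Min.min (F i) (H i))⁻¹ := by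
  refine (hF.abs.add hH.abs).of_le fun i _ => ?_
  rw [Real.norm_eq_abs, Real.norm_of_nonneg (by positivity)]
  rcases min_choice (F i) (H i) with h | h <;> rw [h]
  · linarith [abs_nonneg (H i)⁻¹]
  · linarith [abs_nonneg (F i)⁻¹]

theorem sqrt (ht : ∀ i ∈ S, 1 ≤ t i) (hF : PolyBounded S t 2 F) :
    PolyBounded S t 1 fun i => √(F i) := by
  obtain ⟨c, hc⟩ := isBigO_principal.1 hF
  refine isBigO_principal.2 ⟨√c, fun i hi => ?_⟩
  have h0 : 0 ≤ t i := zero_le_one.trans (ht i hi)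
  have h := hc i hi
  rw [Real.norm_of_nonneg (by positivity : 0 ≤ t i ^ 2)] at h
  rw [Real.norm_of_nonneg (Real.sqrt_nonneg _), pow_one, Real.norm_of_nonneg h0]
  refine (Real.sqrt_le_sqrt ((le_abs_self _).trans h)).trans (le_of_eq ?_)
  rw [Real.sqrt_mul' _ (sq_nonneg _), Real.sqrt_sq h0]

theorem natCeil (ht : ∀ i ∈ S, 1 ≤ t i) (hF : PolyBounded S t k F) :
    PolyBounded S t k fun i => (⌈F i⌉₊ : ℝ) := by
  refine (hF.abs.add ((const (1 : ℝ)).mono ht k.zero_le)).of_le fun i _ => ?_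
  rw [Real.norm_of_nonneg (Nat.cast_nonneg _), Real.norm_of_nonneg (by positivity)]
  exact (Nat.cast_le.2 (Nat.ceil_mono (le_abs_self _))).trans
    (Nat.ceil_lt_add_one (abs_nonneg _)).le

theorem intCeil (ht : ∀ i ∈ S, 1 ≤ t i) (hF : PolyBounded S t k F) :
    PolyBounded S t k fun i => (⌈F i⌉ : ℝ) := by
  refine (hF.abs.add ((const (1 : ℝ)).mono ht k.zero_le)).of_le fun i _ => ?_
  rw [Real.norm_eq_abs, Real.norm_of_nonneg (by positivity), abs_le]
  constructor
  · linarith [neg_abs_le (F i), Int.le_ceil (F i)]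
  · linarith [le_abs_self (F i), Int.ceil_lt_add_one (F i)]

/-- The logarithm of a polynomially bounded function is at most of the order of `log t`. -/
theorem posLog (ht : ∀ i ∈ S, 1 ≤ Real.log (t i)) (hF : PolyBounded S t k F) :
    PolyBounded S (fun i => Real.log (t i)) 1 fun i => Max.max (Real.log (F i)) 0 := by
  obtain ⟨c, hc⟩ := isBigO_principal.1 hF
  set c' := Max.max c 1 with hc'
  have hc1 : 1 ≤ c' := le_max_right _ _
  refine isBigO_principal.2 ⟨Real.log c' + k, fun i hi => ?_⟩
  have hlog := ht i hi
  have hcl : 0 ≤ Real.log c' := Real.log_nonneg hc1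
  have ht0 : t i ≠ 0 := fun h => by rw [h, Real.log_zero] at hlog; linarith
  rw [Real.norm_of_nonneg (le_max_right _ _), pow_one, Real.norm_of_nonneg (by linarith)]
  have h1 : (k : ℝ) * Real.log (t i) + Real.log c' ≤ (Real.log c' + k) * Real.log (t i) := by
    have := mul_le_mul_of_nonneg_left hlog hcl
    linarith
  refine max_le ?_ (mul_nonneg (by positivity) (by linarith))
  by_cases hF0 : F i = 0
  · rw [hF0, Real.log_zero]
    exact mul_nonneg (by positivity) (by linarith)
  have h2 : |F i| ≤ c' * |t i ^ k| :=
    (hc i hi).trans (mul_le_mul_of_nonneg_right (le_max_left _ _) (abs_nonneg _))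
  rw [← Real.log_abs]
  refine (Real.log_le_log (abs_pos.2 hF0) h2).trans ?_
  rw [Real.log_mul (by positivity) (by positivity), Real.log_abs, Real.log_pow]
  linarith

end PolyBounded

namespace Problem

variable {n m : ℕ} {P : Problem n m} {Lf Lft : ℝ}

/-- The accuracies `ε ∈ (0, 1/4]` together with the points of `𝒳 × 𝒴`. -/
def inputs (P : Problem n m) : Set (ℝ × Vec n × Vec m) :=
  {i | (0 < i.1 ∧ i.1 ≤ 1 / 4) ∧ i.2.1 ∈ P.setX ∧ i.2.2 ∈ P.setY}

/-- `PolyBounded` on the inputs of the penalty method, in powers of `ε⁻¹`. -/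
abbrev HasGrowth (P : Problem n m) (k : ℕ) (F : ℝ × Vec n × Vec m → ℝ) : Prop :=
  PolyBounded P.inputs (fun i => i.1⁻¹) k F

theorem four_le_inv_of_mem_inputs {i : ℝ × Vec n × Vec m} (hi : i ∈ P.inputs) : 4 ≤ i.1⁻¹ := by
  rw [le_inv_comm₀ (by norm_num) hi.1.1]
  linarith [hi.1.2]

theorem one_le_inv_of_mem_inputs (i : ℝ × Vec n × Vec m) (hi : i ∈ P.inputs) : 1 ≤ i.1⁻¹ := by
  linarith [four_le_inv_of_mem_inputs hi]

theorem one_le_log_of_mem_inputs (i : ℝ × Vec n × Vec m) (hi : i ∈ P.inputs) :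
    1 ≤ Real.log i.1⁻¹ := by
  have h := four_le_inv_of_mem_inputs hi
  rw [Real.le_log_iff_exp_le (by linarith)]
  linarith [Real.exp_one_lt_d9]

namespace HasGrowth

variable {k l : ℕ} {F H : ℝ × Vec n × Vec m → ℝ}

theorem mono (hF : P.HasGrowth k F) (hkl : k ≤ l) : P.HasGrowth l F :=
  PolyBounded.mono one_le_inv_of_mem_inputs hF hkl

theorem const (c : ℝ) : P.HasGrowth k fun _ => c :=
  mono (PolyBounded.const c) k.zero_le

theorem inv_eps : P.HasGrowth 1 fun i => i.1⁻¹ := PolyBounded.base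

theorem eps : P.HasGrowth k fun i => i.1 :=
  (const (1 / 4)).of_le fun i hi => by
    rw [Real.norm_of_nonneg hi.1.1.le, Real.norm_of_nonneg (by norm_num)]
    exact hi.1.2

/-- Each factor `ε` lowers the order of growth by one. -/
theorem eps_pow_mul (hF : P.HasGrowth (k + l) F) : P.HasGrowth k fun i => i.1 ^ l * F i := by
  obtain ⟨c, hc⟩ := Asymptotics.isBigO_principal.1 hF
  refine Asymptotics.isBigO_principal.2 ⟨c, fun i hi => ?_⟩
  have h := mul_le_mul_of_nonneg_left (hc i hi) (norm_nonneg (i.1 ^ l))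
  rw [← norm_mul] at h
  refine h.trans (le_of_eq ?_)
  rw [mul_left_comm, ← norm_mul, pow_add, mul_left_comm, ← mul_pow, mul_inv_cancel₀ hi.1.1.ne',
    one_pow, mul_one]

end HasGrowth

namespace Assumption

theorem Lhat_growth : P.HasGrowth 1 fun i => Lhat Lf Lft i.1 := by
  unfold Lhat
  exact (HasGrowth.const Lf).add (((HasGrowth.const (k := 0) 2).mul HasGrowth.inv_eps).mul
    (HasGrowth.const (k := 0) Lft))

theorem inv_Lhat_growth (hP : P.Assumption Lf Lft) (hL : 0 < Lf + Lft) :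
    P.HasGrowth 0 fun i => (Lhat Lf Lft i.1)⁻¹ :=
  (HasGrowth.const (Lf + Lft)⁻¹).of_le fun i hi => by
    have h := add_le_Lhat (Lf := Lf) hP.Lft_nonneg hi.1.1 hi.1.2
    have h' := inv_anti₀ hL h
    rwa [Real.norm_of_nonneg (inv_nonneg.2 (hL.le.trans h)),
      Real.norm_of_nonneg (inv_nonneg.2 hL.le)]

theorem f_growth (hP : P.Assumption Lf Lft) :
    P.HasGrowth 0 fun i => (P.f (stack i.2.1 i.2.2)).toReal := by
  obtain ⟨c, hc⟩ := hP.exists_fReal_le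
  refine (HasGrowth.const (|c| + |P.fLow|)).of_le fun i hi => ?_
  have hu : stack i.2.1 i.2.2 ∈ P.setXY := hi.2
  rw [hP.f_eq hu, EReal.toReal_coe, Real.norm_eq_abs, Real.norm_of_nonneg (by positivity), abs_le]
  constructor
  · linarith [hP.fLow_le hu, neg_abs_le P.fLow, abs_nonneg c]
  · linarith [hc _ hu, le_abs_self c, abs_nonneg P.fLow]

theorem sqrt_growth : P.HasGrowth 1 fun i => √(P.Dy * Lhat Lf Lft i.1 * i.1⁻¹) :=
  PolyBounded.sqrt one_le_inv_of_mem_inputs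
    (((HasGrowth.const (k := 0) P.Dy).mul Lhat_growth).mul HasGrowth.inv_eps)

theorem alphaHat_growth : P.HasGrowth 0 fun i => P.alphaHat Lf Lft i.1 :=
  (HasGrowth.const 1).of_le fun i _ => by
    have h : 0 ≤ P.alphaHat Lf Lft i.1 := le_min zero_le_one (Real.sqrt_nonneg _)
    rw [Real.norm_of_nonneg h, norm_one]
    exact alphaHat_le_one

theorem inv_alphaHat_growth (hP : P.Assumption Lf Lft) (hL : 0 < Lf + Lft) (hD : 0 < P.Dy) :
    P.HasGrowth 1 fun i => (P.alphaHat Lf Lft i.1)⁻¹ := by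
  refine ((HasGrowth.const 2).max (sqrt_growth (Lf := Lf) (Lft := Lft))).of_le fun i hi => ?_
  have hLh : 0 < Lhat Lf Lft i.1 := hL.trans_le (add_le_Lhat hP.Lft_nonneg hi.1.1 hi.1.2)
  have hα := alphaHat_pos (P := P) hLh hD hi.1.1
  have h := two_div_alphaHat_le (P := P) hLh hD hi.1.1
  rw [Real.norm_of_nonneg (by positivity), Real.norm_of_nonneg (by positivity)]
  refine le_trans ?_ h
  rw [← one_div]
  gcongr
  norm_num

theorem deltaHat_growth (hP : P.Assumption Lf Lft) (hL : 0 < Lf + Lft) (hD : 0 < P.Dy) :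
    P.HasGrowth 2 fun i => P.deltaHat Lf Lft i.1 := by
  unfold deltaHat
  have hα := hP.inv_alphaHat_growth hL hD
  refine PolyBounded.add ((((HasGrowth.const 2).add hα).mul
    (HasGrowth.const (k := 0) (P.Dx ^ 2 + P.Dy ^ 2))).mul Lhat_growth) ?_
  refine ((PolyBounded.max (k := 2) ?_ ?_).mul (HasGrowth.const (k := 0) (P.Dy ^ 2)))
  · simp only [div_eq_mul_inv]
    exact HasGrowth.eps.mul (HasGrowth.const (k := 0) P.Dy⁻¹)
  · simp only [div_eq_mul_inv]
    exact HasGrowth.mono ((alphaHat_growth.mul Lhat_growth).mul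
      (HasGrowth.const (k := 0) (4 : ℝ)⁻¹)) (by norm_num)

/-- The factors of `Ĉ` are of the orders `ε⁻¹`, `ε⁻²`, `ε⁻⁶` and `ε⁻³`; only its logarithm matters. -/
theorem CHat_growth (hP : P.Assumption Lf Lft) (hL : 0 < Lf + Lft) (hD : 0 < P.Dy) :
    P.HasGrowth 12 fun i => P.CHat Lf Lft i.1 := by
  have hα := hP.inv_alphaHat_growth hL hD
  have hLi := hP.inv_Lhat_growth hL
  have hLg := Lhat_growth (P := P) (Lf := Lf) (Lft := Lft)
  have hμ : P.HasGrowth 0 fun i => i.1 / (2 * P.Dy) := by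
    simp only [div_eq_mul_inv]
    exact HasGrowth.eps.mul (HasGrowth.const (k := 0) (2 * P.Dy)⁻¹)
  have hμi : P.HasGrowth 1 fun i => (i.1 / (2 * P.Dy))⁻¹ := by
    simp only [div_eq_mul_inv, mul_inv _ (2 * P.Dy)⁻¹, inv_inv]
    exact HasGrowth.inv_eps.mul (HasGrowth.const (k := 0) (2 * P.Dy))
  have h3L : P.HasGrowth 1 fun i => 3 * Lhat Lf Lft i.1 := (HasGrowth.const (k := 0) 3).mul hLg
  -- The smoothness constant divided by the strong convexity constants.
  have hQ : P.HasGrowth 3 fun i => (3 * Lhat Lf Lft i.1 + i.1 / (2 * P.Dy)) ^ 2 /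
      min (Lhat Lf Lft i.1) (i.1 / (2 * P.Dy)) + 3 * Lhat Lf Lft i.1 + i.1 / (2 * P.Dy) := by
    refine PolyBounded.add (PolyBounded.add ?_ (h3L.mono (by norm_num))) (hμ.mono (by norm_num))
    simp only [div_eq_mul_inv (_ ^ 2)]
    exact ((h3L.add (hμ.mono (by norm_num))).pow 2).mul
      (PolyBounded.inv_min (hLi.mono (by norm_num)) hμi)
  have hM : P.HasGrowth 1 fun i => max (1 / (2 * Lhat Lf Lft i.1))
      (min (P.Dy / i.1) (4 / (P.alphaHat Lf Lft i.1 * Lhat Lf Lft i.1))) := by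
    refine PolyBounded.max ?_ (PolyBounded.min ?_ ?_)
    · simp only [one_div, mul_inv]
      exact HasGrowth.mono ((HasGrowth.const (k := 0) (2 : ℝ)⁻¹).mul hLi) (by norm_num)
    · simp only [div_eq_mul_inv]
      exact (HasGrowth.const (k := 0) P.Dy).mul HasGrowth.inv_eps
    · simp only [div_eq_mul_inv, mul_inv]
      exact (HasGrowth.const (k := 0) 4).mul (hα.mul hLi)
  have hΨ : P.HasGrowth 2 fun i => P.deltaHat Lf Lft i.1 + 2 * (P.alphaHat Lf Lft i.1)⁻¹ *
      (P.fStar - P.fLow + i.1⁻¹ * (P.ftHi - P.ftLow) + i.1 * P.Dy / 4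
        + Lhat Lf Lft i.1 * (P.Dx ^ 2 + P.Dy ^ 2)) := by
    refine (hP.deltaHat_growth hL hD).add
      (PolyBounded.mul (k := 1) (l := 1) ((HasGrowth.const (k := 0) 2).mul hα) ?_)
    refine PolyBounded.add (PolyBounded.add (PolyBounded.add (HasGrowth.const _)
      (HasGrowth.inv_eps.mul (HasGrowth.const (k := 0) _))) ?_)
      (hLg.mul (HasGrowth.const (k := 0) _))
    simp only [div_eq_mul_inv]
    exact (HasGrowth.eps.mul (HasGrowth.const (k := 0) _)).mul (HasGrowth.const (k := 0) _)
  refine ((((HasGrowth.const (k := 0) 4).mul hM).mul hΨ).mul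
    ((hQ.pow 2).mul (HasGrowth.inv_eps.pow 3))).of_le fun i _ => le_of_eq (congrArg _ ?_)
  unfold CHat
  rw [div_eq_mul_inv _ (_⁻¹ * _), mul_inv, inv_inv, inv_pow]

theorem KHat_growth (hP : P.Assumption Lf Lft) :
    P.HasGrowth 3 fun i => (P.KHat Lf Lft i.1 i.2.1 i.2.2 : ℝ) := by
  have hLg := Lhat_growth (P := P) (Lf := Lf) (Lft := Lft)
  unfold KHat
  refine PolyBounded.natCeil one_le_inv_of_mem_inputs ?_
  simp only [← inv_pow]
  refine PolyBounded.sub (PolyBounded.add ?_ ?_) (HasGrowth.const 1)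
  · refine PolyBounded.mul (k := 1) (l := 2) (PolyBounded.mul (k := 0) (l := 1)
      (PolyBounded.mul (k := 0) (l := 0) (HasGrowth.const 16) ?_) hLg) (HasGrowth.inv_eps.pow 2)
    refine PolyBounded.add (((HasGrowth.const 1).add hP.f_growth).sub (HasGrowth.const _)) ?_
    simp only [div_eq_mul_inv]
    exact (HasGrowth.eps.mul (HasGrowth.const (k := 0) _)).mul (HasGrowth.const (k := 0) _)
  · simp only [mul_comm _ (_ : ℝ × Vec n × Vec m).1]
    have h : P.HasGrowth (3 + 1) fun i => 32 * (1 + 4 * P.Dy ^ 2 * Lhat Lf Lft i.1 ^ 2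
        * i.1⁻¹ ^ 2) :=
      (HasGrowth.const (k := 0) 32).mul ((HasGrowth.const 1).add
        ((((HasGrowth.const (k := 0) (4 * P.Dy ^ 2))).mul (hLg.pow 2)).mul
          (HasGrowth.inv_eps.pow 2)))
    simpa only [pow_one] using h.eps_pow_mul

theorem gapFactor_growth (hP : P.Assumption Lf Lft) (hL : 0 < Lf + Lft) :
    P.HasGrowth 0 fun i => P.gapFactor Lf Lft i.1 i.2.1 i.2.2 := by
  have hLg := Lhat_growth (P := P) (Lf := Lf) (Lft := Lft)
  unfold gapFactor
  refine PolyBounded.add (PolyBounded.add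
    (((HasGrowth.const 1).add hP.f_growth).sub (HasGrowth.const _)) ?_) ?_
  · simp only [mul_comm (2 : ℝ), mul_assoc (_ ^ 3 : ℝ), ← inv_pow]
    refine HasGrowth.eps_pow_mul (PolyBounded.mul (k := 3) (l := 0) (PolyBounded.add
      ((hP.inv_Lhat_growth hL).mono (by norm_num)) ?_) (HasGrowth.const 2))
    exact (((HasGrowth.const (k := 0) 4).mul (HasGrowth.const (k := 0) (P.Dy ^ 2))).mul hLg).mul
      (HasGrowth.inv_eps.pow 2)
  · simp only [div_eq_mul_inv]
    exact ((HasGrowth.const (k := 0) _).mul (HasGrowth.eps (k := 0))).mul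
      (HasGrowth.const (k := 0) _)

open Asymptotics in
/-- The factors of `N̂` are of the orders `1`, `ε⁻¹` and `ε⁻³ log ε⁻¹`. -/
theorem NHat_isBigO (hP : P.Assumption Lf Lft) (hL : 0 < Lf + Lft) (hD : 0 < P.Dy) :
    (fun i : ℝ × Vec n × Vec m => P.NHat Lf Lft i.1 i.2.1 i.2.2) =O[𝓟 P.inputs]
      fun i => (i.1 ^ 4)⁻¹ * Real.log i.1⁻¹ := by
  have hLg := Lhat_growth (P := P) (Lf := Lf) (Lft := Lft)
  have hK := hP.KHat_growth
  have hK1 : P.HasGrowth 3 fun i => (P.KHat Lf Lft i.1 i.2.1 i.2.2 : ℝ) + 1 :=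
    hK.add (HasGrowth.const 1)
  have hlogC := (hP.CHat_growth hL hD).posLog one_le_log_of_mem_inputs
  have hlogK : PolyBounded P.inputs (fun i => Real.log i.1⁻¹) 1
      fun i => Real.log ((P.KHat Lf Lft i.1 i.2.1 i.2.2 : ℝ) + 1) := by
    refine (hK1.posLog one_le_log_of_mem_inputs).of_le fun i _ => ?_
    rw [max_eq_left (log_add_one_nonneg _)]
  have hone : PolyBounded P.inputs (fun i => Real.log i.1⁻¹) 1 fun _ => 1 :=
    (PolyBounded.const 1).mono one_le_log_of_mem_inputs (by norm_num)
  have h1 : P.HasGrowth 0 fun i =>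
      (⌈96 * √2 * (1 + (24 * Lhat Lf Lft i.1 + 4 * i.1 / P.Dy) * (Lhat Lf Lft i.1)⁻¹)⌉ : ℝ) + 2 := by
    refine PolyBounded.add (PolyBounded.intCeil one_le_inv_of_mem_inputs ?_) (HasGrowth.const 2)
    refine PolyBounded.mul (k := 0) (l := 0) (HasGrowth.const (96 * √2))
      (PolyBounded.add (HasGrowth.const 1) ?_)
    simp only [add_mul]
    refine PolyBounded.add ((HasGrowth.const 24).of_le fun i hi => ?_) ?_
    · have h := hL.trans_le (add_le_Lhat (Lf := Lf) hP.Lft_nonneg hi.1.1 hi.1.2)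
      rw [mul_assoc, mul_inv_cancel₀ h.ne', mul_one]
    · simp only [div_eq_mul_inv]
      exact (((HasGrowth.const (k := 0) 4).mul (HasGrowth.eps (k := 0))).mul
        (HasGrowth.const (k := 0) _)).mul (hP.inv_Lhat_growth hL)
  have h2 : P.HasGrowth 1 fun i => max 2 √(P.Dy * Lhat Lf Lft i.1 * i.1⁻¹) :=
    (HasGrowth.const 2).max sqrt_growth
  have h3 : (fun i : ℝ × Vec n × Vec m => ((P.KHat Lf Lft i.1 i.2.1 i.2.2 : ℝ) + 1)
      * max (Real.log (P.CHat Lf Lft i.1)) 0 + P.KHat Lf Lft i.1 i.2.1 i.2.2 + 1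
      + 2 * P.KHat Lf Lft i.1 i.2.1 i.2.2 * Real.log (P.KHat Lf Lft i.1 i.2.1 i.2.2 + 1))
      =O[𝓟 P.inputs] fun i => i.1⁻¹ ^ 3 * Real.log i.1⁻¹ ^ 1 := by
    refine ((IsBigO.mul hK1 hlogC).add (IsBigO.mul hK1 hone)).add
      (IsBigO.mul ((HasGrowth.const (P := P) (k := 0) 2).mul hK) hlogK) |>.congr_left fun i => ?_
    ring
  refine (IsBigO.mul (h1.mul h2) h3).congr (fun i => rfl) fun i => ?_
  rw [← inv_pow]
  ring

end Assumption

end Problem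
end Bilevel

theorem mainTheorem1 {n m : ℕ} (P : Bilevel.Problem n m) (Lf Lft : ℝ)
    (hP : P.Assumption Lf Lft) (hL : 0 < Lf + Lft) (hD : 0 < P.Dy)
    (G Gt : Bilevel.Pair n m → Bilevel.Pair n m)
    (hG : Bilevel.IsGradientOracle Lf P.f₁ P.setXY G)
    (hGt : Bilevel.IsGradientOracle Lft P.ft₁ P.setXY Gt) :
    (∀ ε : ℝ, 0 < ε → ε ≤ 1 / 4 → ∀ x₀ ∈ P.setX, ∀ y₀ ∈ P.setY,
      P.ft (Bilevel.stack x₀ y₀) ≤ P.lowerValue x₀ + (ε : EReal) →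
      ∃ (x : Bilevel.Vec n) (y z : Bilevel.Vec m) (c : Bilevel.Cost),
        ((Bilevel.stack x y, z), c) ∈ P.penaltyMethod G Gt Lf Lft ε x₀ y₀ ⟨0, 0, 0, 0⟩ ∧
        Metric.infEDist 0 (P.upperStationarity ε⁻¹ x y z) ≤ ENNReal.ofReal ε ∧
        Metric.infEDist 0 (P.lowerStationarity ε⁻¹ x z) ≤ ENNReal.ofReal ε ∧
        P.ft (Bilevel.stack x y)
          ≤ P.lowerValue x + ((ε * P.gapFactor Lf Lft ε x₀ y₀ : ℝ) : EReal) ∧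
        (c.gradF : ℝ) ≤ P.NHat Lf Lft ε x₀ y₀ ∧
        (c.gradFt : ℝ) ≤ P.NHat Lf Lft ε x₀ y₀ ∧
        (c.proxF : ℝ) ≤ P.NHat Lf Lft ε x₀ y₀ ∧
        (c.proxFt : ℝ) ≤ P.NHat Lf Lft ε x₀ y₀) ∧
    ∃ C : ℝ, ∀ ε : ℝ, 0 < ε → ε ≤ 1 / 4 → ∀ x₀ ∈ P.setX, ∀ y₀ ∈ P.setY,
      P.NHat Lf Lft ε x₀ y₀ ≤ C * ((ε ^ 4)⁻¹ * Real.log ε⁻¹) ∧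
      P.gapFactor Lf Lft ε x₀ y₀ ≤ C := by
  refine ⟨fun ε hε hε1 x₀ hx₀ y₀ hy₀ h₀ => ?_, ?_⟩
  · obtain ⟨g, hg, hrun⟩ := hP.penaltyMethod_ensures hL hD hG hGt hε hε1 hx₀ hy₀ h₀
    obtain ⟨⟨u, z⟩, c, hc, ⟨xk, -, hr, hstep, hval⟩, h1, h2, h3, h4⟩ := hrun ⟨0, 0, 0, 0⟩
    obtain ⟨hup, hlow, hgap⟩ :=
      hP.penaltyMethod_stationarity hL hD hG hGt hε hε1 hx₀ hy₀ hr hstep hval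
    simp only [zero_add] at h1 h2 h3 h4
    exact ⟨u.fst, u.snd, z, c, hc, hup, hlow, hgap, (Nat.cast_le.2 h1).trans hg,
      (Nat.cast_le.2 h2).trans hg, (Nat.cast_le.2 h3).trans hg, (Nat.cast_le.2 h4).trans hg⟩
  · obtain ⟨C₁, h₁⟩ := Asymptotics.isBigO_principal.1 (hP.NHat_isBigO hL hD)
    obtain ⟨C₂, h₂⟩ := Asymptotics.isBigO_principal.1 (hP.gapFactor_growth hL)
    refine ⟨max C₁ C₂, fun ε hε hε1 x₀ hx₀ y₀ hy₀ => ?_⟩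
    have hi : (ε, x₀, y₀) ∈ P.inputs := ⟨⟨hε, hε1⟩, hx₀, hy₀⟩
    constructor
    · have hlog : 0 ≤ Real.log ε⁻¹ :=
        zero_le_one.trans (Bilevel.Problem.one_le_log_of_mem_inputs _ hi)
      have h := h₁ _ hi
      rw [Real.norm_of_nonneg (mul_nonneg (inv_nonneg.2 (pow_nonneg hε.le 4)) hlog)] at h
      exact ((le_abs_self _).trans h).trans
        (mul_le_mul_of_nonneg_right (le_max_left _ _) (by positivity))
    · have h := h₂ _ hi
      rw [pow_zero, norm_one, mul_one] at h
      exact ((le_abs_self _).trans h).trans (le_max_right _ _)
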